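/- **Setting.** Let $K$ be a field, $n\ge 1$, and let $I\subsetneq K[x_1,\dots,x_n]$ be an ideal in *shape position*: its reduced Gröbner basis with respect to LEX ($x_1<\dots<x_n$) has the form $[f_1(x_1),\,x_2-f_2(x_1),\dots,x_n-f_n(x_1)]$. Let $<_1$ be any term ordering, $\epsilon_1=1,\dots,\epsilon_D$ the terms that are not leading terms of elements of $I$, in increasing order (so $D=\dim_K K[x_1,\dots,x_n]/I$), and $T_i\in K^{D\times D}$ the multiplication matrix of $x_i$: its $j$-th column holds the coordinates of the normal form of $\epsilon_jx_i$ in the $\epsilon_k$. Let $N_1$ be the number of nonzero entries of $T_1$, $e_k$ the $k$-th unit vector of $K^D$, $e=e_1$ and $v_j=T_je$ (the normal form of $x_j$) for $j=2,\dots,n$. The input of the method is $T_1$, as a sparse matrix, together with $v_2,\dots,v_n$. **Method.** 1. (*Deterministic Wiedemann algorithm.*) Put $b_0=e$. For $k=1,2,\dots$, as long as $b_{k-1}\ne0$, let $f_{1,k}$ be the minimal polynomial of the sequence $[\langle e_k,T_1^ib_{k-1}\rangle : 0\le i<2(D-\sum_{l<k}\deg f_{1,l})]$ and $b_k=f_{1,k}(T_1)b_{k-1}$.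 When $b_r=0$, put $f_1=f_{1,1}\cdots f_{1,r}$; return "Fail" if $\deg f_1\ne D$. 2. (*Hankel systems.*) For $i\le r$, $d_i=\deg f_{1,i}$ and $2\le j\le n$, solve $\sum_{l<d_i}\langle e_i,T_1^{a+l}b_{i-1}\rangle c_l=\langle e_i,T_1^a(f_{1,1}\cdots f_{1,i-1})(T_1)v_j\rangle$ $(0\le a<d_i)$ and put $f_{j,i}=\sum_l c_lx_1^l$. Let $P_i=[f_{1,i},x_2-f_{2,i},\dots,x_n-f_{n,i}]$. 3. (*Squarefree splitting.*) Let $\bar f_1$ be the squarefree part of $f_1$ (the product of its distinct monic irreducible factors). If $\bar f_1=f_1$, keep all the $P_i$. Otherwise put $p=\bar f_1$; for $i=1,2,\dots$ until $p=1$, let $g=\gcd(f_{1,i},p)$, keep $[g,x_2-(f_{2,i}\bmod g),\dots,x_n-(f_{n,i}\bmod g)]$ if $g\ne1$, and replace $p$ by $p/g$. 4. (*CRT.*) For $2\le j\le n$ find the polynomial $g_j$ with $\deg g_j<\deg\bar f_1$ that is congruent, for each kept set $[g,x_2-h_2,\dots,x_n-h_n]$, to $h_j$ modulo $g$. Return $[\bar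 f_1,x_2-g_2,\dots,x_n-g_n]$. **Theorem.** (a) *Correctness* (every field $K$). The method does not fail, and all its steps are well defined with unique results: step 1 stops after $r\le D$ rounds, the Hankel matrices are invertible, the univariate polynomials of the kept sets are pairwise coprime with product $\bar f_1$, and the congruences have a unique solution. The returned set is the reduced LEX Gröbner basis of $\sqrt I$. (b) *Complexity.* The number of operations is counted in the model of algebraic computation trees: deterministic programs that access field elements only by $+,-,\times,\div$, the constant $1$ and tests for zero, each of which counts as one operation. There is one program for each value of the discrete data $n$, $D$, $p=\operatorname{char}K$, $q=|K|$ and the set of positions of the nonzero entries of $T_1$, and the program does not depend on anything else. There are such a family of programs and an absolute constant $C$ such that, whenever $\operatorname{char}K=0$, or $\operatorname{char}K>D$, or $K$ is finite, the program computes from $T_1,v_2,\dots,v_n$ all polynomials of the method (those of all the $P_i$, of all the kept sets, and of the returned set) with at most $$C\cdot D\bigl(N_1+D(\log D\,\log\log D+n)\bigr)$$ operations if $\operatorname{char}K=0$ or $\operatorname{char}K>D$, and with at most $$C\cdot\Bigl(D\bigl(N_1+D(\log D\,\log\log D+n)\bigr)+D\log(q/p)\Bigr)$$ operations if $K$ is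 a finite field with $q$ elements and characteristic $p$. In particular, the number of operations is $O(D(N_1+D(\log D\log\log D+n)))$ over each fixed finite field and, with an absolute constant, in characteristic $0$. (For $D=1$ the term $\log D\log\log D$ is read as $0$.) -/

import Mathlib

open Polynomial Matrix

universe u w

noncomputable section

/-! ## Gröbner bases, canonical bases and multiplication matrices -/

/-- The lexicographic term order on `n` variables with `x_1 < x_2 < ⋯ < x_n`.
(`MonomialOrder.lex` makes the variable with the smallest index the largest one, so the
index set is reversed.) -/
def lexOrder (n : ℕ) : MonomialOrder (Fin n) where
  syn := Lex ((Fin n)ᵒᵈ →₀ ℕ)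
  toSyn := (Finsupp.domCongr OrderDual.toDual).trans
    { toEquiv := toLex, map_add' := toLex_add }
  toSyn_monotone := by
    intro a b h
    refine Finsupp.toLex_monotone ?_
    intro i
    exact h (OrderDual.ofDual i)

section Groebner

variable {K : Type u} [Field K] {n : ℕ}

/-- `G` is the (reduced) Gröbner basis of `I` with respect to the term order `ord`. -/
def IsReducedGroebnerBasis (ord : MonomialOrder.{0, w} (Fin n))
    (G : Set (MvPolynomial (Fin n) K)) (I : Ideal (MvPolynomial (Fin n) K)) : Prop :=
  (∀ g ∈ G, g ∈ I) ∧
  (∀ g ∈ G, ord.leadingCoeff g = 1) ∧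
  (∀ f ∈ I, f ≠ 0 → ∃ g ∈ G, ord.degree g ≤ ord.degree f) ∧
  (∀ g ∈ G, ∀ g' ∈ G, g' ≠ g → ∀ s ∈ g.support, ¬ ord.degree g' ≤ s)

/-- `[ε_1, …, ε_D]` is the canonical basis of the quotient by `I` with respect to `ord`: the
terms that are not leading terms of elements of `I`, in increasing order. -/
def IsCanonicalBasis (ord : MonomialOrder.{0, w} (Fin n)) (I : Ideal (MvPolynomial (Fin n) K))
    {D : ℕ} (ε : Fin D → (Fin n →₀ ℕ)) : Prop :=
  StrictMono (fun i => ord.toSyn (ε i)) ∧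
  Set.range ε = {s | ∀ f ∈ I, f ≠ 0 → ord.degree f ≠ s}

/-- `T` is the multiplication matrix of `x_i`: its `j`-th column is the coordinate vector, in the
terms `ε_1, …, ε_D`, of the normal form of `ε_j x_i` modulo `I`. -/
def IsMultiplicationMatrix (I : Ideal (MvPolynomial (Fin n) K)) {D : ℕ}
    (ε : Fin D → (Fin n →₀ ℕ)) (i : Fin n) (T : Matrix (Fin D) (Fin D) K) : Prop :=
  ∀ j, MvPolynomial.monomial (ε j) 1 * MvPolynomial.X i
    - ∑ k, MvPolynomial.monomial (ε k) (T k j) ∈ I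

/-- The polynomial set `[f(x_1), x_2 - h_2(x_1), …, x_n - h_n(x_1)]`, where `n = m + 1`. -/
def shapeSet {m : ℕ} (f : K[X]) (h : Fin m → K[X]) : Set (MvPolynomial (Fin (m + 1)) K) :=
  insert (aeval (MvPolynomial.X 0) f)
    (Set.range fun j : Fin m => MvPolynomial.X j.succ - aeval (MvPolynomial.X 0) (h j))

/-- `I` is in shape position: its LEX Gröbner basis is
`[f_1(x_1), x_2 - f_2(x_1), …, x_n - f_n(x_1)]`. -/
def InShapePosition {m : ℕ} (I : Ideal (MvPolynomial (Fin (m + 1)) K)) : Prop :=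
  ∃ (f : K[X]) (h : Fin m → K[X]), IsReducedGroebnerBasis (lexOrder (m + 1)) (shapeSet f h) I

end Groebner

/-! ## The deterministic method -/

/-- The data computed by the method, with polynomials (in `x_1`) represented by a type `P`.
A pair `(f, h)` stands for the polynomial set `[f, x_2 - h_2, …, x_n - h_n]`, `n = m + 1`. -/
structure MethodTrace (P : Type*) (m : ℕ) where
  /-- the sets `P_1, …, P_r` obtained from the Wiedemann factors and the Hankel systems -/
  systems : List (P × (Fin m → P))
  /-- the sets to which the Chinese remainder theorem is applied -/
  parts : List (P × (Fin m → P))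
  /-- the returned set -/
  result : P × (Fin m → P)

/-- Change the representation of the polynomials in a trace. -/
def MethodTrace.map {P Q : Type*} {m : ℕ} (φ : P → Q) (t : MethodTrace P m) :
    MethodTrace Q m where
  systems := t.systems.map fun s => (φ s.1, fun j => φ (s.2 j))
  parts := t.parts.map fun s => (φ s.1, fun j => φ (s.2 j))
  result := (φ t.result.1, fun j => φ (t.result.2 j))

section Method

variable {K : Type u} [Field K] {D m : ℕ}

/-- The polynomial `g = ∑ g_i x^i` is the characteristic polynomial of a linear recurrence
satisfied by the finite sequence `[s_0, …, s_{N-1}]`. -/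
def IsRecurrence (s : ℕ → K) (N : ℕ) (g : K[X]) : Prop :=
  ∀ j, j + g.natDegree < N → ∑ i ∈ Finset.range (g.natDegree + 1), g.coeff i * s (i + j) = 0

/-- `g` is the minimal polynomial of the finite sequence `[s_0, …, s_{N-1}]`, that is, the output
of the Berlekamp--Massey algorithm on it. -/
def IsMinimalPolynomial (s : ℕ → K) (N : ℕ) (g : K[X]) : Prop :=
  g.Monic ∧ IsRecurrence s N g ∧
    ∀ g' : K[X], g'.Monic → IsRecurrence s N g' → g.natDegree ≤ g'.natDegree

/-- The `d × d` Hankel matrix of a sequence. -/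
def hankel (d : ℕ) (s : ℕ → K) : Matrix (Fin d) (Fin d) K :=
  Matrix.of fun a c => s (a + c)

/-- The sequence `⟨e_k, T^i b⟩`, `i = 0, 1, …`, with `e_k` the `k`-th unit vector. -/
def krylovSeq (T : Matrix (Fin D) (Fin D) K) (k : Fin D) (b : Fin D → K) (i : ℕ) : K :=
  ((T ^ i) *ᵥ b) k

/-- The coordinate vector `(1, 0, …, 0)ᵗ` of the term `1`. -/
def unitVec (K : Type u) [Field K] (D : ℕ) : Fin D → K :=
  fun i => if (i : ℕ) = 0 then 1 else 0

/-- The rounds of the deterministic Wiedemann algorithm with the Hankel systems of the factors.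
The unit vectors are numbered from `0`. On entry to the round with number `k`, the product `f` of
the factors found so far has degree `d`, `b = f(T) e`, and `v j = f(T) v_j`. If `b = 0`, the
algorithm stops. Otherwise the round yields the minimal polynomial `g` of
`[⟨e_k, T^i b⟩ : i = 0, …, 2(D - d) - 1]` and, for each `j`, the polynomial `h j` of degree less
than `deg g` whose coefficient vector `c` is the solution of the Hankel system
`∑_l ⟨e_k, T^(a + l) b⟩ c_l = ⟨e_k, T^a f(T) v_j⟩`, `a = 0, …, deg g - 1`; the Hankel matrix is
required to be invertible. -/
def IsWiedemannRun (T : Matrix (Fin D) (Fin D) K) :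
    (k d : ℕ) → (b : Fin D → K) → (v : Fin m → Fin D → K) →
      List (K[X] × (Fin m → K[X])) → Prop
  | _, _, b, _, [] => b = 0
  | k, d, b, v, (g, h) :: rest =>
      b ≠ 0 ∧
      (∃ hk : k < D,
        IsMinimalPolynomial (krylovSeq T ⟨k, hk⟩ b) (2 * (D - d)) g ∧
        IsUnit (hankel g.natDegree (krylovSeq T ⟨k, hk⟩ b)).det ∧
        ∀ j, (h j).degree < g.degree ∧
          hankel g.natDegree (krylovSeq T ⟨k, hk⟩ b) *ᵥ (fun l => (h j).coeff (l : ℕ))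
            = fun a : Fin g.natDegree => krylovSeq T ⟨k, hk⟩ (v j) a) ∧
      IsWiedemannRun T (k + 1) (d + g.natDegree)
        (aeval T g *ᵥ b) (fun j => aeval T g *ᵥ v j) rest

open Classical in
/-- The squarefree splitting. Going through the sets `[g, x_2 - h_2, …, x_n - h_n]`, take the
monic `g' = gcd(g, p)`; if `g' ≠ 1`, keep `[g', x_2 - (h_2 mod g'), …, x_n - (h_n mod g')]`;
replace `p` by `p / g'` and stop as soon as `p = 1`. -/
def squarefreeSplit : (p : K[X]) → List (K[X] × (Fin m → K[X])) → List (K[X] × (Fin m → K[X]))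
  | _, [] => []
  | p, (g, h) :: rest =>
      if p = 1 then [] else
        let g' := normalize (EuclideanDomain.gcd g p)
        if g' = 1 then squarefreeSplit p rest
        else (g', fun j => h j %ₘ g') :: squarefreeSplit (p /ₘ g') rest

open Classical in
/-- `t` is the record of a successful (that is, not returning "Fail") run of the deterministic
method on the multiplication matrix `T` of `x_1` and the coordinate vectors `v` of
`x_2, …, x_n`. Here `f_1` is the product of the Wiedemann factors, which has to have degree `D`,
and `radical f_1` is its squarefree part (the product of its distinct monic irreducible
factors). -/
def IsMethodRun (T : Matrix (Fin D) (Fin D) K) (v : Fin m → Fin D → K)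
    (t : MethodTrace K[X] m) : Prop :=
  let f₁ : K[X] := (t.systems.map Prod.fst).prod
  let sf : K[X] := UniqueFactorizationMonoid.radical f₁
  IsWiedemannRun T 0 0 (unitVec K D) v t.systems ∧
  f₁.natDegree = D ∧
  t.parts = (if sf = f₁ then t.systems else squarefreeSplit sf t.systems) ∧
  (t.parts.map Prod.fst).prod = sf ∧
  (t.parts.map Prod.fst).Pairwise IsCoprime ∧
  t.result.1 = sf ∧
  ∀ j, (t.result.2 j).degree < sf.degree ∧ ∀ s ∈ t.parts, s.1 ∣ t.result.2 j - s.2 j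

end Method

/-! ## Deterministic algebraic programs and the number of field operations -/

/-- The four field operations. -/
inductive FieldOp
  | add
  | sub
  | mul
  | div

/-- Deterministic algebraic programs (algebraic computation trees) over input registers `ι`, work
registers `ℕ`, returning a value in `α`. A program does not mention a field: the same program can
be run over every field. It has access to field elements only through the four field operations,
the constant `1` and tests for zero. -/
inductive AlgProgram (ι α : Type) : Type
  /-- stop and return -/
  | ret (a : α)
  /-- put the constant `1` into the work register `dst` -/
  | one (dst : ℕ) (next : AlgProgram ι α)
  /-- put the result of a field operation into the work register `dst` -/
  | arith (op : FieldOp) (dst : ℕ) (x y : ι ⊕ ℕ) (next : AlgProgram ι α)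
  /-- branch according to whether a register is zero -/
  | ifZero (x : ι ⊕ ℕ) (yes no : AlgProgram ι α)

section Run

variable {K : Type u} [Field K]

open Classical in
/-- The value of a field operation; division by zero is undefined. -/
def FieldOp.eval : FieldOp → K → K → Option K
  | .add, a, b => some (a + b)
  | .sub, a, b => some (a - b)
  | .mul, a, b => some (a * b)
  | .div, a, b => if b = 0 then none else some (a / b)

open Classical in
/-- Run a program on the register contents `μ`. The result consists of the returned value, the
final register contents, and the number of executed operations, where each field operation, each
test for zero and each use of the constant `1` counts as one. An attempt to divide by zero makes
the run fail. -/
def AlgProgram.run {ι α : Type} :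
    AlgProgram ι α → (ι ⊕ ℕ → K) → Option (α × (ι ⊕ ℕ → K) × ℕ)
  | .ret a, μ => some (a, μ, 0)
  | .one dst next, μ =>
      (next.run (Function.update μ (Sum.inr dst) 1)).map fun r => (r.1, r.2.1, r.2.2 + 1)
  | .arith op dst x y next, μ =>
      (op.eval (μ x) (μ y)).bind fun z =>
        (next.run (Function.update μ (Sum.inr dst) z)).map fun r => (r.1, r.2.1, r.2.2 + 1)
  | .ifZero x yes no, μ =>
      (if μ x = 0 then yes.run μ else no.run μ).map fun r => (r.1, r.2.1, r.2.2 + 1)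

/-- The polynomial whose coefficients, from degree `0` upwards, are stored in the listed
registers. -/
def polyOfRegisters {ρ : Type} (μ : ρ → K) : List ρ → K[X]
  | [] => 0
  | r :: rest => C (μ r) + X * polyOfRegisters μ rest

end Run

/-- The input registers: the entries of `T_1` and the entries of the coordinate vectors
`T_2 e, …, T_n e` of `x_2, …, x_n`, where `n = m + 1`. -/
abbrev MethodInput (m D : ℕ) : Type := (Fin D × Fin D) ⊕ (Fin m × Fin D)

/-- An algorithm for the method: a program for each value of the discrete data of the input.
These are the numbers `m = n - 1` and `D`, the characteristic `p` of the field, its cardinality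
`q` (`0` for an infinite field), and the positions `S` of the nonzero entries of `T_1` (so that
`T_1` is given as a sparse matrix). The program returns the registers of the coefficients of all
polynomials in the record of the method. -/
abbrev MethodAlgorithm : Type :=
  (m D p q : ℕ) → (S : Finset (Fin D × Fin D)) →
    AlgProgram (MethodInput m D) (MethodTrace (List (MethodInput m D ⊕ ℕ)) m)

section Cost

variable {K : Type u} [Field K] {D m : ℕ}

open Classical in
/-- The positions of the nonzero entries of a matrix. -/
def nonzeroEntries (T : Matrix (Fin D) (Fin D) K) : Finset (Fin D × Fin D) :=
  Finset.univ.filter fun p => T p.1 p.2 ≠ 0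

/-- The initial register contents; all work registers contain `0`. -/
def initialRegisters (T : Matrix (Fin D) (Fin D) K) (v : Fin m → Fin D → K) :
    MethodInput m D ⊕ ℕ → K
  | .inl (.inl (i, j)) => T i j
  | .inl (.inr (j, i)) => v j i
  | .inr _ => 0

/-- On the input `T`, `v`, the algorithm `A` performs the method with record `t`, using exactly
`c` operations. -/
def Performs (A : MethodAlgorithm) (T : Matrix (Fin D) (Fin D) K) (v : Fin m → Fin D → K)
    (t : MethodTrace K[X] m) (c : ℕ) : Prop :=
  ∃ (out : MethodTrace (List (MethodInput m D ⊕ ℕ)) m) (μ : MethodInput m D ⊕ ℕ → K),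
    (A m D (ringChar K) (Nat.card K) (nonzeroEntries T)).run (initialRegisters T v)
      = some (out, μ, c) ∧
    out.map (polyOfRegisters μ) = t

/-- `D (N₁ + D (log D · log log D + n))`. -/
def methodBound (n D N₁ : ℕ) : ℝ :=
  D * (N₁ + D * (Real.log D * Real.log (Real.log D) + n))

end Cost

end

/-! Correctness. The terms ε_k are linearly independent modulo I, and in shape position every
residue class is represented by a polynomial in x_1. Hence e is a cyclic vector of T_1
(`isCyclicVector_of_inShapePosition`): v_j = H_j(T_1)e for some polynomial H_j, the minimal
polynomial F of T_1 has degree D, and p(T_1)e = 0 exactly when F ∣ p. A round with vector b studies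
the functional L : p ↦ ⟨e_k, p(T_1)b⟩. The p with L(qp) = 0 for all q form an ideal with a monic
generator g (`IsAnnihilator`). This g is the minimal polynomial of the finite sequence, the form (p,
q) ↦ L(pq) is nondegenerate on K[x]/g, so its Hankel matrix is invertible, and the system belonging
to v_j has the only solution H_j mod g. After the round with e_k the k-th coordinate of q(T_1)b
vanishes for every q, so D rounds suffice, and the product of the factors is F. All polynomials of
the record are therefore remainders of the H_j modulo divisors of F (`methodTrace`,
`isMethodRun_iff`). Finally p(x_1) ∈ √I exactly when rad F ∣ p, which gives the Gröbner basis
(`isReducedGroebnerBasis_radical`).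

Complexity. The program computes the same record by a cheaper route. The vectors T_1^i e with i < 2D
are computed once; the sequence of b = f(T_1)e is then read off from one product of f with a
reversed sequence of e (`runLe_minpolyC`). This is the only use of fast multiplication, once in each
of at most D rounds, and it accounts for D² log D log log D. The multiplication is Schönhage's, with
powers of x as roots of unity, in radix 2 and, in characteristic 2, in radix 3 (`isModProduct_step`,
`exists_computesModProduct`).

The Euclidean algorithm finds g with O(D deg g) operations. Its other cofactor is, up to a scalar,
the last column of the inverse Hankel matrix, from which every Hankel system is solved classically
(`IsAnnihilator.map_mul_cofactor`, `IsAnnihilator.hankel_solution`). Instead of f(T_1)v_j the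
program carries the residual v_j − (H_j mod f)(T_1)e, so that H_j mod F is built up factor by factor
(`modByMonic_mul_eq`) from Krylov vectors shared by all j; as the degrees of the factors add up to
D, this costs O(D N_1 + n D²). The squarefree part comes from gcds with derivatives and from p-th
roots x^(q/p) of coefficients, the origin of the term D log(q/p) (`runLe_radicalC`). All remaining
polynomials are classical remainders of H_j mod F, so the Chinese remainder step needs no
computation of its own. -/

noncomputable section

/-! ## A program logic for algebraic programs -/

/-- Sequential composition of programs. -/
def AlgProgram.bind {ι α β : Type} :
    AlgProgram ι α → (α → AlgProgram ι β) → AlgProgram ι β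
  | .ret a, f => f a
  | .one dst next, f => .one dst (next.bind f)
  | .arith op dst x y next, f => .arith op dst x y (next.bind f)
  | .ifZero x yes no, f => .ifZero x (yes.bind f) (no.bind f)

open Classical in
theorem AlgProgram.run_bind {K : Type u} [Field K] {ι α β : Type} (p : AlgProgram ι α)
    (f : α → AlgProgram ι β) (μ : ι ⊕ ℕ → K) :
    (p.bind f).run μ = (p.run μ).bind fun r =>
      ((f r.1).run r.2.1).map fun r' => (r'.1, r'.2.1, r.2.2 + r'.2.2) := by
  induction p generalizing μ with
  | ret a => simp [AlgProgram.bind, AlgProgram.run]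
  | one dst next ih =>
    simp only [AlgProgram.bind, AlgProgram.run, ih]
    generalize next.run (Function.update μ (Sum.inr dst) 1) = o
    cases o with
    | none => rfl
    | some r =>
      simp only [Option.bind_some, Option.map_some, Option.map_map]
      congr 1
      funext r'
      simp only [Function.comp, add_right_comm]
  | arith op dst x y next ih =>
    simp only [AlgProgram.bind, AlgProgram.run, ih]
    cases op.eval (μ x) (μ y) with
    | none => rfl
    | some z =>
      simp only [Option.bind_some]
      generalize next.run (Function.update μ (Sum.inr dst) z) = o
      cases o with
      | none => rfl
      | some r =>
        simp only [Option.bind_some, Option.map_some, Option.map_map]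
        congr 1
        funext r'
        simp only [Function.comp, add_right_comm]
  | ifZero x yes no ih1 ih2 =>
    simp only [AlgProgram.bind, AlgProgram.run, ih1, ih2]
    split_ifs
    · cases yes.run μ with
      | none => rfl
      | some r =>
        simp only [Option.bind_some, Option.map_some, Option.map_map]
        congr 1
        funext r'
        simp only [Function.comp, add_right_comm]
    · cases no.run μ with
      | none => rfl
      | some r =>
        simp only [Option.bind_some, Option.map_some, Option.map_map]
        congr 1
        funext r'
        simp only [Function.comp, add_right_comm]

/-- Programs that allocate work registers: a computation receives the number of the next unused
register and returns the updated number with its value. -/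
def Comp (ι α : Type) : Type := ℕ → AlgProgram ι (α × ℕ)

/-- The values passed along are addresses and lengths, fixed on each branch of the computation tree.
Reindexing, shifting, splitting or transposing arrays of registers is therefore free; only
operations on field elements are counted. -/
instance {ι : Type} : Monad (Comp ι) where
  pure a := fun s => .ret (a, s)
  bind m f := fun s => (m s).bind fun r => f r.1 r.2

/-- The contents of the registers, together with the number of the next unused register. The
registers `0` and `1` are reserved for the constants. -/
structure World (ι : Type) (K : Type u) [Field K] where
  /-- the next unused register -/
  next : ℕ
  /-- the contents of the registers -/
  val : ι ⊕ ℕ → K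
  one_lt : 1 < next
  val_zero : val (Sum.inr 0) = 0
  val_one : val (Sum.inr 1) = 1

section Logic

variable {K : Type u} [Field K] {ι α β κ : Type}

/-- The input registers and the work registers in use. -/
def World.Valid (w : World ι K) : ι ⊕ ℕ → Prop
  | .inl _ => True
  | .inr i => i < w.next

/-- Every computation writes to fresh registers only, so a later state extends an earlier one.
`Holds` and `Stores` are monotone for this order, and intermediate results stay available. -/
instance : Preorder (World ι K) where
  le w w' := w.next ≤ w'.next ∧ ∀ r, w.Valid r → w'.val r = w.val r
  le_refl w := ⟨le_rfl, fun _ _ => rfl⟩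
  le_trans a b c hab hbc := ⟨hab.1.trans hbc.1, fun r hr => by
    rw [hbc.2 r, hab.2 r hr]
    cases r with
    | inl i => trivial
    | inr i => exact lt_of_lt_of_le hr hab.1⟩

theorem World.Valid.mono {w w' : World ι K} (h : w ≤ w') {r : ι ⊕ ℕ} (hr : w.Valid r) :
    w'.Valid r := by
  cases r with
  | inl i => trivial
  | inr i => exact lt_of_lt_of_le hr h.1

/-- The register `r` is in use and contains `x`. -/
def Holds (w : World ι K) (r : ι ⊕ ℕ) (x : K) : Prop := w.Valid r ∧ w.val r = x

theorem Holds.mono {w w' : World ι K} {r : ι ⊕ ℕ} {x : K} (hr : Holds w r x) (h : w ≤ w') :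
    Holds w' r x :=
  ⟨hr.1.mono h, (h.2 r hr.1).trans hr.2⟩

/-- A family of registers that contains a family of field elements. -/
def Stores (w : World ι K) (a : κ → ι ⊕ ℕ) (x : κ → K) : Prop := ∀ i, Holds w (a i) (x i)

theorem Stores.mono {w w' : World ι K} {a : κ → ι ⊕ ℕ} {x : κ → K} (hr : Stores w a x) (h : w ≤ w') :
    Stores w' a x :=
  fun i => (hr i).mono h

/-- The register of the constant `0`. -/
def zeroReg : ι ⊕ ℕ := Sum.inr 0

/-- The register of the constant `1`. -/
def oneReg : ι ⊕ ℕ := Sum.inr 1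

theorem holds_zero (w : World ι K) : Holds w zeroReg 0 :=
  ⟨Nat.lt_of_succ_lt w.one_lt, w.val_zero⟩

theorem holds_one (w : World ι K) : Holds w oneReg 1 := ⟨w.one_lt, w.val_one⟩

/-- `m` succeeds in `w`, and value, final state and number of operations satisfy `Q`. -/
def Run (w : World ι K) (m : Comp ι α) (Q : α → World ι K → ℕ → Prop) : Prop :=
  ∃ a w' n, (m w.next).run w.val = some ((a, w'.next), w'.val, n) ∧ w ≤ w' ∧ Q a w' n

/-- `m` succeeds in `w` with at most `c` operations, and value and final state satisfy `P`. -/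
def RunLe (w : World ι K) (m : Comp ι α) (c : ℕ) (P : α → World ι K → Prop) : Prop :=
  Run w m fun a w' n => P a w' ∧ n ≤ c

theorem Run.pure {w : World ι K} {a : α} {Q : α → World ι K → ℕ → Prop} (h : Q a w 0) :
    Run w (Pure.pure a : Comp ι α) Q :=
  ⟨a, w, 0, rfl, le_rfl, h⟩

theorem Run.mono {w : World ι K} {m : Comp ι α} {Q R : α → World ι K → ℕ → Prop}
    (h : Run w m Q) (hQR : ∀ a w' n, w ≤ w' → Q a w' n → R a w' n) : Run w m R := by
  obtain ⟨a, w', n, h1, h2, h3⟩ := h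
  exact ⟨a, w', n, h1, h2, hQR a w' n h2 h3⟩

theorem Run.bind {w : World ι K} {m : Comp ι α} {f : α → Comp ι β}
    {Q : α → World ι K → ℕ → Prop} {R : β → World ι K → ℕ → Prop} (h : Run w m Q)
    (hf : ∀ a w' n, w ≤ w' → Q a w' n → Run w' (f a) fun b w'' n' => R b w'' (n + n')) :
    Run w (m >>= f) R := by
  obtain ⟨a, w', n, h1, h2, h3⟩ := h
  obtain ⟨b, w'', n', h4, h5, h6⟩ := hf a w' n h2 h3
  refine ⟨b, w'', n + n', ?_, h2.trans h5, h6⟩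
  change ((m w.next).bind fun r => f r.1 r.2).run w.val = _
  rw [AlgProgram.run_bind, h1, Option.bind_some]
  simp only [h4, Option.map_some]

theorem RunLe.pure {w : World ι K} {a : α} {c : ℕ} {P : α → World ι K → Prop} (h : P a w) :
    RunLe w (Pure.pure a : Comp ι α) c P :=
  Run.pure ⟨h, Nat.zero_le _⟩

theorem RunLe.mono {w : World ι K} {m : Comp ι α} {c c' : ℕ} {P R : α → World ι K → Prop}
    (h : RunLe w m c P) (hPR : ∀ a w', w ≤ w' → P a w' → R a w') (hc : c ≤ c') :
    RunLe w m c' R :=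
  Run.mono h fun a w' _ hw hQ => ⟨hPR a w' hw hQ.1, hQ.2.trans hc⟩

theorem RunLe.mono_cost {w : World ι K} {m : Comp ι α} {c c' : ℕ} {P : α → World ι K → Prop}
    (h : RunLe w m c P) (hc : c ≤ c') : RunLe w m c' P :=
  h.mono (fun _ _ _ h => h) hc

theorem RunLe.bind {w : World ι K} {m : Comp ι α} {f : α → Comp ι β} {c c₁ c₂ : ℕ}
    {P : α → World ι K → Prop} {R : β → World ι K → Prop} (h : RunLe w m c₁ P)
    (hf : ∀ a w', w ≤ w' → P a w' → RunLe w' (f a) c₂ R) (hc : c₁ + c₂ ≤ c := by omega) :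
    RunLe w (m >>= f) c R :=
  Run.bind h fun a w' _ hw hQ => Run.mono (hf a w' hw hQ.1) fun _ _ _ _ hR =>
    ⟨hR.1, by have := hR.2; have := hQ.2; omega⟩

theorem RunLe.seq {w : World ι K} {m : Comp ι α} {f : α → Comp ι β} {c₁ c₂ : ℕ}
    {P : α → World ι K → Prop} {R : β → World ι K → Prop} (h : RunLe w m c₁ P)
    (hf : ∀ a w', w ≤ w' → P a w' → RunLe w' (f a) c₂ R) : RunLe w (m >>= f) (c₁ + c₂) R :=
  h.bind hf le_rfl

/-- For costs that depend on the result, such as those of the Euclidean algorithm: the first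
computation enters through a bound, while the final condition can still relate the operation count
to the values found. -/
theorem Run.bind_le {w : World ι K} {m : Comp ι α} {f : α → Comp ι β} {c₁ : ℕ}
    {P : α → World ι K → Prop} {R : β → World ι K → ℕ → Prop} (h : RunLe w m c₁ P)
    (hf : ∀ a w', w ≤ w' → P a w' →
      Run w' (f a) fun b w'' n' => ∀ n ≤ c₁, R b w'' (n + n')) :
    Run w (m >>= f) R :=
  Run.bind h fun a w' _ hw hQ => Run.mono (hf a w' hw hQ.1) fun _ _ _ _ hR => hR _ hQ.2

/-! ### Primitive operations -/

/-- A field operation. -/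
def arithC (op : FieldOp) (x y : ι ⊕ ℕ) : Comp ι (ι ⊕ ℕ) :=
  fun s => .arith op s x y (.ret (Sum.inr s, s + 1))

/-- A test for zero. -/
def isZeroC (x : ι ⊕ ℕ) : Comp ι Bool :=
  fun s => .ifZero x (.ret (true, s)) (.ret (false, s))

open Classical in
theorem runLe_arithC {w : World ι K} {op : FieldOp} {x y : ι ⊕ ℕ} {a b z : K}
    (hx : Holds w x a) (hy : Holds w y b) (hz : op.eval a b = some z) :
    RunLe w (arithC op x y) 1 fun r w' => Holds w' r z := by
  have hne : ∀ i < w.next, i ≠ w.next := fun i hi => hi.ne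
  refine ⟨Sum.inr w.next, ⟨w.next + 1, Function.update w.val (Sum.inr w.next) z,
    Nat.lt_succ_of_lt w.one_lt, ?_, ?_⟩, 1, ?_, ⟨Nat.le_succ _, ?_⟩, ⟨?_, ?_⟩, le_rfl⟩
  · rw [Function.update_of_ne (by simpa using hne 0 (Nat.lt_of_succ_lt w.one_lt)), w.val_zero]
  · rw [Function.update_of_ne (by simpa using hne 1 w.one_lt), w.val_one]
  · simp [arithC, AlgProgram.run, hx.2, hy.2, hz]
  · rintro (i | i) hr
    · exact Function.update_of_ne (f := w.val) (a' := Sum.inr w.next) Sum.inl_ne_inr z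
    · exact Function.update_of_ne (f := w.val) (a := Sum.inr i) (a' := Sum.inr w.next) (by simpa using hne i hr) z
  · exact Nat.lt_succ_self _
  · exact Function.update_self _ _ _

theorem runLe_add {w : World ι K} {x y : ι ⊕ ℕ} {a b : K} (hx : Holds w x a) (hy : Holds w y b) :
    RunLe w (arithC .add x y) 1 fun r w' => Holds w' r (a + b) :=
  runLe_arithC hx hy rfl

theorem runLe_sub {w : World ι K} {x y : ι ⊕ ℕ} {a b : K} (hx : Holds w x a) (hy : Holds w y b) :
    RunLe w (arithC .sub x y) 1 fun r w' => Holds w' r (a - b) :=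
  runLe_arithC hx hy rfl

theorem runLe_mul {w : World ι K} {x y : ι ⊕ ℕ} {a b : K} (hx : Holds w x a) (hy : Holds w y b) :
    RunLe w (arithC .mul x y) 1 fun r w' => Holds w' r (a * b) :=
  runLe_arithC hx hy rfl

theorem runLe_div {w : World ι K} {x y : ι ⊕ ℕ} {a b : K} (hx : Holds w x a) (hy : Holds w y b)
    (hb : b ≠ 0) : RunLe w (arithC .div x y) 1 fun r w' => Holds w' r (a / b) :=
  runLe_arithC hx hy (by simp [FieldOp.eval, hb])

theorem runLe_isZeroC {w : World ι K} {x : ι ⊕ ℕ} {a : K} (hx : Holds w x a) :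
    RunLe w (isZeroC x) 1 fun b _ => b = true ↔ a = 0 := by
  by_cases ha : a = 0
  · exact ⟨true, w, 1, by simp [isZeroC, AlgProgram.run, hx.2, ha], le_rfl, by simp [ha], le_rfl⟩
  · exact ⟨false, w, 1, by simp [isZeroC, AlgProgram.run, hx.2, ha], le_rfl, by simp [ha], le_rfl⟩

/-! ### Arrays and sums -/

open Classical in
/-- Compute the entries with the listed indices of an array with default entry `d`. -/
def tab (d : β) (f : κ → Comp ι β) : List κ → Comp ι (κ → β)
  | [] => pure fun _ => d
  | k :: l => do
      let g ← tab d f l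
      let x ← f k
      pure (Function.update g k x)

open Classical in
-- `hd` makes the default entry correct at all indices that are not computed; for sequences this is
-- the register of 0 beyond the length. The cost may vary with the index, as needed for sparse
-- matrices and for transforms with vanishing entries.
theorem runLe_tab {w : World ι K} {d : β} {f : κ → Comp ι β} {l : List κ} {c : κ → ℕ}
    {P : κ → β → World ι K → Prop}
    (hP : ∀ k b w₁ w₂, w₁ ≤ w₂ → P k b w₁ → P k b w₂)
    (hd : ∀ k w', w ≤ w' → k ∉ l → P k d w')
    (hf : ∀ k ∈ l, ∀ w', w ≤ w' → RunLe w' (f k) (c k) (P k)) :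
    RunLe w (tab d f l) (l.map c).sum fun g w' => ∀ k, P k (g k) w' := by
  suffices H : RunLe w (tab d f l) (l.map c).sum fun g w' =>
      (∀ k ∈ l, P k (g k) w') ∧ ∀ k ∉ l, g k = d by
    refine H.mono (fun g w' hw h k => ?_) le_rfl
    by_cases hk : k ∈ l
    · exact h.1 k hk
    · rw [h.2 k hk]; exact hd k w' hw hk
  clear hd
  induction l with
  | nil => exact RunLe.pure ⟨by simp, by simp⟩
  | cons k l ih =>
    refine RunLe.bind (ih fun k hk => hf k (List.mem_cons_of_mem _ hk)) (c₂ := c k)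
      (fun g w₁ hw₁ hg => ?_) (by simp [add_comm])
    refine RunLe.bind (hf k List.mem_cons_self w₁ hw₁) (c₂ := 0) (fun x w₂ hw₂ hx => ?_)
    refine RunLe.pure ⟨fun k' hk' => ?_, fun k' hk' => ?_⟩
    · by_cases h : k' = k
      · subst h; simpa using hx
      · rw [Function.update_of_ne h]
        exact hP _ _ _ _ hw₂ (hg.1 k' ((List.mem_cons.1 hk').resolve_left h))
    · rw [List.mem_cons, not_or] at hk'
      rw [Function.update_of_ne hk'.1, hg.2 k' hk'.2]

/-- The first `N` entries of a sequence of registers. -/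
def tabN (N : ℕ) (f : ℕ → Comp ι (ι ⊕ ℕ)) : Comp ι (ℕ → ι ⊕ ℕ) :=
  tab zeroReg f (List.range N)

theorem runLe_tabN {w : World ι K} {N c : ℕ} {f : ℕ → Comp ι (ι ⊕ ℕ)} {x : ℕ → K}
    (hx : ∀ i, N ≤ i → x i = 0)
    (hf : ∀ i < N, ∀ w', w ≤ w' → RunLe w' (f i) c fun r w'' => Holds w'' r (x i)) :
    RunLe w (tabN N f) (N * c) fun a w' => Stores w' a x := by
  have := runLe_tab (w := w) (d := zeroReg) (f := f) (l := List.range N) (c := fun _ => c)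
    (P := fun i r w' => Holds w' r (x i)) (fun _ _ _ _ h h' => h'.mono h)
    (fun k w' _ hk => by
      rw [hx k (by simpa using hk)]; exact holds_zero w')
    (fun k hk w' hw => hf k (by simpa using hk) w' hw)
  simpa [tabN, Stores] using this

/-- Extend a family by a default value outside of a list of indices. -/
def tabList (N : ℕ) (d : β) (f : ℕ → Comp ι β) : Comp ι (ℕ → β) := tab d f (List.range N)

theorem runLe_tabList {w : World ι K} {N c : ℕ} {d : β} {f : ℕ → Comp ι β}
    {P : ℕ → β → World ι K → Prop}
    (hP : ∀ k b w₁ w₂, w₁ ≤ w₂ → P k b w₁ → P k b w₂)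
    (hd : ∀ k w', w ≤ w' → N ≤ k → P k d w')
    (hf : ∀ k < N, ∀ w', w ≤ w' → RunLe w' (f k) c (P k)) :
    RunLe w (tabList N d f) (N * c) fun g w' => ∀ k, P k (g k) w' := by
  have := runLe_tab (w := w) (d := d) (f := f) (l := List.range N) (c := fun _ => c) hP
    (fun k w' hw hk => hd k w' hw (by simpa using hk))
    (fun k hk w' hw => hf k (by simpa using hk) w' hw)
  simpa [tabList] using this

/-- An array indexed by `Fin N`. -/
def tabFin (N : ℕ) (d : β) (f : Fin N → Comp ι β) : Comp ι (Fin N → β) :=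
  tab d f (List.finRange N)

theorem runLe_tabFin {w : World ι K} {N c : ℕ} {d : β} {f : Fin N → Comp ι β}
    {P : Fin N → β → World ι K → Prop}
    (hP : ∀ k b w₁ w₂, w₁ ≤ w₂ → P k b w₁ → P k b w₂)
    (hf : ∀ k, ∀ w', w ≤ w' → RunLe w' (f k) c (P k)) :
    RunLe w (tabFin N d f) (N * c) fun g w' => ∀ k, P k (g k) w' := by
  have := runLe_tab (w := w) (d := d) (f := f) (l := List.finRange N) (c := fun _ => c) hP
    (fun k w' hw hk => absurd (List.mem_finRange k) hk)
    (fun k hk w' hw => hf k w' hw)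
  simpa [tabFin] using this

/-- The sum of the values of computations. -/
def sumC (f : κ → Comp ι (ι ⊕ ℕ)) : List κ → Comp ι (ι ⊕ ℕ)
  | [] => pure zeroReg
  | k :: l => do
      let s ← sumC f l
      let x ← f k
      arithC .add x s

theorem runLe_sumC {w : World ι K} {f : κ → Comp ι (ι ⊕ ℕ)} {l : List κ} {c : ℕ} {x : κ → K}
    (hf : ∀ k ∈ l, ∀ w', w ≤ w' → RunLe w' (f k) c fun r w'' => Holds w'' r (x k)) :
    RunLe w (sumC f l) (l.length * (c + 1)) fun r w' => Holds w' r (l.map x).sum := by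
  induction l with
  | nil => exact RunLe.pure (holds_zero w)
  | cons k l ih =>
    refine RunLe.bind (ih fun k hk => hf k (List.mem_cons_of_mem _ hk)) (c₂ := c + 1)
      (fun s w₁ hw₁ hs => ?_) (by simp [add_mul])
    refine RunLe.bind (hf k List.mem_cons_self w₁ hw₁) (c₂ := 1) (fun x w₂ hw₂ hx => ?_)
    simpa using runLe_add hx (hs.mono hw₂)

theorem runLe_sumC_range {w : World ι K} {f : ℕ → Comp ι (ι ⊕ ℕ)} {N c : ℕ} {x : ℕ → K}
    (hf : ∀ k < N, ∀ w', w ≤ w' → RunLe w' (f k) c fun r w'' => Holds w'' r (x k)) :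
    RunLe w (sumC f (List.range N)) (N * (c + 1)) fun r w' =>
      Holds w' r (∑ i ∈ Finset.range N, x i) := by
  have := runLe_sumC (w := w) (f := f) (l := List.range N) (c := c) (x := x)
    (fun k hk w' hw => hf k (by simpa using hk) w' hw)
  rw [List.length_range] at this
  exact this

theorem runLe_sumC_finset {w : World ι K} {f : κ → Comp ι (ι ⊕ ℕ)} {s : Finset κ} {c : ℕ}
    {x : κ → K}
    (hf : ∀ k ∈ s, ∀ w', w ≤ w' → RunLe w' (f k) c fun r w'' => Holds w'' r (x k)) :
    RunLe w (sumC f s.toList) (s.card * (c + 1)) fun r w' => Holds w' r (∑ i ∈ s, x i) := by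
  have := runLe_sumC (w := w) (f := f) (l := s.toList) (c := c) (x := x)
    (fun k hk w' hw => hf k (by simpa using hk) w' hw)
  simpa using this

end Logic

/-! ## Multiplication modulo `1 + z + ⋯ + z ^ (ℓ - 1)` at `z = x ^ N` -/

section Cyclotomic

variable {A : Type*} [CommRing A]

/-- Reduction of a sequence of length `ℓ * N`, read as a polynomial, modulo
`∑ i < ℓ, x ^ (i * N)`. -/
def blockReduce {G : Type*} [Sub G] (ℓ N : ℕ) (c : ℕ → G) (i : ℕ) : G :=
  c i - c ((ℓ - 1) * N + i % N)

theorem sum_range_mul {M : Type*} [AddCommMonoid M] (f : ℕ → M) (a b : ℕ) :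
    ∑ i ∈ Finset.range (a * b), f i
      = ∑ j ∈ Finset.range a, ∑ r ∈ Finset.range b, f (j * b + r) := by
  induction a with
  | zero => simp
  | succ a ih => rw [Nat.succ_mul, Finset.sum_range_add, ih, Finset.sum_range_succ]

/-- The relation reads z^((ℓ−1)N) = −∑_{j<ℓ−1} z^(jN), so reduction subtracts the top block of N
coefficients from each lower block. -/
theorem sum_blockReduce {ℓ N : ℕ} (hℓ : 0 < ℓ) {z : A}
    (hz : ∑ i ∈ Finset.range ℓ, (z ^ N) ^ i = 0) (c : ℕ → A) :
    ∑ i ∈ Finset.range ((ℓ - 1) * N), blockReduce ℓ N c i * z ^ i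
      = ∑ i ∈ Finset.range (ℓ * N), c i * z ^ i := by
  obtain ⟨l, rfl⟩ : ∃ l, ℓ = l + 1 := ⟨ℓ - 1, by omega⟩
  simp only [Nat.add_sub_cancel, blockReduce]
  rw [sum_range_mul, sum_range_mul, Finset.sum_range_succ]
  have h1 : ∀ j, ∑ r ∈ Finset.range N,
      (c (j * N + r) - c (l * N + (j * N + r) % N)) * z ^ (j * N + r)
      = ∑ r ∈ Finset.range N, c (j * N + r) * z ^ (j * N + r)
        - (z ^ N) ^ j * ∑ r ∈ Finset.range N, c (l * N + r) * z ^ r := by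
    intro j
    rw [Finset.mul_sum, ← Finset.sum_sub_distrib]
    refine Finset.sum_congr rfl fun r hr => ?_
    rw [Nat.mul_add_mod', Nat.mod_eq_of_lt (Finset.mem_range.1 hr)]
    ring
  simp only [h1, Finset.sum_sub_distrib, ← Finset.sum_mul]
  rw [Finset.sum_range_succ] at hz
  rw [eq_neg_of_add_eq_zero_left hz, sub_eq_add_neg, neg_mul, neg_neg, Finset.mul_sum]
  congr 1
  refine Finset.sum_congr rfl fun r _ => ?_
  ring

/-- `∑ i < ℓ ^ s, z ^ i` is a product of values of `∑ i < ℓ, z ^ i`. -/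
theorem sum_pow_eq_prod (ℓ s : ℕ) (z : A) :
    ∑ i ∈ Finset.range (ℓ ^ s), z ^ i
      = ∏ j ∈ Finset.range s, ∑ i ∈ Finset.range ℓ, (z ^ ℓ ^ j) ^ i := by
  induction s with
  | zero => simp
  | succ s ih =>
    rw [Finset.prod_range_succ, ← ih, pow_succ', sum_range_mul, Finset.sum_mul_sum,
      Finset.sum_comm]
    refine Finset.sum_congr rfl fun r _ => Finset.sum_congr rfl fun j _ => ?_
    rw [← pow_mul, ← pow_add]
    congr 1
    ring

/-- The relation forces ω^ℓ = 1, and multiplication by e permutes the exponents modulo ℓ. -/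
theorem sum_pow_mul_eq_zero {ℓ : ℕ} (hℓ : ℓ.Prime) {ω : A}
    (hω : ∑ i ∈ Finset.range ℓ, ω ^ i = 0) {e : ℕ} (he : ¬ ℓ ∣ e) :
    ∑ i ∈ Finset.range ℓ, (ω ^ e) ^ i = 0 := by
  have h1 : ω ^ ℓ = 1 := by
    have := mul_geom_sum ω ℓ
    rw [hω, mul_zero] at this
    exact (sub_eq_zero.1 this.symm)
  rw [← hω]
  have hmod : ∀ i, ω ^ (i % ℓ) = ω ^ i := fun i => by
    conv_rhs => rw [← Nat.mod_add_div i ℓ, pow_add, pow_mul, h1, one_pow, mul_one]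
  refine Finset.sum_bij (fun i _ => (e * i) % ℓ) (fun i _ => ?_) (fun i hi j hj h => ?_)
    (fun j hj => ?_) (fun i _ => ?_)
  · exact Finset.mem_range.2 (Nat.mod_lt _ hℓ.pos)
  · have h2 : i ≡ j [MOD ℓ] :=
      Nat.ModEq.cancel_left_of_coprime ((Nat.Prime.coprime_iff_not_dvd hℓ).2 he) h
    exact Nat.ModEq.eq_of_lt_of_lt h2 (Finset.mem_range.1 hi) (Finset.mem_range.1 hj)
  · obtain ⟨m, hm, hm'⟩ := Nat.exists_mul_mod_eq_of_coprime j
      ((Nat.Prime.coprime_iff_not_dvd hℓ).2 he).symm hℓ.pos.ne'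
    exact ⟨m, Finset.mem_range.2 hm, hm'.trans (Nat.mod_eq_of_lt (Finset.mem_range.1 hj))⟩
  · rw [hmod, pow_mul]

/-- Orthogonality of the powers of a root of unity of order `ℓ ^ s`. -/
theorem sum_pow_root_eq_zero {ℓ s : ℕ} (hℓ : ℓ.Prime) {η : A}
    (hη : ∑ i ∈ Finset.range ℓ, (η ^ ℓ ^ s) ^ i = 0) {d : ℕ} (hd : ¬ ℓ ^ (s + 1) ∣ d) :
    ∑ i ∈ Finset.range (ℓ ^ (s + 1)), (η ^ d) ^ i = 0 := by
  have hd0 : d ≠ 0 := by rintro rfl; exact hd (dvd_zero _)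
  obtain ⟨a, d', hd', rfl⟩ := Nat.exists_eq_pow_mul_and_not_dvd hd0 ℓ hℓ.ne_one
  have ha : a ≤ s := by
    by_contra h
    exact hd (Dvd.dvd.mul_right (pow_dvd_pow ℓ (by omega)) _)
  rw [sum_pow_eq_prod]
  -- With d = ℓ^a d' and ℓ ∤ d', the factor of index s − a is the geometric sum at (η^(ℓ^s))^(d'),
  -- which vanishes. No cancellation is used, so A may have zero divisors.
  refine Finset.prod_eq_zero (i := s - a) (Finset.mem_range.2 (by omega)) ?_
  rw [← pow_mul η, show ℓ ^ a * d' * ℓ ^ (s - a) = ℓ ^ s * d' by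
    rw [mul_right_comm, ← pow_add, Nat.add_sub_cancel' ha], pow_mul]
  exact sum_pow_mul_eq_zero hℓ hη hd'

theorem pow_mul_eq_one_of_sum_eq_zero {ℓ N : ℕ} {z : A}
    (hz : ∑ i ∈ Finset.range ℓ, (z ^ N) ^ i = 0) : z ^ (ℓ * N) = 1 := by
  have := mul_geom_sum (z ^ N) ℓ
  rw [hz, mul_zero, ← pow_mul, mul_comm N] at this
  exact sub_eq_zero.1 this.symm

/-- The cyclic convolution of length `L` of two sequences of length `N`. -/
def cyclicConv {A : Type*} [CommRing A] (L N : ℕ) (a b : ℕ → A) (i : ℕ) : A :=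
  ∑ p ∈ (Finset.range N ×ˢ Finset.range N).filter fun p => (p.1 + p.2) % L = i, a p.1 * b p.2

theorem pow_mod_of_pow_eq_one {L : ℕ} {z : A} (hz : z ^ L = 1) (i : ℕ) : z ^ (i % L) = z ^ i := by
  conv_rhs => rw [← Nat.mod_add_div i L, pow_add, pow_mul, hz, one_pow, mul_one]

theorem sum_cyclicConv {L N : ℕ} (hL : 0 < L) {z : A} (hz : z ^ L = 1) (a b : ℕ → A) :
    ∑ i ∈ Finset.range L, cyclicConv L N a b i * z ^ i
      = (∑ u ∈ Finset.range N, a u * z ^ u) * ∑ v ∈ Finset.range N, b v * z ^ v := by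
  rw [Finset.sum_mul_sum, ← Finset.sum_product',
    ← Finset.sum_fiberwise_of_maps_to (t := Finset.range L) (g := fun p : ℕ × ℕ => (p.1 + p.2) % L)
      (fun p _ => Finset.mem_range.2 (Nat.mod_lt _ hL))]
  refine Finset.sum_congr rfl fun i _ => ?_
  rw [cyclicConv, Finset.sum_mul]
  refine Finset.sum_congr rfl fun p hp => ?_
  rw [← (Finset.mem_filter.1 hp).2, pow_mod_of_pow_eq_one hz]
  ring

theorem sum_blockReduce_cyclicConv {ℓ t : ℕ} (hℓ : 0 < ℓ) (ht : 0 < t) {z : A}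
    (hz : ∑ i ∈ Finset.range ℓ, (z ^ t) ^ i = 0) (N : ℕ) (a b : ℕ → A) :
    ∑ j ∈ Finset.range ((ℓ - 1) * t), blockReduce ℓ t (cyclicConv (ℓ * t) N a b) j * z ^ j
      = (∑ u ∈ Finset.range N, a u * z ^ u) * ∑ v ∈ Finset.range N, b v * z ^ v := by
  rw [sum_blockReduce hℓ hz, sum_cyclicConv (Nat.mul_pos hℓ ht) (pow_mul_eq_one_of_sum_eq_zero hz)]

/-- Interpolation at the roots of `∑ i < ℓ, (y ^ ℓ ^ s) ^ i`. -/
theorem blockReduce_inverse_transform {ℓ s : ℕ} (hℓ : ℓ.Prime) {η : A}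
    (hη : ∑ i ∈ Finset.range ℓ, (η ^ ℓ ^ s) ^ i = 0) (H : ℕ → A) {c g : ℕ → A}
    (hc : ∀ e < ℓ ^ (s + 1), c e = if ℓ ∣ e then 0 else
      ∑ j ∈ Finset.range ((ℓ - 1) * ℓ ^ s), H j * (η ^ e) ^ j)
    (hg : ∀ j < ℓ ^ (s + 1), g j = ∑ e ∈ Finset.range (ℓ ^ (s + 1)),
      (η ^ (ℓ ^ (s + 1) - 1)) ^ (e * j) * c e)
    {j : ℕ} (hj : j < (ℓ - 1) * ℓ ^ s) :
    blockReduce ℓ (ℓ ^ s) g j = (ℓ : A) ^ (s + 1) * H j := by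
  set t := ℓ ^ s with ht
  set L := ℓ ^ (s + 1) with hL
  have hLt : L = (ℓ - 1) * t + t := by
    rw [hL, pow_succ', ← ht]
    obtain ⟨l, rfl⟩ : ∃ l, ℓ = l + 1 := ⟨ℓ - 1, by have := hℓ.pos; omega⟩
    simp [add_mul]
  have ht0 : 0 < t := Nat.pow_pos hℓ.pos
  have hηL : η ^ L = 1 := by
    rw [hL, pow_succ']; exact pow_mul_eq_one_of_sum_eq_zero hη
  set T : ℕ → A := fun e => ∑ j ∈ Finset.range ((ℓ - 1) * t), H j * (η ^ e) ^ j with hT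
  -- The contribution of the points η^e with ℓ ∣ e, where the values were replaced by 0. A full
  -- inverse transform would give ℓ^(s+1) H; what is computed differs from it by W.
  set W : ℕ → A := fun j => ∑ e ∈ Finset.range L,
    if ℓ ∣ e then (η ^ (L - 1)) ^ (e * j) * T e else 0 with hW
  have horth : ∀ i < L, ∀ j < L, ∑ e ∈ Finset.range L, (η ^ (L - 1)) ^ (e * j) * (η ^ e) ^ i
      = if i = j then (ℓ : A) ^ (s + 1) else 0 := by
    intro i hi j hj
    have h1 : ∀ e, (η ^ (L - 1)) ^ (e * j) * (η ^ e) ^ i = (η ^ ((L - 1) * j + i)) ^ e := by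
      intro e
      rw [← pow_mul, ← pow_mul, ← pow_add, ← pow_mul]
      congr 1; ring
    simp only [h1]
    split_ifs with hij
    · subst hij
      have : (L - 1) * i + i = L * i := by
        obtain ⟨l, hl⟩ : ∃ l, L = l + 1 := ⟨L - 1, by omega⟩
        rw [hl]; simp; ring
      rw [this, pow_mul, hηL]
      simp [hL]
    · apply sum_pow_root_eq_zero hℓ hη
      intro hd
      apply hij
      have h3 : (L - 1) * j + j = L * j := by
        obtain ⟨l, hl⟩ : ∃ l, L = l + 1 := ⟨L - 1, by omega⟩
        rw [hl]; simp; ring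
      have h4 : ((L - 1) * j + i) + j ≡ 0 + j [MOD L] :=
        Nat.ModEq.add_right j ((Nat.modEq_zero_iff_dvd).2 hd)
      have h5 : ((L - 1) * j + i) + j ≡ i [MOD L] := by
        rw [add_right_comm, h3, Nat.ModEq, Nat.mul_add_mod]
      rw [zero_add] at h4
      exact Nat.ModEq.eq_of_lt_of_lt (h5.symm.trans h4) hi hj
  have hfull : ∀ j < L, g j = (if j < (ℓ - 1) * t then (ℓ : A) ^ (s + 1) * H j else 0) - W j := by
    intro j hj
    have h1 : g j + W j = ∑ e ∈ Finset.range L, (η ^ (L - 1)) ^ (e * j) * T e := by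
      rw [hg j hj, hW, ← Finset.sum_add_distrib]
      refine Finset.sum_congr rfl fun e he => ?_
      rw [hc e (Finset.mem_range.1 he)]
      split_ifs <;> simp [hT]
    rw [eq_sub_iff_add_eq, h1]
    simp only [hT, Finset.mul_sum]
    rw [Finset.sum_comm]
    have h2 : ∀ i ∈ Finset.range ((ℓ - 1) * t), ∑ e ∈ Finset.range L,
        (η ^ (L - 1)) ^ (e * j) * (H i * (η ^ e) ^ i)
        = if j = i then (ℓ : A) ^ (s + 1) * H j else 0 := by
      intro i hi
      have hi' := Finset.mem_range.1 hi
      have := horth i (by omega) j hj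
      have h3 : ∀ e, (η ^ (L - 1)) ^ (e * j) * (H i * (η ^ e) ^ i)
          = H i * ((η ^ (L - 1)) ^ (e * j) * (η ^ e) ^ i) := fun e => by ring
      simp only [h3, ← Finset.mul_sum]
      rw [this]
      by_cases h : i = j
      · subst h; simp [mul_comm]
      · rw [if_neg h, if_neg (Ne.symm h), mul_zero]
    rw [Finset.sum_congr rfl h2, Finset.sum_ite_eq]
    simp
  -- W only involves exponents e divisible by ℓ, so it has period t. Subtracting the top block,
  -- where H contributes nothing, removes it.
  have hWper : ∀ i j, i % t = j % t → W i = W j := by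
    intro i j hij
    simp only [hW]
    refine Finset.sum_congr rfl fun e _ => ?_
    split_ifs with he
    · obtain ⟨e', rfl⟩ := he
      congr 1
      have h0 : (η ^ (L - 1)) ^ L = 1 := by rw [← pow_mul, mul_comm, pow_mul, hηL, one_pow]
      have h1 : ∀ i, (η ^ (L - 1)) ^ (ℓ * e' * i) = (η ^ (L - 1)) ^ (ℓ * e' * (i % t)) := by
        intro i
        conv_lhs => rw [← Nat.mod_add_div i t]
        rw [mul_add, pow_add, show ℓ * e' * (t * (i / t)) = L * (e' * (i / t)) by
          rw [hL, pow_succ']; ring, pow_mul (η ^ (L - 1)) L, h0, one_pow, mul_one]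
      rw [h1 i, h1 j, hij]
    · rfl
  have hmod := Nat.mod_lt j ht0
  rw [blockReduce, hfull j (by omega), hfull _ (by omega), if_pos hj, if_neg (by omega),
    hWper ((ℓ - 1) * t + j % t) j (by rw [Nat.mul_add_mod', Nat.mod_mod])]
  ring

end Cyclotomic

/-! ## The fast Fourier transform with powers of `x` as roots of unity -/

/-- Cyclic shift by `τ` of a sequence of length `M`. -/
def shiftSeq {G : Type*} (M τ : ℕ) (x : ℕ → G) (i : ℕ) : G := x ((i + (M - τ % M)) % M)

section Transform

variable {K : Type u} [Field K] {A : Type*} [CommRing A] [Algebra K A]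

/-- The value of the polynomial with the first `M` coefficients `x` at `ξ`. -/
def evalSeq (M : ℕ) (ξ : A) (x : ℕ → K) : A :=
  ∑ i ∈ Finset.range M, algebraMap K A (x i) * ξ ^ i

theorem evalSeq_congr {M : ℕ} {ξ : A} {x y : ℕ → K} (h : ∀ i < M, x i = y i) :
    evalSeq M ξ x = evalSeq M ξ y :=
  Finset.sum_congr rfl fun i hi => by rw [h i (Finset.mem_range.1 hi)]

/-- The reason for using powers of x as roots of unity: multiplying by them only moves coefficients,
so the transform needs additions alone. -/
theorem evalSeq_shiftSeq {M : ℕ} (hM : 0 < M) {ξ : A} (hξ : ξ ^ M = 1) (τ : ℕ) (x : ℕ → K) :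
    evalSeq M ξ (shiftSeq M τ x) = ξ ^ τ * evalSeq M ξ x := by
  have hτ := Nat.mod_lt τ hM
  have key : ∀ i, (τ + (i + (M - τ % M)) % M) % M = i % M := by
    intro i
    rw [Nat.add_mod_mod, show τ + (i + (M - τ % M)) = (i + M) + M * (τ / M) by
      have := Nat.mod_add_div τ M; omega, Nat.add_mul_mod_self_left, Nat.add_mod_right]
  have key2 : ∀ i, ((τ + i) % M + (M - τ % M)) % M = i % M := by
    intro i
    rw [Nat.mod_add_mod, show τ + i + (M - τ % M) = (i + M) + M * (τ / M) by
      have := Nat.mod_add_div τ M; omega, Nat.add_mul_mod_self_left, Nat.add_mod_right]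
  rw [evalSeq, evalSeq, Finset.mul_sum]
  refine Finset.sum_nbij' (fun i => (i + (M - τ % M)) % M) (fun i => (τ + i) % M)
    (fun i _ => Finset.mem_range.2 (Nat.mod_lt _ hM))
    (fun i _ => Finset.mem_range.2 (Nat.mod_lt _ hM)) (fun i hi => ?_) (fun i hi => ?_)
    (fun i hi => ?_)
  · rw [key, Nat.mod_eq_of_lt (Finset.mem_range.1 hi)]
  · rw [key2, Nat.mod_eq_of_lt (Finset.mem_range.1 hi)]
  · rw [shiftSeq, mul_left_comm, ← pow_add, ← pow_mod_of_pow_eq_one hξ (τ + _), key,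
      pow_mod_of_pow_eq_one hξ]

/-- The transform of length `ℓ ^ s` of an array of sequences of length `M`. -/
def transform (ℓ M : ℕ) : ℕ → ℕ → (ℕ → ℕ → K) → ℕ → ℕ → K
  | 0, _, x => x
  | s + 1, σ, x => fun e i => if e < ℓ ^ (s + 1) ∧ i < M then
      ∑ r ∈ Finset.range ℓ, shiftSeq M (σ * e * r)
        (transform ℓ M s (σ * ℓ) (fun j => x (j * ℓ + r)) (e % ℓ ^ s)) i else 0

theorem transform_succ (ℓ M s σ : ℕ) (x : ℕ → ℕ → K) (e i : ℕ) :
    transform ℓ M (s + 1) σ x e i = if e < ℓ ^ (s + 1) ∧ i < M then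
      ∑ r ∈ Finset.range ℓ, shiftSeq M (σ * e * r)
        (transform ℓ M s (σ * ℓ) (fun j => x (j * ℓ + r)) (e % ℓ ^ s)) i else 0 := rfl

/-- Radix-ℓ decimation in time: write the summation index as jℓ + r, and the inner sums are
transforms of length ℓ^s for the root ξ^(σℓ). The order of that root divides ℓ^s, so e matters only
modulo ℓ^s there. -/
theorem evalSeq_transform {ℓ M : ℕ} (hℓ : 0 < ℓ) (hM : 0 < M) {ξ : A} (hξ : ξ ^ M = 1) (s : ℕ)
    {σ : ℕ} (hσ : (ξ ^ σ) ^ ℓ ^ s = 1) (x : ℕ → ℕ → K) {e : ℕ} (he : e < ℓ ^ s) :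
    evalSeq M ξ (transform ℓ M s σ x e)
      = ∑ j ∈ Finset.range (ℓ ^ s), ((ξ ^ σ) ^ e) ^ j * evalSeq M ξ (x j) := by
  induction s generalizing σ x e with
  | zero =>
    obtain rfl : e = 0 := by simpa using he
    simp [transform]
  | succ s ih =>
    have hσ' : (ξ ^ (σ * ℓ)) ^ ℓ ^ s = 1 := by
      rw [← hσ, pow_succ', pow_mul, pow_mul]
    have h1 : evalSeq M ξ (transform ℓ M (s + 1) σ x e)
        = ∑ r ∈ Finset.range ℓ, ξ ^ (σ * e * r) * evalSeq M ξ
          (transform ℓ M s (σ * ℓ) (fun j => x (j * ℓ + r)) (e % ℓ ^ s)) := by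
      simp only [← evalSeq_shiftSeq hM hξ]
      rw [evalSeq]
      simp only [evalSeq]
      rw [Finset.sum_comm]
      refine Finset.sum_congr rfl fun i hi => ?_
      rw [transform_succ, if_pos ⟨he, Finset.mem_range.1 hi⟩, map_sum, Finset.sum_mul]
    rw [h1, pow_succ, sum_range_mul, Finset.sum_comm]
    refine Finset.sum_congr rfl fun r _ => ?_
    rw [ih hσ' _ (Nat.mod_lt _ (Nat.pow_pos hℓ)), Finset.mul_sum]
    refine Finset.sum_congr rfl fun j _ => ?_
    rw [← mul_assoc, pow_mod_of_pow_eq_one hσ']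
    congr 1
    rw [← pow_mul, ← pow_mul, ← pow_mul, ← pow_mul, ← pow_add]
    congr 1
    ring

variable {ι : Type}

/-- The program for `transform`. -/
def transformC (ℓ M : ℕ) :
    ℕ → ℕ → (ℕ → ℕ → ι ⊕ ℕ) → Comp ι (ℕ → ℕ → ι ⊕ ℕ)
  | 0, _, x => pure x
  | s + 1, σ, x => do
      let B ← tabList ℓ (fun _ _ => zeroReg) fun r =>
        transformC ℓ M s (σ * ℓ) (fun j => x (j * ℓ + r))
      tabList (ℓ ^ (s + 1)) (fun _ => zeroReg) fun e => tabN M fun i =>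
        sumC (fun r => pure (shiftSeq M (σ * e * r) (B r (e % ℓ ^ s)) i)) (List.range ℓ)

/-- On each of the s levels, ℓ^s sequences of length M are formed in total, with ℓ additions per
coefficient. Twiddle factors are relabellings of registers. -/
theorem runLe_transformC {w : World ι K} {ℓ M : ℕ} (s σ : ℕ) {x : ℕ → ℕ → ι ⊕ ℕ}
    {y : ℕ → ℕ → K} (hx : ∀ j, Stores w (x j) (y j)) :
    RunLe w (transformC ℓ M s σ x) (s * (ℓ ^ s * (M * ℓ))) fun z w' =>
      ∀ e, Stores w' (z e) (transform ℓ M s σ y e) := by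
  induction s generalizing σ x y w with
  | zero => exact RunLe.pure hx
  | succ s ih =>
    have h1 := runLe_tabList (w := w) (N := ℓ) (d := fun _ _ => zeroReg)
      (f := fun r => transformC ℓ M s (σ * ℓ) (fun j => x (j * ℓ + r)))
      (P := fun r z w' => r < ℓ → ∀ e, Stores w' (z e)
        (transform ℓ M s (σ * ℓ) (fun j => y (j * ℓ + r)) e))
      (fun _ _ _ _ hw h hr e => (h hr e).mono hw) (fun k w' _ hk hr => absurd hr (by omega))
      (fun r _ w' hw => (ih (σ * ℓ) (fun j => (hx (j * ℓ + r)).mono hw)).mono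
        (fun _ _ _ h _ => h) le_rfl)
    refine RunLe.bind h1 (c₂ := ℓ ^ (s + 1) * (M * (ℓ * (0 + 1)))) (fun B w₁ hw₁ hB => ?_)
      (le_of_eq (by ring))
    refine runLe_tabList (P := fun e z w' => Stores w' z (transform ℓ M (s + 1) σ y e))
      (fun _ _ _ _ hw h => h.mono hw) (fun e w' _ he i => ?_)
      (fun e he w' hw => ?_)
    · rw [transform_succ, if_neg (by omega)]; exact holds_zero w'
    · refine runLe_tabN (fun i hi => ?_) (fun i hi w'' hw' => ?_)
      · rw [transform_succ, if_neg (by omega)]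
      · rw [transform_succ, if_pos ⟨he, hi⟩]
        refine runLe_sumC_range fun r hr w₃ hw₃ => RunLe.pure ?_
        exact (hB r hr (e % ℓ ^ s) _).mono (hw.trans (hw'.trans hw₃))

end Transform

/-! ## The recursion step of fast multiplication -/

theorem sum_range_ite_lt {M : Type*} [AddCommMonoid M] {N L : ℕ} (h : N ≤ L) (f : ℕ → M) :
    ∑ i ∈ Finset.range L, (if i < N then f i else 0) = ∑ i ∈ Finset.range N, f i := by
  rw [← Finset.sum_filter]
  congr 1
  ext i
  simp only [Finset.mem_filter, Finset.mem_range]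
  omega

theorem sum_overlap {A : Type*} [CommRing A] {N L : ℕ} (h : N < L) (y : A) (f g : ℕ → A) :
    ∑ J ∈ Finset.range L, y ^ J * ((if J < N then f J else 0) +
      (if 1 ≤ J ∧ J ≤ N then g (J - 1) else 0)) =
    ∑ j ∈ Finset.range N, (f j + y * g j) * y ^ j := by
  obtain ⟨L, rfl⟩ : ∃ L', L = L' + 1 := ⟨L - 1, by omega⟩
  simp only [mul_add, Finset.sum_add_distrib, mul_ite, mul_zero, add_mul]
  congr 1
  · rw [sum_range_ite_lt h.le]
    exact Finset.sum_congr rfl fun _ _ => mul_comm _ _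
  · rw [Finset.sum_range_succ', if_neg (by omega), add_zero,
      ← sum_range_ite_lt (N := N) (L := L) (by omega)]
    refine Finset.sum_congr rfl fun j _ => ?_
    have : (1 ≤ j + 1 ∧ j + 1 ≤ N) ↔ j < N := by omega
    simp only [this, Nat.add_sub_cancel]
    split_ifs
    · ring
    · rfl

section Step

variable (K : Type u) [Field K]

/-- The polynomial `∑ i < ℓ, (x ^ N) ^ i`. -/
def blockCyclotomic (ℓ N : ℕ) : K[X] := ∑ i ∈ Finset.range ℓ, (X ^ N) ^ i

/-- The ring `K[x]` modulo `∑ i < ℓ, (x ^ N) ^ i`. -/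
abbrev BlockRing (ℓ N : ℕ) : Type u := AdjoinRoot (blockCyclotomic K ℓ N)

variable {K}

theorem blockRing_root (ℓ N : ℕ) :
    ∑ i ∈ Finset.range ℓ, (AdjoinRoot.root (blockCyclotomic K ℓ N) ^ N) ^ i = 0 := by
  have : AdjoinRoot.mk (blockCyclotomic K ℓ N) (∑ i ∈ Finset.range ℓ, (X ^ N) ^ i) = 0 :=
    AdjoinRoot.mk_self
  simpa only [map_sum, map_pow, AdjoinRoot.mk_X] using this

theorem degree_blockCyclotomic {ℓ N : ℕ} (hℓ : 0 < ℓ) (hN : 0 < N) :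
    (blockCyclotomic K ℓ N).degree = ((ℓ - 1) * N : ℕ) := by
  obtain ⟨l, rfl⟩ : ∃ l, ℓ = l + 1 := ⟨ℓ - 1, by omega⟩
  rw [blockCyclotomic, Finset.sum_range_succ, Nat.add_sub_cancel, ← pow_mul, mul_comm N]
  rw [degree_add_eq_right_of_degree_lt]
  · exact degree_X_pow _
  · rw [degree_X_pow]
    refine (degree_sum_le _ _).trans_lt ((Finset.sup_lt_iff (WithBot.bot_lt_coe _)).2 ?_)
    intro i hi
    rw [← pow_mul, degree_X_pow]
    exact_mod_cast by
      rw [mul_comm]; exact Nat.mul_lt_mul_of_pos_right (Finset.mem_range.1 hi) hN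

theorem evalSeq_root (f : K[X]) (M : ℕ) (x : ℕ → K) :
    evalSeq M (AdjoinRoot.root f) x
      = AdjoinRoot.mk f (∑ i ∈ Finset.range M, C (x i) * X ^ i) := by
  simp only [evalSeq, map_sum, map_mul, map_pow, AdjoinRoot.mk_X, AdjoinRoot.mk_C]
  rfl

/-- `z` is the product of `x` and `y` modulo `∑ i < ℓ, (x ^ N) ^ i`. -/
def IsModProduct (ℓ N : ℕ) (x y z : ℕ → K) : Prop :=
  (∀ i, (ℓ - 1) * N ≤ i → z i = 0) ∧
  evalSeq ((ℓ - 1) * N) (AdjoinRoot.root (blockCyclotomic K ℓ N)) z =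
    evalSeq ((ℓ - 1) * N) (AdjoinRoot.root (blockCyclotomic K ℓ N)) x *
    evalSeq ((ℓ - 1) * N) (AdjoinRoot.root (blockCyclotomic K ℓ N)) y

/-- The first `(ℓ - 1) * N` entries of `blockReduce`. -/
def blockReduceSeq (ℓ N : ℕ) (x : ℕ → K) (i : ℕ) : K :=
  if i < (ℓ - 1) * N then blockReduce ℓ N x i else 0

theorem evalSeq_blockReduce {A : Type*} [CommRing A] [Algebra K A] {ℓ N : ℕ} (hℓ : 0 < ℓ) {ξ : A}
    (hξ : ∑ i ∈ Finset.range ℓ, (ξ ^ N) ^ i = 0) (x : ℕ → K) :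
    evalSeq ((ℓ - 1) * N) ξ (blockReduce ℓ N x) = evalSeq (ℓ * N) ξ x := by
  rw [evalSeq, evalSeq, ← sum_blockReduce hℓ hξ fun i => algebraMap K A (x i)]
  refine Finset.sum_congr rfl fun i _ => ?_
  simp only [blockReduce, map_sub]

theorem evalSeq_blockReduceSeq {A : Type*} [CommRing A] [Algebra K A] {ℓ N : ℕ} (hℓ : 0 < ℓ)
    {ξ : A} (hξ : ∑ i ∈ Finset.range ℓ, (ξ ^ N) ^ i = 0) (x : ℕ → K) :
    evalSeq ((ℓ - 1) * N) ξ (blockReduceSeq ℓ N x) = evalSeq (ℓ * N) ξ x := by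
  rw [← evalSeq_blockReduce hℓ hξ]
  exact evalSeq_congr fun i hi => if_pos hi

theorem evalSeq_of_zero {A : Type*} [CommRing A] [Algebra K A] {N M : ℕ} (h : N ≤ M) (ξ : A)
    {x : ℕ → K} (hx : ∀ i, N ≤ i → x i = 0) : evalSeq M ξ x = evalSeq N ξ x := by
  refine (Finset.sum_subset (Finset.range_mono h) fun i _ hi => ?_).symm
  rw [hx i (by simpa using hi)]
  simp

/-- The coefficients of a polynomial in `x ^ m` with `N` coefficients of length `m`. -/
def splitBlocks {G : Type*} (d : G) (m N : ℕ) (x : ℕ → G) (j i : ℕ) : G :=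
  if j < N ∧ i < m then x (j * m + i) else d

/-- The sum of `N` overlapping sequences of length `2 * m`, shifted by multiples of `m`. -/
def overlapAdd (m N : ℕ) (H : ℕ → ℕ → K) (i : ℕ) : K :=
  (if i / m < N then H (i / m) (i % m) else 0) +
    (if 1 ≤ i / m ∧ i / m ≤ N then H (i / m - 1) (m + i % m) else 0)

/-- The high half of the sequence with index J − 1 falls on the same block as the low half of the
one with index J; N < L leaves room for the last high half. -/
theorem evalSeq_overlapAdd {A : Type*} [CommRing A] [Algebra K A] {m N L : ℕ} (hm : 0 < m)
    (h : N < L) (ξ : A) (H : ℕ → ℕ → K) :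
    evalSeq (L * m) ξ (overlapAdd m N H)
      = ∑ j ∈ Finset.range N, evalSeq (2 * m) ξ (H j) * (ξ ^ m) ^ j := by
  have h1 : ∀ j, evalSeq (2 * m) ξ (H j) = evalSeq m ξ (H j)
      + ξ ^ m * evalSeq m ξ (fun i => H j (m + i)) := by
    intro j
    rw [two_mul, evalSeq, Finset.sum_range_add]
    congr 1
    rw [evalSeq, Finset.mul_sum]
    refine Finset.sum_congr rfl fun i _ => ?_
    rw [pow_add]; ring
  simp only [h1]
  rw [← sum_overlap h, evalSeq, sum_range_mul]
  refine Finset.sum_congr rfl fun J _ => ?_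
  have h2 : ∀ i ∈ Finset.range m, algebraMap K A (overlapAdd m N H (J * m + i)) * ξ ^ (J * m + i)
      = (ξ ^ m) ^ J * ((if J < N then algebraMap K A (H J i) * ξ ^ i else 0) +
        (if 1 ≤ J ∧ J ≤ N then algebraMap K A (H (J - 1) (m + i)) * ξ ^ i else 0)) := by
    intro i hi
    have hi := Finset.mem_range.1 hi
    have h3 : (J * m + i) / m = J := by
      rw [mul_comm, Nat.mul_add_div hm, Nat.div_eq_of_lt hi, add_zero]
    have h4 : (J * m + i) % m = i := by rw [Nat.mul_add_mod', Nat.mod_eq_of_lt hi]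
    rw [overlapAdd, h3, h4, ← pow_mul, pow_add, mul_comm m J]
    split_ifs <;> simp <;> ring
  rw [Finset.sum_congr rfl h2, ← Finset.mul_sum, Finset.sum_add_distrib]
  congr 2
  · split_ifs <;> simp [evalSeq]
  · split_ifs <;> simp [evalSeq]

/-- One level of the recursion: multiplication modulo `∑ i < ℓ, (x ^ ℓ ^ (s + r)) ^ i` is reduced
to multiplications modulo `∑ i < ℓ, (x ^ ℓ ^ (r + δ)) ^ i`. -/
theorem isModProduct_step {ℓ δ s r : ℕ} (hℓ : ℓ.Prime) (hδ : (ℓ - 1) * ℓ ^ δ = 2)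
    (hsr : s ≤ r + δ) (x y : ℕ → K) {c H : ℕ → ℕ → K} {κ : K}
    (hκ : κ * (ℓ : K) ^ (s + 1) = 1)
    (hc0 : ∀ e, ℓ ∣ e → c e = 0)
    (hc : ∀ e < ℓ ^ (s + 1), ¬ ℓ ∣ e → IsModProduct ℓ (ℓ ^ (r + δ))
      (blockReduceSeq ℓ (ℓ ^ (r + δ)) (transform ℓ (ℓ * ℓ ^ (r + δ)) (s + 1) (ℓ ^ (r + δ - s))
        (splitBlocks 0 (ℓ ^ r) ((ℓ - 1) * ℓ ^ s) x) e))
      (blockReduceSeq ℓ (ℓ ^ (r + δ)) (transform ℓ (ℓ * ℓ ^ (r + δ)) (s + 1) (ℓ ^ (r + δ - s))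
        (splitBlocks 0 (ℓ ^ r) ((ℓ - 1) * ℓ ^ s) y) e)) (c e))
    (hH : ∀ j < (ℓ - 1) * ℓ ^ s, ∀ i < 2 * ℓ ^ r, H j i = κ * blockReduce ℓ (ℓ ^ (r + δ))
      (blockReduce ℓ (ℓ ^ s) (transform ℓ (ℓ * ℓ ^ (r + δ)) (s + 1)
        (ℓ ^ (r + δ - s) * (ℓ ^ (s + 1) - 1)) c) j) i) :
    IsModProduct ℓ (ℓ ^ (s + r)) x y
      (blockReduceSeq ℓ (ℓ ^ (s + r)) (overlapAdd (ℓ ^ r) ((ℓ - 1) * ℓ ^ s) H)) := by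
  have hℓ0 := hℓ.pos
  set t := ℓ ^ s with ht
  set m := ℓ ^ r with hm
  set m' := ℓ ^ (r + δ) with hm'
  set σ := ℓ ^ (r + δ - s) with hσ
  set L := ℓ ^ (s + 1) with hL
  have hm0 : 0 < m := Nat.pow_pos hℓ0
  have hm'0 : 0 < m' := Nat.pow_pos hℓ0
  have ht0 : 0 < t := Nat.pow_pos hℓ0
  have hLt : L = ℓ * t := by rw [hL, pow_succ', ← ht]
  have hlt : (ℓ - 1) * t < ℓ * t := Nat.mul_lt_mul_of_pos_right (by omega) ht0
  -- The auxiliary ring K[x]/∑ (x^m')^i has dimension 2m, just enough to hold a product of two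
  -- blocks of length m unchanged.
  have h2m : (ℓ - 1) * m' = 2 * m := by
    rw [hm', pow_add, ← hm, mul_comm m, ← mul_assoc, hδ]
  have hM : 2 * m ≤ ℓ * m' := by rw [← h2m]; exact Nat.mul_le_mul_right _ (by omega)
  set ξ := AdjoinRoot.root (blockCyclotomic K ℓ m') with hξ
  have hξΦ : ∑ i ∈ Finset.range ℓ, (ξ ^ m') ^ i = 0 := blockRing_root ℓ m'
  have hξM : ξ ^ (ℓ * m') = 1 := pow_mul_eq_one_of_sum_eq_zero hξΦ
  -- Here s ≤ r + δ is needed. Thus η = ξ^σ satisfies ∑ (η^t)^i = 0, so it serves as a root of unity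
  -- of order ℓt for the variable y = x^m.
  have hσt : σ * t = m' := by rw [hσ, ht, hm', ← pow_add]; congr 1; omega
  set η := ξ ^ σ with hη
  have hηt : η ^ t = ξ ^ m' := by rw [hη, ← pow_mul, hσt]
  have hηΦ : ∑ i ∈ Finset.range ℓ, (η ^ t) ^ i = 0 := by rw [hηt]; exact hξΦ
  have hηL : η ^ L = 1 := by rw [hLt]; exact pow_mul_eq_one_of_sum_eq_zero hηΦ
  set pc : (ℕ → K) → ℕ → K[X] := fun x j => ∑ i ∈ Finset.range m, C (x (j * m + i)) * X ^ i
    with hpc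
  have hsplit : ∀ x : ℕ → K, ∀ j < (ℓ - 1) * t,
      evalSeq (ℓ * m') ξ (splitBlocks 0 m ((ℓ - 1) * t) x j)
        = AdjoinRoot.mk (blockCyclotomic K ℓ m') (pc x j) := by
    intro x j hj
    rw [evalSeq_of_zero (N := m) (by omega), hξ, evalSeq_root]
    · congr 1
      refine Finset.sum_congr rfl fun i hi => ?_
      rw [splitBlocks, if_pos ⟨hj, Finset.mem_range.1 hi⟩]
    · intro i hi
      rw [splitBlocks, if_neg (by omega)]
  have htrans : ∀ x : ℕ → K, ∀ e < L,
      evalSeq (ℓ * m') ξ (transform ℓ (ℓ * m') (s + 1) σ (splitBlocks 0 m ((ℓ - 1) * t) x) e)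
        = ∑ j ∈ Finset.range ((ℓ - 1) * t),
          AdjoinRoot.mk (blockCyclotomic K ℓ m') (pc x j) * (η ^ e) ^ j := by
    intro x e he
    rw [evalSeq_transform hℓ0 (Nat.mul_pos hℓ0 hm'0) hξM _ hηL _ he]
    symm
    refine Finset.sum_subset_zero_on_sdiff (Finset.range_mono ?_) ?_ ?_
    · rw [← hL, hLt]; exact hlt.le
    · intro j hj
      have hj := (Finset.mem_sdiff.1 hj).2
      have : splitBlocks 0 m ((ℓ - 1) * t) x j = 0 := by
        funext i
        rw [splitBlocks, if_neg (by rw [Finset.mem_range] at hj; omega)]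
        rfl
      rw [this]
      simp [evalSeq]
    · intro j hj
      rw [hsplit x j (Finset.mem_range.1 hj), mul_comm]
  -- The true coefficients, in K[x], of the product as a polynomial in y modulo ∑ y^(ti). They are
  -- formed over K[x] so that they can be mapped both to the auxiliary ring and to the target ring.
  set Hp : ℕ → K[X] := blockReduce ℓ t (cyclicConv (ℓ * t) ((ℓ - 1) * t) (pc x) (pc y)) with hHp
  have hmap : ∀ {R : Type u} [CommRing R] (φ : K[X] →+* R) (j : ℕ), φ (Hp j) = blockReduce ℓ t
      (cyclicConv (ℓ * t) ((ℓ - 1) * t) (fun j => φ (pc x j)) (fun j => φ (pc y j))) j := by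
    intro R _ φ j
    simp only [hHp, blockReduce, cyclicConv, map_sub, map_sum, map_mul]
  -- For ℓ ∤ e the modulus ∑ y^(ti) vanishes at y = η^e, so the pointwise product of the two
  -- transforms is the value there of the reduced product.
  have hcval : ∀ e < L, evalSeq (ℓ * m') ξ (c e) = if ℓ ∣ e then 0 else
      ∑ j ∈ Finset.range ((ℓ - 1) * t),
        AdjoinRoot.mk (blockCyclotomic K ℓ m') (Hp j) * (η ^ e) ^ j := by
    intro e he
    split_ifs with hd
    · rw [hc0 e hd]; simp [evalSeq]
    · obtain ⟨h1, h2⟩ := hc e he hd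
      rw [evalSeq_of_zero (N := (ℓ - 1) * m') (Nat.mul_le_mul_right _ (by omega)) _ h1, h2,
        ← hξ, evalSeq_blockReduceSeq hℓ0 hξΦ, evalSeq_blockReduceSeq hℓ0 hξΦ, htrans x e he,
        htrans y e he]
      simp only [hmap]
      rw [sum_blockReduce_cyclicConv hℓ0 ht0]
      rw [← pow_mul, mul_comm, pow_mul]
      exact sum_pow_mul_eq_zero hℓ hηΦ hd
  have hG : ∀ j < (ℓ - 1) * t, evalSeq (2 * m) ξ (H j)
      = AdjoinRoot.mk (blockCyclotomic K ℓ m') (Hp j) := by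
    intro j hj
    set G := transform ℓ (ℓ * m') (s + 1) (σ * (L - 1)) c with hGdef
    have h1 : ∀ j < L, evalSeq (ℓ * m') ξ (G j) = ∑ e ∈ Finset.range L,
        (η ^ (L - 1)) ^ (e * j) * evalSeq (ℓ * m') ξ (c e) := by
      intro j hj
      rw [hGdef, evalSeq_transform hℓ0 (Nat.mul_pos hℓ0 hm'0) hξM _ _ _ hj]
      · refine Finset.sum_congr rfl fun e _ => ?_
        rw [hη, ← pow_mul, ← pow_mul, ← pow_mul, ← pow_mul, mul_comm e j, mul_assoc]
      · rw [pow_mul, ← hη, ← pow_mul, mul_comm, pow_mul, ← hL, hηL, one_pow]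
    have h2 := blockReduce_inverse_transform hℓ hηΦ
      (fun j => AdjoinRoot.mk (blockCyclotomic K ℓ m') (Hp j)) hcval h1 hj
    have h3 : evalSeq (2 * m) ξ (H j) = algebraMap K _ κ *
        blockReduce ℓ t (fun j => evalSeq (ℓ * m') ξ (G j)) j := by
      have h4 : blockReduce ℓ t (fun j => evalSeq (ℓ * m') ξ (G j)) j
          = evalSeq (ℓ * m') ξ (blockReduce ℓ t G j) := by
        simp only [blockReduce, evalSeq, ← Finset.sum_sub_distrib, Pi.sub_apply, map_sub, sub_mul]
      rw [h4, ← evalSeq_blockReduce hℓ0 hξΦ, h2m, evalSeq, evalSeq, Finset.mul_sum]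
      refine Finset.sum_congr rfl fun i hi => ?_
      rw [hH j hj i (Finset.mem_range.1 hi), map_mul, mul_assoc]
    rw [h3, h2, ← mul_assoc]
    have : algebraMap K (BlockRing K ℓ m') κ * (ℓ : BlockRing K ℓ m') ^ (s + 1) = 1 := by
      rw [← map_natCast (algebraMap K (BlockRing K ℓ m')), ← map_pow, ← map_mul, hκ, map_one]
    rw [this, one_mul]
  have hdeg : ∀ j, (Hp j).degree < (2 * m : ℕ) := by
    have hpcdeg : ∀ (x : ℕ → K) j, pc x j ∈ degreeLE K (m - 1 : ℕ) := by
      intro x j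
      refine Submodule.sum_mem _ fun i hi => ?_
      rw [mem_degreeLE]
      refine (degree_C_mul_X_pow_le _ _).trans ?_
      have := Finset.mem_range.1 hi
      exact_mod_cast by omega
    have hcc : ∀ j, cyclicConv (ℓ * t) ((ℓ - 1) * t) (pc x) (pc y) j
        ∈ degreeLT K (2 * m) := by
      intro j
      refine Submodule.sum_mem _ fun p _ => ?_
      rw [mem_degreeLT]
      have h1 := mem_degreeLE.1 (hpcdeg x p.1)
      have h2 := mem_degreeLE.1 (hpcdeg y p.2)
      refine (degree_mul_le _ _).trans_lt ((add_le_add h1 h2).trans_lt ?_)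
      exact_mod_cast by omega
    intro j
    exact mem_degreeLT.1 (Submodule.sub_mem _ (hcc _) (hcc _))
  -- Both sides have degree below that of the auxiliary modulus, so the congruence is an equality in
  -- K[x] and can be used in the target ring.
  have hpoly : ∀ j < (ℓ - 1) * t, ∑ i ∈ Finset.range (2 * m), C (H j i) * X ^ i = Hp j := by
    intro j hj
    have h1 := hG j hj
    rw [hξ, evalSeq_root, AdjoinRoot.mk_eq_mk] at h1
    by_contra hne
    refine absurd (degree_le_of_dvd h1 (sub_ne_zero.2 hne)) (not_le.2 ?_)
    rw [degree_blockCyclotomic hℓ0 hm'0, h2m]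
    refine (degree_sub_le _ _).trans_lt (max_lt ?_ (hdeg j))
    rw [← mem_degreeLT]
    refine Submodule.sum_mem _ fun i hi => ?_
    rw [mem_degreeLT]
    refine (degree_C_mul_X_pow_le _ _).trans_lt ?_
    exact_mod_cast Finset.mem_range.1 hi
  set ρ := AdjoinRoot.root (blockCyclotomic K ℓ (ℓ ^ (s + r))) with hρ
  have hn : ℓ ^ (s + r) = t * m := pow_add _ _ _
  have hρΦ : ∑ i ∈ Finset.range ℓ, (ρ ^ (ℓ ^ (s + r))) ^ i = 0 := blockRing_root ℓ _
  have hρΦ' : ∑ i ∈ Finset.range ℓ, ((ρ ^ m) ^ t) ^ i = 0 := by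
    rw [← pow_mul, mul_comm, ← hn]; exact hρΦ
  have e1 : ℓ * ℓ ^ (s + r) = ℓ * t * m := by rw [hn, mul_assoc]
  have e2 : (ℓ - 1) * ℓ ^ (s + r) = (ℓ - 1) * t * m := by rw [hn, mul_assoc]
  refine ⟨fun i hi => if_neg (by omega), ?_⟩
  rw [← hρ, evalSeq_blockReduceSeq hℓ0 hρΦ, e1, e2, evalSeq_overlapAdd hm0 hlt]
  have h1 : ∀ j ∈ Finset.range ((ℓ - 1) * t), evalSeq (2 * m) ρ (H j) * (ρ ^ m) ^ j
      = AdjoinRoot.mk _ (Hp j) * (ρ ^ m) ^ j := by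
    intro j hj
    rw [hρ, evalSeq_root, hpoly j (Finset.mem_range.1 hj)]
  have h2 : ∀ x : ℕ → K, evalSeq ((ℓ - 1) * t * m) ρ x
      = ∑ j ∈ Finset.range ((ℓ - 1) * t), AdjoinRoot.mk _ (pc x j) * (ρ ^ m) ^ j := by
    intro x
    rw [evalSeq, sum_range_mul]
    refine Finset.sum_congr rfl fun j _ => ?_
    simp only [hpc, map_sum, map_mul, map_pow, AdjoinRoot.mk_X, AdjoinRoot.mk_C, Finset.sum_mul]
    refine Finset.sum_congr rfl fun i _ => ?_
    change AdjoinRoot.of _ (x (j * m + i)) * ρ ^ (j * m + i)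
      = AdjoinRoot.of _ (x (j * m + i)) * ρ ^ i * (ρ ^ m) ^ j
    ring
  rw [Finset.sum_congr rfl h1, h2 x, h2 y]
  simp only [hmap]
  rw [sum_blockReduce_cyclicConv hℓ0 ht0 hρΦ']

end Step

/-! ## The program for fast multiplication -/

section FastMul

variable {ι : Type}

/-- The program for `blockReduceSeq`. -/
def blockReduceC (ℓ N : ℕ) (a : ℕ → ι ⊕ ℕ) : Comp ι (ℕ → ι ⊕ ℕ) :=
  tabN ((ℓ - 1) * N) fun i => arithC .sub (a i) (a ((ℓ - 1) * N + i % N))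

theorem runLe_blockReduceC {K : Type u} [Field K] {w : World ι K} {ℓ N : ℕ} {a : ℕ → ι ⊕ ℕ}
    {x : ℕ → K} (ha : Stores w a x) :
    RunLe w (blockReduceC ℓ N a) ((ℓ - 1) * N) fun z w' => Stores w' z (blockReduceSeq ℓ N x) := by
  have := runLe_tabN (w := w) (N := (ℓ - 1) * N) (c := 1)
    (f := fun i => arithC .sub (a i) (a ((ℓ - 1) * N + i % N))) (x := blockReduceSeq ℓ N x)
    (fun i hi => if_neg (by omega)) (fun i hi w' hw => by
      rw [blockReduceSeq, if_pos hi]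
      exact runLe_sub ((ha _).mono hw) ((ha _).mono hw))
  rwa [mul_one] at this

/-- The program computes products modulo `∑ i < ℓ, (x ^ ℓ ^ k) ^ i` with at most `c`
operations. -/
def ComputesModProduct (ℓ k c : ℕ) (prog : (ℕ → ι ⊕ ℕ) → (ℕ → ι ⊕ ℕ) → Comp ι (ℕ → ι ⊕ ℕ)) :
    Prop :=
  ∀ (K : Type u) [Field K], (ℓ : K) ≠ 0 → ∀ (w : World ι K) (a b : ℕ → ι ⊕ ℕ) (x y : ℕ → K),
    Stores w a x → Stores w b y → RunLe w (prog a b) c fun z w' =>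
      ∃ v, Stores w' z v ∧ IsModProduct ℓ (ℓ ^ k) x y v

/-- Classical multiplication. -/
def naiveModMulC (ℓ k : ℕ) (a b : ℕ → ι ⊕ ℕ) : Comp ι (ℕ → ι ⊕ ℕ) := do
  let raw ← tabN (ℓ * ℓ ^ k) fun i =>
    sumC (fun p : ℕ × ℕ => arithC .mul (a p.1) (b p.2))
      (((Finset.range ((ℓ - 1) * ℓ ^ k) ×ˢ Finset.range ((ℓ - 1) * ℓ ^ k)).filter
        fun p => (p.1 + p.2) % (ℓ * ℓ ^ k) = i).toList)
  blockReduceC ℓ (ℓ ^ k) raw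

theorem computesModProduct_naive {ℓ : ℕ} (hℓ : 0 < ℓ) (k : ℕ) :
    ComputesModProduct.{u} (ι := ι) ℓ k
      (ℓ * ℓ ^ k * (((ℓ - 1) * ℓ ^ k) * ((ℓ - 1) * ℓ ^ k) * 2) + (ℓ - 1) * ℓ ^ k)
      (naiveModMulC ℓ k) := by
  intro K _ _ w a b x y ha hb
  set N := (ℓ - 1) * ℓ ^ k with hN
  set L := ℓ * ℓ ^ k with hL
  refine RunLe.seq (runLe_tabN (x := fun i => if i < L then cyclicConv L N x y i else 0)
    (c := N * N * 2) (fun i hi => if_neg (by omega)) (fun i hi w' hw => ?_))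
    (fun raw w₁ hw₁ hraw => ?_)
  · rw [if_pos hi]
    refine (runLe_sumC_finset (c := 1) (x := fun p : ℕ × ℕ => x p.1 * y p.2)
      fun p _ w'' hw' => ?_).mono_cost ?_
    · exact runLe_mul ((ha _).mono (hw.trans hw')) ((hb _).mono (hw.trans hw'))
    · refine Nat.mul_le_mul_right _ ((Finset.card_filter_le _ _).trans ?_)
      rw [Finset.card_product, Finset.card_range]
  · refine (runLe_blockReduceC hraw).mono (fun z w' _ hz => ⟨_, hz, fun i hi => ?_, ?_⟩) le_rfl
    · exact if_neg (by omega)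
    · have hz := blockRing_root (K := K) ℓ (ℓ ^ k)
      rw [evalSeq_blockReduceSeq hℓ hz]
      have h1 := sum_cyclicConv (N := N) (Nat.mul_pos hℓ (Nat.pow_pos (n := k) hℓ))
        (pow_mul_eq_one_of_sum_eq_zero hz)
        (fun i => algebraMap K (BlockRing K ℓ (ℓ ^ k)) (x i))
        (fun i => algebraMap K (BlockRing K ℓ (ℓ ^ k)) (y i))
      rw [evalSeq, evalSeq, evalSeq, ← h1]
      refine Finset.sum_congr rfl fun i hi => ?_
      rw [if_pos (Finset.mem_range.1 hi)]
      simp only [cyclicConv, map_sum, map_mul, ← hL]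

/-- Powers of a register. -/
def powC (a : ι ⊕ ℕ) : ℕ → Comp ι (ι ⊕ ℕ)
  | 0 => pure oneReg
  | n + 1 => do
      let b ← powC a n
      arithC .mul b a

theorem runLe_powC {K : Type u} [Field K] {w : World ι K} {a : ι ⊕ ℕ} {x : K} (ha : Holds w a x)
    (n : ℕ) : RunLe w (powC a n) n fun r w' => Holds w' r (x ^ n) := by
  induction n with
  | zero => exact RunLe.pure (by simpa using holds_one w)
  | succ n ih =>
    refine RunLe.bind ih (c₂ := 1) fun b w₁ hw₁ hb => ?_
    rw [pow_succ]
    exact runLe_mul hb (ha.mono hw₁)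

/-- The constant `ℓ ^ (-n)`. -/
def invNatPowC (ℓ n : ℕ) : Comp ι (ι ⊕ ℕ) := do
  let l ← sumC (fun _ => pure oneReg) (List.range ℓ)
  let i ← arithC .div oneReg l
  powC i n

theorem runLe_invNatPowC {K : Type u} [Field K] {w : World ι K} {ℓ : ℕ} (hℓ : (ℓ : K) ≠ 0)
    (n : ℕ) :
    RunLe w (invNatPowC ℓ n) (ℓ + 1 + n) fun r w' => ∃ κ : K, Holds w' r κ ∧ κ * ℓ ^ n = 1 := by
  refine RunLe.bind (runLe_sumC_range (c := 0) (x := fun _ => (1 : K))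
    fun _ _ w' _ => RunLe.pure (holds_one w')) (c₂ := 1 + n) (fun l w₁ hw₁ hl => ?_)
  simp only [Finset.sum_const, Finset.card_range, nsmul_eq_mul, mul_one] at hl
  refine RunLe.bind (runLe_div (holds_one w₁) hl hℓ) (c₂ := n) (fun i w₂ hw₂ hi => ?_)
  refine (runLe_powC hi n).mono (fun r w' _ hr => ⟨_, hr, ?_⟩) le_rfl
  rw [← mul_pow, one_div_mul_cancel hℓ, one_pow]

/-- Multiplication of unreduced sequences. -/
def reducedMulC (ℓ N : ℕ) (mul : (ℕ → ι ⊕ ℕ) → (ℕ → ι ⊕ ℕ) → Comp ι (ℕ → ι ⊕ ℕ))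
    (a b : ℕ → ι ⊕ ℕ) : Comp ι (ℕ → ι ⊕ ℕ) := do
  let p ← blockReduceC ℓ N a
  let q ← blockReduceC ℓ N b
  mul p q

open Classical in
/-- One level of the recursion. -/
def modMulStepC (ℓ δ s r : ℕ) (mul : (ℕ → ι ⊕ ℕ) → (ℕ → ι ⊕ ℕ) → Comp ι (ℕ → ι ⊕ ℕ))
    (a b : ℕ → ι ⊕ ℕ) : Comp ι (ℕ → ι ⊕ ℕ) := do
  let t := ℓ ^ s
  let m := ℓ ^ r
  let m' := ℓ ^ (r + δ)
  let σ := ℓ ^ (r + δ - s)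
  let A ← transformC ℓ (ℓ * m') (s + 1) σ (splitBlocks zeroReg m ((ℓ - 1) * t) a)
  let B ← transformC ℓ (ℓ * m') (s + 1) σ (splitBlocks zeroReg m ((ℓ - 1) * t) b)
  let c ← tabList (ℓ ^ (s + 1)) (fun _ => zeroReg) fun e =>
    if ℓ ∣ e then pure fun _ => zeroReg
    else reducedMulC ℓ m' mul (A e) (B e)
  let G ← transformC ℓ (ℓ * m') (s + 1) (σ * (ℓ ^ (s + 1) - 1)) c
  let κ ← invNatPowC ℓ (s + 1)
  let H ← tabList ((ℓ - 1) * t) (fun _ => zeroReg) fun j => tabN (2 * m) fun i => do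
    let u ← arithC .sub (G j i) (G ((ℓ - 1) * t + j % t) i)
    let v ← arithC .sub (G j ((ℓ - 1) * m' + i % m'))
      (G ((ℓ - 1) * t + j % t) ((ℓ - 1) * m' + i % m'))
    let d ← arithC .sub u v
    arithC .mul κ d
  let raw ← tabN (ℓ * ℓ ^ (s + r)) fun i =>
    arithC .add (if i / m < (ℓ - 1) * t then H (i / m) (i % m) else zeroReg)
      (if 1 ≤ i / m ∧ i / m ≤ (ℓ - 1) * t then H (i / m - 1) (m + i % m) else zeroReg)
  blockReduceC ℓ (ℓ ^ (s + r)) raw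

theorem stores_splitBlocks {K : Type u} [Field K] {w : World ι K} {a : ℕ → ι ⊕ ℕ} {x : ℕ → K}
    (ha : Stores w a x) (m N j : ℕ) :
    Stores w (splitBlocks zeroReg m N a j) (splitBlocks 0 m N x j) := by
  intro i
  unfold splitBlocks
  split_ifs
  · exact ha _
  · exact holds_zero w

/-- Only the (ℓ−1)t indices prime to ℓ lead to a recursive multiplication. This count, rather than
ℓt, is what makes the recursion balance. -/
theorem sum_range_not_dvd {ℓ : ℕ} (hℓ : 0 < ℓ) (t c : ℕ) :
    ((List.range (ℓ * t)).map fun e => if ℓ ∣ e then 0 else c).sum = (ℓ - 1) * t * c := by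
  have h0 : ((List.range (ℓ * t)).map fun e => if ℓ ∣ e then 0 else c).sum
      = ∑ e ∈ Finset.range (t * ℓ), if ℓ ∣ e then 0 else c := by rw [mul_comm]; rfl
  rw [h0, sum_range_mul]
  obtain ⟨l, rfl⟩ : ∃ l, ℓ = l + 1 := ⟨ℓ - 1, by omega⟩
  have h1 : ∀ j, ∑ r ∈ Finset.range (l + 1), (if l + 1 ∣ j * (l + 1) + r then 0 else c)
      = l * c := by
    intro j
    rw [Finset.sum_range_succ', if_pos (by simp), add_zero]
    have : ∀ r ∈ Finset.range l, (if l + 1 ∣ j * (l + 1) + (r + 1) then 0 else c) = c := by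
      intro r hr
      rw [if_neg]
      rw [Nat.dvd_add_right (Dvd.intro_left j rfl)]
      exact Nat.not_dvd_of_pos_of_lt (Nat.succ_pos _) (by have := Finset.mem_range.1 hr; omega)
    rw [Finset.sum_congr rfl this]
    simp
  simp only [h1, Finset.sum_const, Finset.card_range, smul_eq_mul, Nat.add_sub_cancel]
  ring

/-- The terms of the cost are: three transforms; the pointwise products, each with reductions of two
factors to 2ℓ^r coefficients; the constant ℓ^(−s−1); three subtractions and a scaling for each
coefficient of each H_j; the overlapping addition; the final reduction. -/
theorem computesModProduct_step {ℓ δ s r cD : ℕ} (hℓ : ℓ.Prime) (hδ : (ℓ - 1) * ℓ ^ δ = 2)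
    (hsr : s ≤ r + δ) {mul : (ℕ → ι ⊕ ℕ) → (ℕ → ι ⊕ ℕ) → Comp ι (ℕ → ι ⊕ ℕ)}
    (hmul : ComputesModProduct.{u} ℓ (r + δ) cD mul) :
    ComputesModProduct.{u} ℓ (s + r)
      (3 * ((s + 1) * (ℓ ^ (s + 1) * (ℓ * ℓ ^ (r + δ) * ℓ)))
        + (ℓ - 1) * ℓ ^ s * (4 * ℓ ^ r + cD) + (ℓ + 1 + (s + 1))
        + (ℓ - 1) * ℓ ^ s * (2 * ℓ ^ r * 4) + ℓ * ℓ ^ (s + r) + (ℓ - 1) * ℓ ^ (s + r))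
      (modMulStepC ℓ δ s r mul) := by
  classical
  intro K _ hK w a b x y ha hb
  have hℓ0 := hℓ.pos
  set t := ℓ ^ s with ht
  set m := ℓ ^ r with hm
  set m' := ℓ ^ (r + δ) with hm'
  set σ := ℓ ^ (r + δ - s) with hσ
  have hm0 : 0 < m := Nat.pow_pos hℓ0
  have ht0 : 0 < t := Nat.pow_pos hℓ0
  have h2m : (ℓ - 1) * m' = 2 * m := by
    rw [hm', pow_add, ← hm, mul_comm m, ← mul_assoc, hδ]
  have hlt : (ℓ - 1) * t < ℓ * t := Nat.mul_lt_mul_of_pos_right (by omega) ht0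
  set cT := (s + 1) * (ℓ ^ (s + 1) * (ℓ * m' * ℓ)) with hcT
  set Y := transform ℓ (ℓ * m') (s + 1) σ (splitBlocks 0 m ((ℓ - 1) * t) x) with hY
  set Z := transform ℓ (ℓ * m') (s + 1) σ (splitBlocks 0 m ((ℓ - 1) * t) y) with hZ
  set c1 := (ℓ - 1) * t * (4 * m + cD) with hc1
  set c2 := ℓ + 1 + (s + 1) with hc2
  set c3 := (ℓ - 1) * t * (2 * m * 4) with hc3
  set c4 := ℓ * ℓ ^ (s + r) with hc4
  set c5 := (ℓ - 1) * ℓ ^ (s + r) with hc5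
  refine RunLe.mono_cost (c := cT + (cT + (c1 + (cT + (c2 + (c3 + (c4 + c5))))))) ?_
    (le_of_eq (by ring))
  refine RunLe.seq (runLe_transformC _ _ fun j => stores_splitBlocks ha m _ j) (fun A w₁ hw₁ hA => ?_)
  refine RunLe.seq (runLe_transformC _ _ fun j => stores_splitBlocks (hb.mono hw₁) m _ j) (fun B w₂ hw₂ hB => ?_)
  have hpt := runLe_tab (w := w₂) (d := fun _ => zeroReg) (l := List.range (ℓ ^ (s + 1)))
    (f := fun e => if ℓ ∣ e then pure fun _ => zeroReg
      else reducedMulC ℓ m' mul (A e) (B e)) (c := fun e => if ℓ ∣ e then 0 else 4 * m + cD)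
    (P := fun e z w' => ∃ v : ℕ → K, Stores w' z v ∧ (ℓ ∣ e → v = 0) ∧
      (e < ℓ ^ (s + 1) → ¬ ℓ ∣ e →
        IsModProduct ℓ m' (blockReduceSeq ℓ m' (Y e)) (blockReduceSeq ℓ m' (Z e)) v))
    (fun e z w₁ w₂ hw ⟨v, hv, hv'⟩ => ⟨v, hv.mono hw, hv'⟩)
    (fun e w' _ he => ⟨0, fun _ => holds_zero w', fun _ => rfl,
      fun h => absurd h (by simpa using he)⟩)
    (fun e he w₃ hw₃ => by
      split_ifs with hd
      · exact RunLe.pure ⟨0, fun _ => holds_zero w₃, fun _ => rfl, fun _ h => absurd hd h⟩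
      · refine RunLe.bind (c₂ := (ℓ - 1) * m' + cD) (runLe_blockReduceC ((hA e).mono (hw₂.trans hw₃))) (fun p w₄ hw₄ hp => ?_) (by rw [h2m]; omega)
        refine RunLe.seq (runLe_blockReduceC ((hB e).mono (hw₃.trans hw₄))) (fun q w₅ hw₅ hq => ?_)
        exact (hmul K hK w₅ p q _ _ (hp.mono hw₅) hq).mono
          (fun z w' _ ⟨v, hv, hv'⟩ => ⟨v, hv, fun h => absurd h hd, fun _ _ => hv'⟩) le_rfl)
  rw [pow_succ', sum_range_not_dvd hℓ0] at hpt
  refine RunLe.seq (by rw [← ht] at hpt; rw [pow_succ']; exact hpt) (fun c w₃ hw₃ hc => ?_)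
  choose v hv hv0 hvm using hc
  refine RunLe.seq (runLe_transformC _ _ hv)
    (fun G w₄ hw₄ hG => ?_)
  refine RunLe.seq (runLe_invNatPowC hK (s + 1))
    (fun k w₅ hw₅ ⟨κ, hk, hκ⟩ => ?_)
  set W := transform ℓ (ℓ * m') (s + 1) (σ * (ℓ ^ (s + 1) - 1)) v with hW
  set U : ℕ → ℕ → K := fun j i => if j < (ℓ - 1) * t ∧ i < 2 * m then
    κ * blockReduce ℓ m' (blockReduce ℓ t W j) i else 0 with hU
  refine RunLe.seq (runLe_tabList (c := 2 * m * 4) (P := fun j z w' => Stores w' z (U j))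
    (fun _ _ _ _ hw h => h.mono hw)
    (fun j w' _ hj i => by
      rw [show U j i = 0 from if_neg fun h => absurd h.1 (not_lt.2 hj)]; exact holds_zero w')
    (fun j hj w₆ hw₆ => runLe_tabN
      (fun i hi => if_neg fun h => absurd h.2 (not_lt.2 hi)) (fun i hi w₇ hw₇ => ?_))) (fun H w₆ hw₆ hH => ?_)
  · have hst : ∀ j i, Holds w₇ (G j i) (W j i) :=
      fun j i => (hG j i).mono (hw₅.trans (hw₆.trans hw₇))
    rw [show U j i = _ from if_pos ⟨hj, hi⟩]
    refine RunLe.bind (c₂ := 3) (runLe_sub (hst _ _) (hst _ _)) (fun u w₈ hw₈ hu => ?_)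
    refine RunLe.bind (c₂ := 2) (runLe_sub ((hst _ _).mono hw₈) ((hst _ _).mono hw₈))
      (fun u' w₉ hw₉ hu' => ?_)
    refine RunLe.bind (c₂ := 1) (runLe_sub (hu.mono hw₉) hu') (fun d w₁₀ hw₁₀ hd => ?_)
    exact runLe_mul (hk.mono (hw₆.trans (hw₇.trans (hw₈.trans (hw₉.trans hw₁₀))))) hd
  refine RunLe.bind (c₂ := c5) (runLe_tabN (c := 1) (x := overlapAdd m ((ℓ - 1) * t) U)
    (fun i hi => ?_) (fun i hi w₇ hw₇ => ?_)) (fun raw w₇ hw₇ hraw => ?_) (by rw [mul_one])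
  · have : ℓ * t ≤ i / m := by
      rw [Nat.le_div_iff_mul_le hm0, mul_assoc, ht, hm, ← pow_add]; exact hi
    rw [overlapAdd, if_neg (by omega), if_neg (by omega), add_zero]
  · refine runLe_add ?_ ?_
    · split_ifs
      · exact (hH _ _).mono hw₇
      · exact holds_zero w₇
    · split_ifs
      · exact (hH _ _).mono hw₇
      · exact holds_zero w₇
  refine (runLe_blockReduceC hraw).mono (fun z w' _ hz => ⟨_, hz, ?_⟩) le_rfl
  refine isModProduct_step hℓ hδ hsr x y hκ hv0 (fun e he hd => hvm e (by rwa [ht, ← pow_succ']) hd)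
    (fun j hj i hi => ?_)
  exact if_pos ⟨hj, hi⟩

theorem ComputesModProduct.mono {ℓ k c c' : ℕ}
    {prog : (ℕ → ι ⊕ ℕ) → (ℕ → ι ⊕ ℕ) → Comp ι (ℕ → ι ⊕ ℕ)}
    (h : ComputesModProduct.{u} ℓ k c prog) (hc : c ≤ c') :
    ComputesModProduct.{u} ℓ k c' prog :=
  fun K _ hK w a b x y ha hb => (h K hK w a b x y ha hb).mono_cost hc

/-- The number of operations of fast multiplication, divided by the length. -/
def fastMulCost (k : ℕ) : ℕ := 20600 * ((k - 3) * (Nat.log 2 (k - 3) + 1)) + 20000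

theorem fastMulCost_mono {k k' : ℕ} (h : k ≤ k') : fastMulCost k ≤ fastMulCost k' := by
  unfold fastMulCost
  have h1 : k - 3 ≤ k' - 3 := Nat.sub_le_sub_right h 3
  have h2 := Nat.log_mono_right (b := 2) h1
  gcongr

/-- In u = k − 3 the recursion halves, u' ≤ u/2, and u(log u + 1) gains u on each level. The factor
20600 covers 20000 + 130(u + 3) ≤ 20000 + 20600u for u ≥ 1, the extra 20000 coming from the doubled
additive constant. -/
theorem fastMulCost_step {k k' : ℕ} (hk : 4 ≤ k) (hk' : 2 * k' ≤ k + 3) :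
    2 * fastMulCost k' + 130 * k ≤ fastMulCost k := by
  obtain ⟨u, rfl⟩ : ∃ u, k = u + 3 := ⟨k - 3, by omega⟩
  have hu : k' - 3 ≤ u / 2 := by omega
  have h1 : (k' - 3) * (Nat.log 2 (k' - 3) + 1) ≤ u / 2 * Nat.log 2 u := by
    rcases Nat.lt_or_ge u 2 with h | h
    · have : k' - 3 = 0 := by omega
      simp [this]
    · have h2 : Nat.log 2 (u / 2) = Nat.log 2 u - 1 := Nat.log_div_base 2 u
      have h3 : 1 ≤ Nat.log 2 u := Nat.log_pos one_lt_two h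
      have h4 := Nat.log_mono_right (b := 2) hu
      exact Nat.mul_le_mul hu (by omega)
  have h5 : 2 * (u / 2 * Nat.log 2 u) ≤ u * Nat.log 2 u := by
    rw [← mul_assoc]; exact Nat.mul_le_mul_right _ (Nat.mul_div_le u 2)
  unfold fastMulCost
  rw [Nat.add_sub_cancel]
  nlinarith

/-- Schönhage's multiplication algorithm, in the radix-`2` and radix-`3` versions. -/
theorem exists_computesModProduct {ℓ δ : ℕ} (hℓ : ℓ.Prime) (hδ : (ℓ - 1) * ℓ ^ δ = 2) (k : ℕ) :
    ∃ prog : (ℕ → ι ⊕ ℕ) → (ℕ → ι ⊕ ℕ) → Comp ι (ℕ → ι ⊕ ℕ),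
      ComputesModProduct.{u} ℓ k (ℓ ^ k * fastMulCost k) prog := by
  have hℓ2 := hℓ.two_le
  have hℓ3 : ℓ ≤ 3 := by
    have : ℓ - 1 ≤ 2 := Nat.le_of_dvd two_pos ⟨_, hδ.symm⟩
    omega
  have hδ1 : δ ≤ 1 := by
    by_contra h
    have h1 : ℓ ^ 2 ≤ ℓ ^ δ := Nat.pow_le_pow_right hℓ.pos (by omega)
    have h2 : 2 ^ 2 ≤ ℓ ^ 2 := Nat.pow_le_pow_left hℓ2 2
    have h3 : ℓ ^ δ ≤ (ℓ - 1) * ℓ ^ δ := Nat.le_mul_of_pos_left _ (by omega)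
    omega
  induction k using Nat.strong_induction_on with
  | _ k ih =>
    rcases Nat.lt_or_ge k 4 with hk | hk
    · refine ⟨_, (computesModProduct_naive hℓ.pos k).mono ?_⟩
      -- 54 = 2·3³. Classical multiplication then costs at most 3·54·54·2 + 2 = 17498 per unit of
      -- length, below the additive constant 20000.
      have h1 : (ℓ - 1) * ℓ ^ k ≤ 54 :=
        (Nat.mul_le_mul (show ℓ - 1 ≤ 2 by omega) ((Nat.pow_le_pow_left hℓ3 k).trans
          (Nat.pow_le_pow_right (by omega) (show k ≤ 3 by omega)))).trans (by norm_num)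
      have h2 : ((ℓ - 1) * ℓ ^ k) * ((ℓ - 1) * ℓ ^ k) ≤ 54 * 54 := Nat.mul_le_mul h1 h1
      calc _ ≤ 3 * ℓ ^ k * (54 * 54 * 2) + 2 * ℓ ^ k := by gcongr; omega
        _ = ℓ ^ k * 17498 := by ring
        _ ≤ _ := Nat.mul_le_mul_left _ (by unfold fastMulCost; omega)
    -- About √n blocks of length about √n. The subproblems have exponent r + δ with 2(r + δ) ≤ k +
    -- 3, which is less than k from k = 4 on.
    · obtain ⟨s, hs⟩ : ∃ s, s = k / 2 := ⟨_, rfl⟩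
      obtain ⟨r, hr⟩ : ∃ r, r = k - k / 2 := ⟨_, rfl⟩
      have hsr : s + r = k := by omega
      obtain ⟨prog, hprog⟩ := ih (r + δ) (by omega)
      refine ⟨modMulStepC ℓ δ s r prog, ?_⟩
      have := computesModProduct_step hℓ hδ (show s ≤ r + δ by omega) hprog
      rw [hsr] at this
      refine this.mono ?_
      have hn : ℓ ^ s * ℓ ^ r = ℓ ^ k := by rw [← pow_add, hsr]
      have hpos : 1 ≤ ℓ ^ k := Nat.one_le_pow _ _ hℓ.pos
      have e1 : ℓ ^ (s + 1) * (ℓ * ℓ ^ (r + δ) * ℓ) ≤ 27 * ℓ ^ k := by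
        have h1 : ℓ ^ (s + 1) * (ℓ * ℓ ^ (r + δ) * ℓ) = ℓ ^ k * (ℓ ^ 2 * (ℓ * ℓ ^ δ)) := by
          rw [← hn, pow_add, pow_add]; ring
        have h2 : ℓ * ℓ ^ δ ≤ 2 + ℓ ^ δ := by
          obtain ⟨l, rfl⟩ : ∃ l, ℓ = l + 1 := ⟨ℓ - 1, by omega⟩
          rw [Nat.add_sub_cancel] at hδ
          rw [add_mul, hδ, one_mul]
        have h3 : ℓ ^ 2 * (ℓ * ℓ ^ δ) ≤ 27 := by
          have : ℓ = 2 ∨ ℓ = 3 := by omega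
          rcases this with rfl | rfl
          · have : 2 ^ δ ≤ 2 ^ 1 := Nat.pow_le_pow_right two_pos hδ1
            omega
          · have : 3 ^ δ = 1 := by omega
            omega
        rw [h1, mul_comm 27]
        exact Nat.mul_le_mul_left _ h3
      have e2 : (ℓ - 1) * ℓ ^ s * (4 * ℓ ^ r + ℓ ^ (r + δ) * fastMulCost (r + δ))
          ≤ 8 * ℓ ^ k + 2 * (ℓ ^ k * fastMulCost (r + δ)) := by
        have h1 : (ℓ - 1) * ℓ ^ s * (4 * ℓ ^ r + ℓ ^ (r + δ) * fastMulCost (r + δ))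
          = (ℓ - 1) * 4 * ℓ ^ k + ((ℓ - 1) * ℓ ^ δ) * (ℓ ^ k * fastMulCost (r + δ)) := by
            rw [← hn, pow_add]; ring
        rw [h1, hδ]
        gcongr
        omega
      have e3 : (ℓ - 1) * ℓ ^ s * (2 * ℓ ^ r * 4) ≤ 16 * ℓ ^ k := by
        have h1 : (ℓ - 1) * ℓ ^ s * (2 * ℓ ^ r * 4) = (ℓ - 1) * 8 * ℓ ^ k := by
          rw [← hn]; ring
        rw [h1]; gcongr; omega
      have e4 : ℓ * ℓ ^ k ≤ 3 * ℓ ^ k := by gcongr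
      have e5 : (ℓ - 1) * ℓ ^ k ≤ 2 * ℓ ^ k := by gcongr; omega
      have e6 := fastMulCost_step hk (show 2 * (r + δ) ≤ k + 3 by omega)
      have e7 : (s + 1) * (ℓ ^ (s + 1) * (ℓ * ℓ ^ (r + δ) * ℓ)) ≤ (s + 1) * (27 * ℓ ^ k) :=
        Nat.mul_le_mul_left _ e1
      have e8 : ℓ + 1 + (s + 1) ≤ (s + 5) * ℓ ^ k :=
        le_trans (by omega) (Nat.le_mul_of_pos_right _ hpos)
      have e9 := Nat.mul_le_mul_left (ℓ ^ k) e6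
      -- 82s + 115 collects 3·27(s + 1) for the transforms, s + 5 for the constant, and 8 + 16 + 3 +
      -- 2 for the linear terms.
      have e10 : (82 * s + 115) * ℓ ^ k ≤ (130 * k) * ℓ ^ k := Nat.mul_le_mul_right _ (by omega)
      nlinarith

end FastMul

/-! ## Programs for polynomial arithmetic -/

section PolyArith

variable {K : Type u} [Field K] {ι : Type}

/-- The number of coefficients of a polynomial. -/
def polyLen (p : K[X]) : ℕ := by
  classical exact if p = 0 then 0 else p.natDegree + 1

theorem polyLen_zero : polyLen (0 : K[X]) = 0 := by simp [polyLen]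

theorem polyLen_of_ne_zero {p : K[X]} (hp : p ≠ 0) : polyLen p = p.natDegree + 1 := by
  simp [polyLen, hp]

theorem polyLen_eq_zero {p : K[X]} : polyLen p = 0 ↔ p = 0 := by
  by_cases hp : p = 0 <;> simp [polyLen, hp]

theorem polyLen_le_iff {p : K[X]} {n : ℕ} : polyLen p ≤ n ↔ p.degree < n := by
  by_cases hp : p = 0
  · simp [polyLen, hp]
  · rw [polyLen_of_ne_zero hp, degree_eq_natDegree hp, Nat.cast_lt, Nat.succ_le_iff]

theorem degree_lt_polyLen (p : K[X]) : p.degree < polyLen p := polyLen_le_iff.1 le_rfl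

theorem coeff_eq_zero_of_polyLen_le {p : K[X]} {n i : ℕ} (h : polyLen p ≤ n) (hi : n ≤ i) :
    p.coeff i = 0 :=
  coeff_eq_zero_of_degree_lt (lt_of_lt_of_le (polyLen_le_iff.1 h) (by exact_mod_cast hi))

theorem coeff_polyLen_sub_one {p : K[X]} (hp : p ≠ 0) :
    p.coeff (polyLen p - 1) = p.leadingCoeff := by
  rw [polyLen_of_ne_zero hp]; rfl

theorem polyLen_eq_of_coeff_ne_zero {p : K[X]} {n : ℕ} (h : polyLen p ≤ n + 1)
    (hn : p.coeff n ≠ 0) : polyLen p = n + 1 := by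
  refine le_antisymm h ?_
  by_contra hlt
  exact hn (coeff_eq_zero_of_polyLen_le (n := n) (by omega) le_rfl)

theorem polyLen_lt_iff_degree_lt {p q : K[X]} : polyLen p < polyLen q ↔ p.degree < q.degree := by
  by_cases hq : q = 0
  · simp [hq, polyLen_zero]
  · rw [polyLen_of_ne_zero hq, Nat.lt_succ_iff, polyLen_le_iff, degree_eq_natDegree hq]

/-- Products of polynomials with at most `n` coefficients by fast multiplication. -/
theorem isModProduct_coeff {ℓ N : ℕ} (hℓ : 0 < ℓ) (hN : 0 < N) {p q : K[X]} {v : ℕ → K}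
    (hv : IsModProduct ℓ N p.coeff q.coeff v) (hp : polyLen p ≤ (ℓ - 1) * N)
    (hq : polyLen q ≤ (ℓ - 1) * N) (hpq : polyLen (p * q) ≤ (ℓ - 1) * N) :
    v = (p * q).coeff := by
  obtain ⟨h0, h1⟩ := hv
  have h2 : ∀ p : K[X], polyLen p ≤ (ℓ - 1) * N →
      ∑ i ∈ Finset.range ((ℓ - 1) * N), C (p.coeff i) * X ^ i = p := fun p hp => by
    by_cases h : p = 0
    · simp [h]
    · rw [polyLen_of_ne_zero h] at hp
      exact (as_sum_range_C_mul_X_pow' p (by omega)).symm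
  rw [evalSeq_root, evalSeq_root, evalSeq_root, h2 p hp, h2 q hq, ← map_mul,
    AdjoinRoot.mk_eq_mk] at h1
  set V := ∑ i ∈ Finset.range ((ℓ - 1) * N), C (v i) * X ^ i with hV
  have hVd : V.degree < ((ℓ - 1) * N : ℕ) := by
    rw [← mem_degreeLT]
    refine Submodule.sum_mem _ fun i hi => ?_
    rw [mem_degreeLT]
    refine (degree_C_mul_X_pow_le _ _).trans_lt ?_
    exact_mod_cast Finset.mem_range.1 hi
  have hVpq : V = p * q := by
    by_contra hne
    refine absurd (degree_le_of_dvd h1 (sub_ne_zero.2 hne)) (not_le.2 ?_)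
    rw [degree_blockCyclotomic hℓ hN]
    exact (degree_sub_le _ _).trans_lt (max_lt hVd (polyLen_le_iff.1 hpq))
  rw [← hVpq]
  funext i
  simp only [hV, finsetSum_coeff, coeff_C_mul, coeff_X_pow, mul_ite, mul_one, mul_zero,
    Finset.sum_ite_eq, Finset.mem_range]
  split_ifs with h
  · rfl
  · exact h0 i (by omega)

/-- The number of operations of fast multiplication of polynomials with `n` coefficients. -/
def polyMulCost (n : ℕ) : ℕ := 3 * n * fastMulCost (Nat.clog 2 n)

/-- The radix has to be invertible in K: 3 in characteristic 2, otherwise 2, with (ℓ−1)ℓ^δ = 2 in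
both cases. One program serves all fields of characteristic p. Rounding the length up to a power of
ℓ costs a factor of at most 3, and the product is exact since it fits below the degree of the
modulus. -/
theorem exists_polyMul (p n : ℕ) (hn : 0 < n) :
    ∃ prog : (ℕ → ι ⊕ ℕ) → (ℕ → ι ⊕ ℕ) → Comp ι (ℕ → ι ⊕ ℕ),
      ∀ (K : Type u) [Field K], ringChar K = p → ∀ (w : World ι K) (a b : ℕ → ι ⊕ ℕ) (f g : K[X]),
        Stores w a f.coeff → Stores w b g.coeff → polyLen f ≤ n → polyLen g ≤ n →
        polyLen (f * g) ≤ n →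
        RunLe w (prog a b) (polyMulCost n) fun z w' => Stores w' z (f * g).coeff := by
  obtain ⟨ℓ, δ, hℓ, hδ, hp⟩ : ∃ ℓ δ : ℕ, ℓ.Prime ∧ (ℓ - 1) * ℓ ^ δ = 2 ∧
      ∀ (K : Type u) [Field K], ringChar K = p → (ℓ : K) ≠ 0 := by
    by_cases h : p = 2
    · subst h
      refine ⟨3, 0, Nat.prime_three, by norm_num, fun K _ hK h3 => ?_⟩
      rw [ringChar.spec, hK] at h3
      omega
    · refine ⟨2, 1, Nat.prime_two, by norm_num, fun K _ hK h2 => ?_⟩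
      rw [ringChar.spec, hK] at h2
      rcases (Nat.dvd_prime Nat.prime_two).1 h2 with h1 | h1
      · refine one_ne_zero (α := K) ?_
        rw [← Nat.cast_one, ringChar.spec, hK, h1]
      · exact h h1
  obtain ⟨prog, hprog⟩ := exists_computesModProduct.{u} (ι := ι) hℓ hδ (Nat.clog ℓ n)
  have hℓ2 := hℓ.two_le
  have hnN : n ≤ (ℓ - 1) * ℓ ^ Nat.clog ℓ n :=
    (Nat.le_pow_clog hℓ.one_lt n).trans (Nat.le_mul_of_pos_left _ (by omega))
  refine ⟨prog, fun K _ hK w a b f g ha hb hf hg hfg => ?_⟩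
  refine (hprog K (hp K hK) w a b _ _ ha hb).mono (fun z w' _ ⟨v, hv, hv'⟩ => ?_) ?_
  · rw [← isModProduct_coeff hℓ.pos (Nat.pow_pos hℓ.pos) hv' (hf.trans hnN) (hg.trans hnN)
      (hfg.trans hnN)]
    exact hv
  · have h1 : ℓ ^ Nat.clog ℓ n ≤ 3 * n := by
      rcases Nat.lt_or_ge 1 n with h | h
      · have h2 := Nat.pow_pred_clog_lt_self hℓ.one_lt h
        have h3 : 0 < Nat.clog ℓ n := Nat.clog_pos hℓ.one_lt h
        have h4 : ℓ ≤ 3 := by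
          have : ℓ - 1 ≤ 2 := Nat.le_of_dvd two_pos ⟨_, hδ.symm⟩
          omega
        calc ℓ ^ Nat.clog ℓ n = ℓ * ℓ ^ (Nat.clog ℓ n - 1) := by
              rw [← pow_succ', Nat.sub_add_cancel h3]
          _ ≤ 3 * n := Nat.mul_le_mul h4 (le_of_lt h2)
      · rw [Nat.clog_of_right_le_one h, pow_zero]; omega
    refine Nat.mul_le_mul h1 (fastMulCost_mono ?_)
    exact Nat.clog_anti_left one_lt_two hℓ2

/-! ### Classical arithmetic -/

/-- The program for `p + c * X ^ j * q`. -/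
def addMulShiftC (a : ℕ → ι ⊕ ℕ) (c : ι ⊕ ℕ) (j : ℕ) (b : ℕ → ι ⊕ ℕ) (nb : ℕ) :
    Comp ι (ℕ → ι ⊕ ℕ) := do
  let g ← tabN nb fun i => do
    let m ← arithC .mul c (b i)
    arithC .add (a (i + j)) m
  pure fun i => if j ≤ i ∧ i < j + nb then g (i - j) else a i

theorem runLe_addMulShiftC {w : World ι K} {a b : ℕ → ι ⊕ ℕ} {c : ι ⊕ ℕ} {p q : K[X]} {γ : K}
    (j : ℕ) {nb : ℕ} (ha : Stores w a p.coeff) (hc : Holds w c γ) (hb : Stores w b q.coeff)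
    (hq : polyLen q ≤ nb) :
    RunLe w (addMulShiftC a c j b nb) (nb * 2) fun z w' =>
      Stores w' z (p + C γ * X ^ j * q).coeff := by
  refine RunLe.bind (c₂ := 0) (runLe_tabN (c := 2)
    (x := fun i => if i < nb then p.coeff (i + j) + γ * q.coeff i else 0)
    (fun i hi => if_neg (by omega)) (fun i hi w₁ hw₁ => ?_)) (fun g w₁ hw₁ hg => ?_)
  · rw [if_pos hi]
    refine RunLe.bind (c₂ := 1) (runLe_mul (hc.mono hw₁) ((hb i).mono hw₁)) fun m w₂ hw₂ hm => ?_
    exact runLe_add ((ha _).mono (hw₁.trans hw₂)) hm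
  · refine RunLe.pure fun i => ?_
    have hco : (p + C γ * X ^ j * q).coeff i
        = if j ≤ i then p.coeff i + γ * q.coeff (i - j) else p.coeff i := by
      rw [mul_assoc, coeff_add, coeff_C_mul, coeff_X_pow_mul']
      split_ifs <;> simp
    rw [hco]
    split_ifs with h1 h2 h2
    · have := hg (i - j)
      dsimp only at this
      rw [if_pos (by omega), Nat.sub_add_cancel h2] at this
      exact this
    · exact absurd h1.1 h2
    · rw [coeff_eq_zero_of_polyLen_le hq (by omega), mul_zero, add_zero]
      exact (ha i).mono hw₁
    · exact (ha i).mono hw₁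

/-- The program for `p + q * r`. -/
def addMulC (a b : ℕ → ι ⊕ ℕ) (d : ℕ → ι ⊕ ℕ) (nd : ℕ) : ℕ → Comp ι (ℕ → ι ⊕ ℕ)
  | 0 => pure a
  | n + 1 => do
      let z ← addMulC a b d nd n
      addMulShiftC z (b n) n d nd

theorem runLe_addMulC {w : World ι K} {a b d : ℕ → ι ⊕ ℕ} {p q r : K[X]} {nb nd : ℕ}
    (ha : Stores w a p.coeff) (hb : Stores w b q.coeff) (hd : Stores w d r.coeff)
    (hq : polyLen q ≤ nb) (hr : polyLen r ≤ nd) :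
    RunLe w (addMulC a b d nd nb) (nb * (nd * 2)) fun z w' => Stores w' z (p + q * r).coeff := by
  suffices H : ∀ n, RunLe w (addMulC a b d nd n) (n * (nd * 2)) fun z w' =>
      Stores w' z (p + (∑ i ∈ Finset.range n, C (q.coeff i) * X ^ i) * r).coeff by
    have := H nb
    by_cases h : q = 0
    · subst h; simpa using this
    · rw [polyLen_of_ne_zero h] at hq
      rwa [← as_sum_range_C_mul_X_pow' q (by omega)] at this
  intro n
  induction n with
  | zero => exact RunLe.pure (by simpa using ha)
  | succ n ih =>
    refine RunLe.bind (c₂ := nd * 2) ih (fun z w₁ hw₁ hz => ?_) (by rw [add_mul, one_mul])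
    rw [Finset.sum_range_succ, add_mul, ← add_assoc]
    exact runLe_addMulShiftC n hz ((hb n).mono hw₁) (hd.mono hw₁) hr

/-- The program for the product of two polynomials. -/
def mulC (b : ℕ → ι ⊕ ℕ) (nb : ℕ) (d : ℕ → ι ⊕ ℕ) (nd : ℕ) : Comp ι (ℕ → ι ⊕ ℕ) :=
  addMulC (fun _ => zeroReg) b d nd nb

theorem stores_zero (w : World ι K) : Stores w (fun _ : ℕ => zeroReg) (0 : K[X]).coeff :=
  fun _ => by simpa using holds_zero w

theorem runLe_mulC {w : World ι K} {b d : ℕ → ι ⊕ ℕ} {q r : K[X]} {nb nd : ℕ}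
    (hb : Stores w b q.coeff) (hd : Stores w d r.coeff)
    (hq : polyLen q ≤ nb) (hr : polyLen r ≤ nd) :
    RunLe w (mulC b nb d nd) (nb * (nd * 2)) fun z w' => Stores w' z (q * r).coeff := by
  simpa [mulC] using runLe_addMulC (stores_zero w) hb hd hq hr

/-- The program for `-p`. -/
def negC (a : ℕ → ι ⊕ ℕ) (n : ℕ) : Comp ι (ℕ → ι ⊕ ℕ) := tabN n fun i => arithC .sub zeroReg (a i)

theorem runLe_negC {w : World ι K} {a : ℕ → ι ⊕ ℕ} {p : K[X]} {n : ℕ} (ha : Stores w a p.coeff)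
    (hp : polyLen p ≤ n) : RunLe w (negC a n) n fun z w' => Stores w' z (-p).coeff := by
  have := runLe_tabN (w := w) (N := n) (c := 1) (f := fun i => arithC .sub zeroReg (a i))
    (x := (-p).coeff) (fun i hi => by rw [coeff_neg, coeff_eq_zero_of_polyLen_le hp hi, neg_zero])
    (fun i _ w' hw => by
      rw [coeff_neg, ← zero_sub]; exact runLe_sub (holds_zero w') ((ha i).mono hw))
  rwa [mul_one] at this

/-- The program for `c⁻¹ * p`. -/
def divScalarC (a : ℕ → ι ⊕ ℕ) (n : ℕ) (c : ι ⊕ ℕ) : Comp ι (ℕ → ι ⊕ ℕ) :=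
  tabN n fun i => arithC .div (a i) c

theorem runLe_divScalarC {w : World ι K} {a : ℕ → ι ⊕ ℕ} {p : K[X]} {n : ℕ} {c : ι ⊕ ℕ} {γ : K}
    (ha : Stores w a p.coeff) (hp : polyLen p ≤ n) (hc : Holds w c γ) (hγ : γ ≠ 0) :
    RunLe w (divScalarC a n c) n fun z w' => Stores w' z (C γ⁻¹ * p).coeff := by
  have := runLe_tabN (w := w) (N := n) (c := 1) (f := fun i => arithC .div (a i) c)
    (x := (C γ⁻¹ * p).coeff)
    (fun i hi => by rw [coeff_C_mul, coeff_eq_zero_of_polyLen_le hp hi, mul_zero])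
    (fun i _ w' hw => by
      rw [coeff_C_mul, mul_comm, ← div_eq_mul_inv]
      exact runLe_div ((ha i).mono hw) (hc.mono hw) hγ)
  rwa [mul_one] at this

/-- The program for `polyLen`. -/
def lenC (a : ℕ → ι ⊕ ℕ) : ℕ → Comp ι ℕ
  | 0 => pure 0
  | n + 1 => do
      let b ← isZeroC (a n)
      if b then lenC a n else pure (n + 1)

/-- Zero tests from the top coefficient downwards turn the degree into discrete data: on each branch
of the tree it is a known number. -/
theorem runLe_lenC {w : World ι K} {a : ℕ → ι ⊕ ℕ} {p : K[X]} {n : ℕ} (ha : Stores w a p.coeff)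
    (hp : polyLen p ≤ n) : RunLe w (lenC a n) n fun m _ => m = polyLen p := by
  induction n generalizing w with
  | zero => exact RunLe.pure (by omega)
  | succ n ih =>
    refine RunLe.bind (c₂ := n) (runLe_isZeroC (ha n)) fun b w₁ hw₁ hb => ?_
    by_cases h : p.coeff n = 0
    · rw [if_pos (hb.2 h)]
      refine ih (ha.mono hw₁) ?_
      by_contra hlt
      have hn : polyLen p = n + 1 := by omega
      have hp0 : p ≠ 0 := by rintro rfl; simp [polyLen_zero] at hn
      have := coeff_polyLen_sub_one hp0
      rw [hn, Nat.add_sub_cancel, h] at this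
      exact hp0 (leadingCoeff_eq_zero.1 this.symm)
    · rw [if_neg (by rw [hb]; exact h)]
      exact RunLe.pure (polyLen_eq_of_coeff_ne_zero hp h).symm

/-- Division with remainder by a polynomial with `nb` coefficients, with a quotient with at most
`n` coefficients. -/
def divModC (b : ℕ → ι ⊕ ℕ) (nb : ℕ) : ℕ → (ℕ → ι ⊕ ℕ) → Comp ι ((ℕ → ι ⊕ ℕ) × (ℕ → ι ⊕ ℕ))
  | 0, a => pure (fun _ => zeroReg, a)
  | n + 1, a => do
      let c ← arithC .div (a (n + nb - 1)) (b (nb - 1))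
      let d ← arithC .sub zeroReg c
      let z ← addMulShiftC a d n b nb
      let r ← divModC b nb n z
      pure (Function.update r.1 n c, r.2)

theorem div_mod_unique {p q r g : K[X]} (h : p = q * g + r) (hr : r.degree < g.degree) :
    p / g = q ∧ p % g = r := by
  have hg : g ≠ 0 := by rintro rfl; simp at hr
  have h1 := EuclideanDomain.div_add_mod p g
  have h2 : (p % g).degree < g.degree := EuclideanDomain.mod_lt p hg
  have h3 : g * (p / g - q) = r - p % g := by
    rw [mul_sub, sub_eq_sub_iff_add_eq_add, h1, h]; ring
  have h4 : p / g - q = 0 := by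
    by_contra hne
    have h5 : (r - p % g).degree < g.degree := (degree_sub_le _ _).trans_lt (max_lt hr h2)
    rw [← h3, degree_mul, degree_eq_natDegree hne, degree_eq_natDegree hg] at h5
    have : g.natDegree + (p / g - q).natDegree < g.natDegree := by exact_mod_cast h5
    omega
  rw [h4, mul_zero] at h3
  exact ⟨sub_eq_zero.1 h4, (sub_eq_zero.1 h3.symm).symm⟩

theorem runLe_divModC {w : World ι K} {b : ℕ → ι ⊕ ℕ} {g : K[X]} {nb : ℕ}
    (hb : Stores w b g.coeff) (hg : g ≠ 0) (hnb : polyLen g = nb) (n : ℕ) {a : ℕ → ι ⊕ ℕ} {p : K[X]}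
    (ha : Stores w a p.coeff) (hp : polyLen p ≤ n + nb - 1) :
    RunLe w (divModC b nb n a) (n * (2 + nb * 2)) fun r w' =>
      Stores w' r.1 (p / g).coeff ∧ Stores w' r.2 (p % g).coeff ∧ polyLen (p / g) ≤ n ∧
        polyLen (p % g) ≤ nb - 1 := by
  have hnb0 : nb = g.natDegree + 1 := by rw [← hnb, polyLen_of_ne_zero hg]
  suffices H : ∀ w, Stores w b g.coeff → ∀ n a p, Stores w a p.coeff → polyLen p ≤ n + nb - 1 →
      RunLe w (divModC b nb n a) (n * (2 + nb * 2)) fun r w' => ∃ Q R : K[X],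
        Stores w' r.1 Q.coeff ∧ Stores w' r.2 R.coeff ∧ p = Q * g + R ∧ polyLen Q ≤ n ∧
        polyLen R ≤ nb - 1 by
    refine (H w hb n a p ha hp).mono (fun r w' _ ⟨Q, R, h1, h2, h3, h4, h5⟩ => ?_) le_rfl
    have h6 : R.degree < g.degree := by
      rw [← polyLen_lt_iff_degree_lt]; omega
    obtain ⟨rfl, rfl⟩ := div_mod_unique h3 h6
    exact ⟨h1, h2, h4, h5⟩
  clear ha hp a p n hb w
  intro w hb n
  induction n generalizing w with
  | zero =>
    intro a p ha hp
    refine RunLe.pure ⟨0, p, stores_zero w, ha, by simp, by simp [polyLen_zero], by omega⟩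
  | succ n ih =>
    intro a p ha hp
    have hlc : g.coeff (nb - 1) = g.leadingCoeff := by
      rw [← hnb, coeff_polyLen_sub_one hg]
    have hlc0 : g.coeff (nb - 1) ≠ 0 := by rw [hlc]; exact leadingCoeff_ne_zero.2 hg
    refine RunLe.bind (c₂ := 1 + nb * 2 + n * (2 + nb * 2)) (runLe_div (ha (n + nb - 1))
      (hb (nb - 1)) hlc0) (fun c w₁ hw₁ hc => ?_) (by ring_nf; omega)
    refine RunLe.bind (c₂ := nb * 2 + n * (2 + nb * 2)) (runLe_sub (holds_zero w₁) hc)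
      (fun d w₂ hw₂ hd => ?_)
    refine RunLe.bind (c₂ := n * (2 + nb * 2)) (runLe_addMulShiftC n (ha.mono (hw₁.trans hw₂)) hd
      (hb.mono (hw₁.trans hw₂)) hnb.le) (fun z w₃ hw₃ hz => ?_)
    set γ := p.coeff (n + nb - 1) / g.coeff (nb - 1) with hγ
    set p' := p + C (0 - γ) * X ^ n * g with hp'
    have hcoeff : ∀ i, p'.coeff i = p.coeff i - γ * (if n ≤ i then g.coeff (i - n) else 0) := by
      intro i
      rw [hp', mul_assoc, coeff_add, coeff_C_mul, coeff_X_pow_mul']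
      ring
    have hlen : polyLen p' ≤ n + nb - 1 := by
      rw [polyLen_le_iff, degree_lt_iff_coeff_zero]
      intro i hi
      rw [hcoeff, if_pos (by omega)]
      rcases Nat.eq_or_lt_of_le hi with rfl | hi
      · rw [show n + nb - 1 - n = nb - 1 by omega, hγ, div_mul_cancel₀ _ hlc0, sub_self]
      · rw [coeff_eq_zero_of_polyLen_le hp (by omega),
          coeff_eq_zero_of_polyLen_le hnb.le (by omega), mul_zero, sub_zero]
    refine RunLe.bind (c₂ := 0) (ih w₃ (hb.mono (hw₁.trans (hw₂.trans hw₃))) z p' hz hlen)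
      (fun r w₄ hw₄ ⟨Q, R, h1, h2, h3, h4, h5⟩ => ?_)
    refine RunLe.pure ⟨Q + C γ * X ^ n, R, fun i => ?_, h2, ?_, ?_, h5⟩
    · change Holds w₄ (Function.update r.1 n c i) _
      rw [coeff_add, coeff_C_mul, coeff_X_pow]
      by_cases hi : i = n
      · subst hi
        rw [Function.update_self, if_pos rfl, mul_one, coeff_eq_zero_of_polyLen_le h4 le_rfl,
          zero_add]
        exact hc.mono (hw₂.trans (hw₃.trans hw₄))
      · rw [Function.update_of_ne hi, if_neg hi, mul_zero, add_zero]
        exact h1 i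
    · have : p = p' + C γ * X ^ n * g := by rw [hp', zero_sub, C_neg]; ring
      rw [this, h3]; ring
    · rw [polyLen_le_iff]
      refine (degree_add_le _ _).trans_lt (max_lt ?_ ?_)
      · exact (polyLen_le_iff.1 h4).trans (by exact_mod_cast Nat.lt_succ_self n)
      · exact (degree_C_mul_X_pow_le _ _).trans_lt (by exact_mod_cast Nat.lt_succ_self n)

end PolyArith

/-! ## The extended Euclidean algorithm -/

section Euclid

variable {K : Type u} [Field K] {ι : Type}

/-- Two consecutive remainders and the cofactors of the second input. -/
structure EuclidState (ι : Type) where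
  /-- the number of coefficients of the first remainder -/
  n₀ : ℕ
  /-- the first remainder -/
  a₀ : ℕ → ι ⊕ ℕ
  /-- the number of coefficients of the second remainder -/
  n₁ : ℕ
  /-- the second remainder -/
  a₁ : ℕ → ι ⊕ ℕ
  /-- the first cofactor -/
  v₀ : ℕ → ι ⊕ ℕ
  /-- the second cofactor -/
  v₁ : ℕ → ι ⊕ ℕ
  /-- the number of coefficients of the second cofactor -/
  l₁ : ℕ

/-- The extended Euclidean algorithm, stopped at the first remainder with at most `th`
coefficients. -/
def euclidC (th : ℕ) : ℕ → EuclidState ι → Comp ι (EuclidState ι)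
  | 0, s => pure s
  | fuel + 1, s =>
      if s.n₁ ≤ th then pure s
      else do
        let qr ← divModC s.a₁ s.n₁ (s.n₀ - s.n₁ + 1) s.a₀
        let m ← lenC qr.2 (s.n₁ - 1)
        let q ← negC qr.1 (s.n₀ - s.n₁ + 1)
        let v ← addMulC s.v₀ q s.v₁ s.l₁ (s.n₀ - s.n₁ + 1)
        euclidC th fuel ⟨s.n₁, s.a₁, m, qr.2, s.v₁, v, s.n₀ - s.n₁ + s.l₁⟩

/-- The remainders `R₀`, `R₁` of the Euclidean algorithm for `A`, `S` with cofactors `V₀`, `V₁`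
of `S`. -/
structure IsEuclidPair (A S R₀ R₁ V₀ V₁ : K[X]) : Prop where
  exists_cofactors : ∃ U₀ U₁ : K[X], R₀ = U₀ * A + V₀ * S ∧ R₁ = U₁ * A + V₁ * S ∧
    IsUnit (U₀ * V₁ - U₁ * V₀)
  len_lt : polyLen R₁ < polyLen R₀
  cofactor_lt : polyLen V₀ < polyLen V₁
  len_add : polyLen V₁ + polyLen R₀ = polyLen A + 1

/-- The state contains remainders and cofactors of `A` and `S`. -/
def EuclidState.Stores (w : World ι K) (s : EuclidState ι) (R₀ R₁ V₀ V₁ : K[X]) : Prop :=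
  _root_.Stores w s.a₀ R₀.coeff ∧ _root_.Stores w s.a₁ R₁.coeff ∧ _root_.Stores w s.v₀ V₀.coeff ∧
    _root_.Stores w s.v₁ V₁.coeff ∧ s.n₀ = polyLen R₀ ∧ s.n₁ = polyLen R₁ ∧ s.l₁ = polyLen V₁

/-- The cofactor gains exactly deg(R₀/R₁) in degree, because V₀ is shorter than V₁; this keeps
`len_add`. The determinant of the cofactors only changes its sign. -/
theorem IsEuclidPair.next {A S R₀ R₁ V₀ V₁ : K[X]} (h : IsEuclidPair A S R₀ R₁ V₀ V₁)
    (h1 : R₁ ≠ 0) : IsEuclidPair A S R₁ (R₀ % R₁) V₁ (V₀ + -(R₀ / R₁) * V₁) ∧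
      polyLen (V₀ + -(R₀ / R₁) * V₁) = polyLen R₀ - polyLen R₁ + polyLen V₁ := by
  obtain ⟨⟨U₀, U₁, hR₀, hR₁, hU⟩, hlt, hV, hadd⟩ := h
  have hR0 : R₀ ≠ 0 := by rintro rfl; simp [polyLen_zero] at hlt
  have hV1 : V₁ ≠ 0 := by rintro rfl; simp [polyLen_zero] at hV
  have hdeg : R₁.degree ≤ R₀.degree := (polyLen_lt_iff_degree_lt.1 hlt).le
  have hq : R₀ / R₁ ≠ 0 := by
    rw [Ne, Polynomial.div_eq_zero_iff h1]; exact not_lt.2 hdeg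
  have hqd : (R₀ / R₁).natDegree = R₀.natDegree - R₁.natDegree := by
    have := degree_add_div h1 hdeg
    rw [degree_eq_natDegree h1, degree_eq_natDegree hq, degree_eq_natDegree hR0] at this
    have : R₁.natDegree + (R₀ / R₁).natDegree = R₀.natDegree := by exact_mod_cast this
    omega
  have hlen : polyLen (V₀ + -(R₀ / R₁) * V₁) = polyLen R₀ - polyLen R₁ + polyLen V₁ := by
    have hqV : (R₀ / R₁) * V₁ ≠ 0 := mul_ne_zero hq hV1
    have h2 : polyLen ((R₀ / R₁) * V₁) = polyLen R₀ - polyLen R₁ + polyLen V₁ := by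
      rw [polyLen_of_ne_zero hqV, natDegree_mul hq hV1, hqd, polyLen_of_ne_zero hR0,
        polyLen_of_ne_zero h1, polyLen_of_ne_zero hV1]
      omega
    have h3 : V₀.degree < (-(R₀ / R₁) * V₁).degree := by
      rw [neg_mul, degree_neg, ← polyLen_lt_iff_degree_lt]; omega
    have h4 : (V₀ + -(R₀ / R₁) * V₁).degree = ((R₀ / R₁) * V₁).degree := by
      rw [degree_add_eq_right_of_degree_lt h3, neg_mul, degree_neg]
    rw [← h2]
    refine le_antisymm (polyLen_le_iff.2 (h4 ▸ degree_lt_polyLen _))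
      (polyLen_le_iff.2 (h4 ▸ degree_lt_polyLen _))
  refine ⟨⟨⟨U₁, U₀ - (R₀ / R₁) * U₁, hR₁, ?_, ?_⟩, ?_, ?_, ?_⟩, hlen⟩
  · have := EuclideanDomain.div_add_mod R₀ R₁
    have h2 : R₀ % R₁ = R₀ - R₁ * (R₀ / R₁) := by rw [eq_sub_iff_add_eq, add_comm]; exact this
    rw [h2]
    generalize R₀ / R₁ = q at *
    rw [hR₀, hR₁]; ring
  · have h2 : U₁ * (V₀ + -(R₀ / R₁) * V₁) - (U₀ - (R₀ / R₁) * U₁) * V₁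
        = -(U₀ * V₁ - U₁ * V₀) := by ring
    rw [h2]; exact hU.neg
  · rw [polyLen_lt_iff_degree_lt]; exact EuclideanDomain.mod_lt R₀ h1
  · rw [hlen]; omega
  · rw [hlen]; omega

/-- 16·|A|·|R₀| serves as a potential, |·| being the number of coefficients: one step costs at most
16·|A|·(|R₀| − |R₁|), so the costs telescope and an early stop is cheap. -/
theorem run_euclidC {A S : K[X]} (th fuel : ℕ) {w : World ι K} {s : EuclidState ι}
    {R₀ R₁ V₀ V₁ : K[X]} (hs : s.Stores w R₀ R₁ V₀ V₁) (h : IsEuclidPair A S R₀ R₁ V₀ V₁)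
    (hth : th < polyLen R₀) (hfuel : polyLen R₁ ≤ fuel) :
    Run w (euclidC th fuel s) fun s' w' n => ∃ R₀' R₁' V₀' V₁', s'.Stores w' R₀' R₁' V₀' V₁' ∧
      IsEuclidPair A S R₀' R₁' V₀' V₁' ∧ th < polyLen R₀' ∧ polyLen R₁' ≤ th ∧
      n + 16 * polyLen A * polyLen R₀' ≤ 16 * polyLen A * polyLen R₀ := by
  induction fuel generalizing w s R₀ R₁ V₀ V₁ with
  | zero =>
    exact Run.pure ⟨R₀, R₁, V₀, V₁, hs, h, hth, by omega, by omega⟩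
  | succ fuel ih =>
    obtain ⟨h1, h2, h3, h4, h5, h6, h7⟩ := id hs
    rw [euclidC]
    split_ifs with hn
    · exact Run.pure ⟨R₀, R₁, V₀, V₁, hs, h, hth, h6 ▸ hn, by omega⟩
    · have hR1 : R₁ ≠ 0 := by
        rintro rfl; rw [polyLen_zero] at h6; omega
      have hlt := h.len_lt
      have hadd := h.len_add
      have hcof := h.cofactor_lt
      obtain ⟨hnext, hlen⟩ := h.next hR1
      refine Run.bind_le (runLe_divModC h2 hR1 h6.symm (s.n₀ - s.n₁ + 1) h1 (by omega))
        (fun qr w₁ hw₁ ⟨hq, hr, hql, hrl⟩ => ?_)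
      refine Run.bind_le (runLe_lenC hr hrl) (fun m w₂ hw₂ hm => ?_)
      refine Run.bind_le (runLe_negC (hq.mono hw₂) hql) (fun q w₃ hw₃ hq' => ?_)
      have hw₀ := hw₁.trans (hw₂.trans hw₃)
      refine Run.bind_le (runLe_addMulC (h3.mono hw₀) hq' (h4.mono hw₀)
        (by rw [polyLen_le_iff, degree_neg, ← polyLen_le_iff]; exact hql) h7.symm.le)
        (fun v w₄ hw₄ hv => ?_)
      refine Run.mono (ih (R₀ := R₁) (R₁ := R₀ % R₁) (V₀ := V₁) (V₁ := V₀ + -(R₀ / R₁) * V₁)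
        ⟨h2.mono (hw₀.trans hw₄), hr.mono (hw₂.trans (hw₃.trans hw₄)), h4.mono (hw₀.trans hw₄), hv,
          h6, hm, by rw [hlen]; dsimp only; omega⟩ hnext (by omega)
          (by have := hnext.len_lt; omega)) ?_
      rintro s' w' n' _ ⟨R₀', R₁', V₀', V₁', g1, g2, g3, g4, g5⟩
      intro n₄ hn₄ n₃ hn₃ n₂ hn₂ n₁ hn₁
      refine ⟨R₀', R₁', V₀', V₁', g1, g2, g3, g4, ?_⟩
      set c := s.n₀ - s.n₁ + 1 with hc
      obtain ⟨N, hN⟩ : ∃ N, N = polyLen A := ⟨_, rfl⟩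
      rw [← hN] at hadd g5 ⊢
      have e1 : c * (2 + s.n₁ * 2) ≤ c * (2 + N * 2) := Nat.mul_le_mul_left _ (by omega)
      have e2 : c * (s.l₁ * 2) ≤ c * (N * 2) := Nat.mul_le_mul_left _ (by omega)
      obtain ⟨D, hD⟩ : ∃ D, polyLen R₀ = polyLen R₁ + D := ⟨polyLen R₀ - polyLen R₁, by omega⟩
      have e3 : c = D + 1 := by omega
      have e4 : D * N ≥ N := Nat.le_mul_of_pos_left _ (by omega)
      have e5 : D * N ≥ D := Nat.le_mul_of_pos_right _ (by omega)
      rw [hD]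
      have e6 : (D + 1) * (2 + N * 2) = 2 * D + 2 * (D * N) + 2 + 2 * N := by ring
      have e7 : (D + 1) * (N * 2) = 2 * (D * N) + 2 * N := by ring
      have e8 : 16 * N * (polyLen R₁ + D) = 16 * N * polyLen R₁ + 16 * (D * N) := by ring
      rw [e3] at e1 e2 hn₁ hn₃ hn₄
      have e9 : 1 ≤ N := by omega
      omega

/-- `g` is the monic greatest common divisor of `p` and `q`. -/
structure IsMonicGcd (g p q : K[X]) : Prop where
  monic : g.Monic
  dvd_left : g ∣ p
  dvd_right : g ∣ q
  exists_bezout : ∃ x y, g = x * p + y * q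

theorem IsMonicGcd.dvd {g p q d : K[X]} (h : IsMonicGcd g p q) (hp : d ∣ p) (hq : d ∣ q) :
    d ∣ g := by
  obtain ⟨x, y, hxy⟩ := h.exists_bezout
  rw [hxy]
  exact dvd_add (hp.mul_left x) (hq.mul_left y)

theorem IsMonicGcd.mod_left {g p q : K[X]} (h : IsMonicGcd g q (p % q)) : IsMonicGcd g p q := by
  obtain ⟨x, y, hxy⟩ := h.exists_bezout
  have h1 := EuclideanDomain.div_add_mod p q
  refine ⟨h.monic, ?_, h.dvd_left, y, x - y * (p / q), ?_⟩
  · rw [← h1]; exact dvd_add (h.dvd_left.mul_right _) h.dvd_right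
  · conv_rhs => rw [← h1]
    have h2 : (q * (p / q) + p % q) / q = p / q := by rw [h1]
    rw [h2, hxy]
    ring

theorem polyLen_C_mul {c : K} (hc : c ≠ 0) (p : K[X]) : polyLen (C c * p) = polyLen p := by
  by_cases hp : p = 0
  · simp [hp]
  · rw [polyLen_of_ne_zero hp, polyLen_of_ne_zero (mul_ne_zero (C_ne_zero.2 hc) hp),
      natDegree_C_mul hc]

/-- The monic greatest common divisor. -/
def gcdC (na : ℕ) (a : ℕ → ι ⊕ ℕ) (nb : ℕ) (b : ℕ → ι ⊕ ℕ) :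
    Comp ι (ℕ × (ℕ → ι ⊕ ℕ)) := do
  let s ← euclidC 0 nb ⟨na, a, nb, b, fun _ => zeroReg,
    fun i => if i = 0 then oneReg else zeroReg, 1⟩
  let z ← divScalarC s.a₀ s.n₀ (s.a₀ (s.n₀ - 1))
  pure (s.n₀, z)

theorem stores_one (w : World ι K) :
    Stores w (fun i : ℕ => if i = 0 then oneReg else zeroReg) (1 : K[X]).coeff := by
  intro i
  change Holds w (if i = 0 then oneReg else zeroReg) _
  rw [coeff_one]
  split_ifs
  · exact holds_one w
  · exact holds_zero w

theorem isEuclidPair_init {A S : K[X]} (h : polyLen S < polyLen A) :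
    IsEuclidPair A S A S 0 1 := by
  have h1 : polyLen (1 : K[X]) = 1 := by rw [polyLen_of_ne_zero one_ne_zero]; simp
  exact ⟨⟨1, 0, by ring, by ring, by simp⟩, h, by rw [polyLen_zero, h1]; omega, by rw [h1]; omega⟩

/-- The last nonzero remainder is a combination of A and S; conversely both are multiples of it, by
Cramer's rule with the unit determinant of the cofactors. The cost 16·|A|·(|A| − |g|) + |A| keeps
the repeated gcds of the squarefree part quadratic in total. -/
theorem run_gcdC {w : World ι K} {na nb : ℕ} {a b : ℕ → ι ⊕ ℕ} {A S : K[X]}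
    (ha : Stores w a A.coeff) (hb : Stores w b S.coeff) (hna : na = polyLen A)
    (hnb : nb = polyLen S) (hlt : polyLen S < polyLen A) :
    Run w (gcdC na a nb b) fun r w' n => ∃ g, IsMonicGcd g A S ∧ r.1 = polyLen g ∧
      Stores w' r.2 g.coeff ∧ n + 16 * na * r.1 ≤ 16 * na * na + na := by
  have h1 : polyLen (1 : K[X]) = 1 := by rw [polyLen_of_ne_zero one_ne_zero]; simp
  refine Run.bind (run_euclidC (A := A) (S := S) 0 nb
    (s := ⟨na, a, nb, b, fun _ => zeroReg, fun i => if i = 0 then oneReg else zeroReg, 1⟩)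
    ⟨ha, hb, stores_zero w, stores_one w, hna, hnb, h1.symm⟩ (isEuclidPair_init hlt) (by omega)
    hnb.ge) ?_
  rintro s w₁ n hw₁ ⟨R₀, R₁, V₀, V₁, ⟨g1, g2, g3, g4, g5, g6, g7⟩, h2, h3, h4, h5⟩
  have hR1 : R₁ = 0 := polyLen_eq_zero.1 (by omega)
  have hR0 : R₀ ≠ 0 := by rintro rfl; simp [polyLen_zero] at h3
  have hlc : R₀.leadingCoeff ≠ 0 := leadingCoeff_ne_zero.2 hR0
  have hc := g1 (s.n₀ - 1)
  rw [g5, coeff_polyLen_sub_one hR0, ← g5] at hc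
  refine Run.bind_le (runLe_divScalarC g1 g5.ge hc hlc) (fun z w₂ hw₂ hz => ?_)
  refine Run.pure fun n' hn' => ⟨C R₀.leadingCoeff⁻¹ * R₀, ?_, ?_, hz, ?_⟩
  · obtain ⟨U₀, U₁, e1, e2, e3⟩ := h2.exists_cofactors
    rw [hR1] at e2
    obtain ⟨u, hu⟩ := e3
    have hC : C R₀.leadingCoeff⁻¹ * C R₀.leadingCoeff = 1 := by
      rw [← C_mul, inv_mul_cancel₀ hlc, C_1]
    have hmonic : (C R₀.leadingCoeff⁻¹ * R₀).Monic := by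
      rw [mul_comm]; exact monic_mul_leadingCoeff_inv hR0
    generalize C R₀.leadingCoeff⁻¹ = c' at *
    have hdvd : ∀ x : K[X], (∃ k, x = k * R₀) → c' * R₀ ∣ x := by
      rintro x ⟨k, rfl⟩
      exact ⟨k * C R₀.leadingCoeff, by linear_combination - (k * R₀) * hC⟩
    have hu' : (↑u⁻¹ : K[X]) * u = 1 := Units.inv_mul u
    refine ⟨hmonic, hdvd A ⟨↑u⁻¹ * V₁, ?_⟩, hdvd S ⟨- (↑u⁻¹ * U₁), ?_⟩, c' * U₀, c' * V₀, ?_⟩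
    · have : (u : K[X]) * A = V₁ * R₀ := by
        linear_combination A * hu - V₁ * e1 + V₀ * e2
      linear_combination - A * hu' + ↑u⁻¹ * this
    · have : (u : K[X]) * S = - U₁ * R₀ := by
        linear_combination S * hu + U₁ * e1 - U₀ * e2
      linear_combination - S * hu' + ↑u⁻¹ * this
    · linear_combination c' * e1
  · rw [polyLen_C_mul (inv_ne_zero hlc)]; exact g5
  · have : s.n₀ ≤ na := by
      have := h2.len_add; have := h2.cofactor_lt; omega
    rw [← hna, ← g5] at h5
    dsimp only
    omega

end Euclid

/-! ## Linear recurrences -/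

section Recurrence

variable {K : Type u} [Field K]

/-- `g` is the monic generator of the ideal of all `p` with `L (q * p) = 0` for every `q`. -/
structure IsAnnihilator (L : K[X] →ₗ[K] K) (g : K[X]) : Prop where
  monic : g.Monic
  dvd_iff : ∀ p, g ∣ p ↔ ∀ q, L (q * p) = 0

theorem IsAnnihilator.unique {L : K[X] →ₗ[K] K} {g g' : K[X]} (h : IsAnnihilator L g)
    (h' : IsAnnihilator L g') : g = g' :=
  eq_of_monic_of_associated h.monic h'.monic
    (associated_of_dvd_dvd ((h.dvd_iff g').2 ((h'.dvd_iff g').1 dvd_rfl))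
      ((h'.dvd_iff g).2 ((h.dvd_iff g).1 dvd_rfl)))

/-- The p with L(qp) = 0 for all q form an ideal of a principal ideal domain; it is nonzero because
it contains f. -/
theorem exists_isAnnihilator {L : K[X] →ₗ[K] K} {f : K[X]} (hf : f ≠ 0)
    (hL : ∀ q, L (q * f) = 0) : ∃ g, IsAnnihilator L g := by
  classical
  let I : Ideal K[X] :=
    { carrier := {p | ∀ q, L (q * p) = 0}
      add_mem' := fun {a b} ha hb q => by rw [mul_add, map_add, ha q, hb q, add_zero]
      zero_mem' := fun q => by rw [mul_zero, map_zero]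
      smul_mem' := fun c p hp q => by rw [smul_eq_mul, ← mul_assoc]; exact hp _ }
  have hI : ∀ p, p ∈ I ↔ Submodule.IsPrincipal.generator I ∣ p := fun p =>
    Submodule.IsPrincipal.mem_iff_generator_dvd I
  have h0 : Submodule.IsPrincipal.generator I ≠ 0 := fun h => hf (by
    have := (hI f).1 hL
    rw [h] at this
    exact zero_dvd_iff.1 this)
  exact ⟨normalize (Submodule.IsPrincipal.generator I), monic_normalize h0, fun p => by
    rw [normalize_dvd_iff]; exact (hI p).symm⟩

theorem eq_sum_range_of_degree_lt {p : K[X]} {d : ℕ} (hp : p.degree < d) :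
    p = ∑ i ∈ Finset.range d, C (p.coeff i) * X ^ i := by
  by_cases h : p = 0
  · simp [h]
  · exact p.as_sum_range_C_mul_X_pow' ((natDegree_lt_iff_degree_lt h).2 hp)

theorem map_mul_eq_zero_of_forall_lt {L : K[X] →ₗ[K] K} {p q : K[X]} {d : ℕ}
    (h : ∀ a < d, L (X ^ a * p) = 0) (hq : q.degree < d) : L (q * p) = 0 := by
  rw [eq_sum_range_of_degree_lt hq, Finset.sum_mul, map_sum]
  refine Finset.sum_eq_zero fun i hi => ?_
  rw [mul_assoc, ← smul_eq_C_mul, map_smul, h i (Finset.mem_range.1 hi), smul_zero]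

/-- q ↦ L(qp) depends only on q mod g, so it suffices to test 1, X, …, X^(deg g − 1). -/
theorem IsAnnihilator.dvd_of_forall_lt {L : K[X] →ₗ[K] K} {g p : K[X]} (h : IsAnnihilator L g)
    (hp : ∀ a < g.natDegree, L (X ^ a * p) = 0) : g ∣ p := by
  refine (h.dvd_iff p).2 fun q => ?_
  have h1 : q * p = (q %ₘ g) * p + ((q /ₘ g) * p) * g := by
    conv_lhs => rw [← modByMonic_add_div q g]
    ring
  rw [h1, map_add, (h.dvd_iff g).1 dvd_rfl, add_zero]
  refine map_mul_eq_zero_of_forall_lt hp ?_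
  rw [← degree_eq_natDegree h.monic.ne_zero]
  exact degree_modByMonic_lt q h.monic

theorem isRecurrence_iff {L : K[X] →ₗ[K] K} {s : ℕ → K} (hs : ∀ i, s i = L (X ^ i)) (N : ℕ)
    (g : K[X]) : IsRecurrence s N g ↔ ∀ j, j + g.natDegree < N → L (X ^ j * g) = 0 := by
  have h : ∀ j, ∑ i ∈ Finset.range (g.natDegree + 1), g.coeff i * s (i + j) = L (X ^ j * g) := by
    intro j
    conv_rhs => rw [g.as_sum_range_C_mul_X_pow, Finset.mul_sum, map_sum]
    refine Finset.sum_congr rfl fun i _ => ?_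
    rw [hs, mul_left_comm, ← pow_add, ← smul_eq_C_mul, map_smul, smul_eq_mul, add_comm]
  simp only [IsRecurrence, h]

/-- A recurrence p of degree at most M on 2M terms gives L(X^a p) = 0 for a < 2M − deg p, in
particular for a < deg g, and so g ∣ p. Longer recurrences cannot be minimal, since g is one itself.
-/
theorem isMinimalPolynomial_iff {L : K[X] →ₗ[K] K} {s : ℕ → K} (hs : ∀ i, s i = L (X ^ i))
    {g : K[X]} (h : IsAnnihilator L g) {M : ℕ} (hM : g.natDegree ≤ M) (g' : K[X]) :
    IsMinimalPolynomial s (2 * M) g' ↔ g' = g := by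
  have key : ∀ p : K[X], p.natDegree ≤ M → IsRecurrence s (2 * M) p → g ∣ p := by
    intro p hp hr
    refine h.dvd_of_forall_lt fun a ha => (isRecurrence_iff hs _ _).1 hr a (by omega)
  have hg : IsRecurrence s (2 * M) g :=
    (isRecurrence_iff hs _ _).2 fun j _ => (h.dvd_iff g).1 dvd_rfl _
  have hmin : ∀ p : K[X], p.Monic → IsRecurrence s (2 * M) p → g.natDegree ≤ p.natDegree := by
    intro p hp hr
    by_cases hpM : p.natDegree ≤ M
    · exact natDegree_le_of_dvd (key p hpM hr) hp.ne_zero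
    · omega
  constructor
  · rintro ⟨h1, h2, h3⟩
    have h4 := h3 g h.monic hg
    exact (eq_of_dvd_of_natDegree_le_of_leadingCoeff (key g' (h4.trans hM) h2) h4
      (h.monic.trans h1.symm)).symm
  · rintro rfl
    exact ⟨h.monic, hg, hmin⟩

theorem hankel_mulVec {L : K[X] →ₗ[K] K} {s : ℕ → K} (hs : ∀ i, s i = L (X ^ i)) {d : ℕ}
    {p : K[X]} (hp : p.degree < d) :
    hankel d s *ᵥ (fun l => p.coeff (l : ℕ)) = fun a : Fin d => L (X ^ (a : ℕ) * p) := by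
  funext a
  conv_rhs => rw [eq_sum_range_of_degree_lt hp, Finset.mul_sum, map_sum]
  simp only [mulVec, dotProduct, hankel, of_apply]
  rw [Finset.sum_range]
  refine Finset.sum_congr rfl fun i _ => ?_
  rw [hs, mul_left_comm, ← pow_add, ← smul_eq_C_mul, map_smul, smul_eq_mul, mul_comm]

/-- A kernel vector holds the coefficients of some p with deg p < deg g and L(X^a p) = 0 for a < deg
g; hence g ∣ p and p = 0. -/
theorem IsAnnihilator.isUnit_hankel {L : K[X] →ₗ[K] K} {s : ℕ → K} (hs : ∀ i, s i = L (X ^ i))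
    {g : K[X]} (h : IsAnnihilator L g) : IsUnit (hankel g.natDegree s).det := by
  rw [← Matrix.isUnit_iff_isUnit_det, ← Matrix.mulVec_injective_iff_isUnit]
  rw [← Matrix.coe_mulVecLin, ← LinearMap.ker_eq_bot, LinearMap.ker_eq_bot']
  intro c hc
  rw [Matrix.coe_mulVecLin] at hc
  let p : K[X] := ∑ i : Fin g.natDegree, C (c i) * X ^ (i : ℕ)
  have hpc : ∀ i : Fin g.natDegree, p.coeff i = c i := by
    intro i
    simp [p, coeff_X_pow, Fin.val_inj]
  have hpd : p.degree < g.natDegree := by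
    refine (degree_lt_iff_coeff_zero _ _).2 fun i hi => ?_
    simp only [p, finsetSum_coeff, coeff_C_mul, coeff_X_pow]
    refine Finset.sum_eq_zero fun j _ => ?_
    rw [if_neg (by omega), mul_zero]
  have h1 := hankel_mulVec hs hpd
  rw [funext hpc, hc] at h1
  have h2 : g ∣ p := h.dvd_of_forall_lt fun a ha => (congrFun h1 ⟨a, ha⟩).symm
  have h3 : p = 0 := eq_zero_of_dvd_of_degree_lt h2
    (by rwa [degree_eq_natDegree h.monic.ne_zero])
  funext i
  rw [← hpc, h3]; rfl

/-- The system says L(X^a (H − p)) = 0 for a < deg g, that is, g ∣ H − p. -/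
theorem IsAnnihilator.hankel_mulVec_iff {L : K[X] →ₗ[K] K} {s : ℕ → K}
    (hs : ∀ i, s i = L (X ^ i)) {g : K[X]} (h : IsAnnihilator L g) (H p : K[X]) :
    (p.degree < g.degree ∧ hankel g.natDegree s *ᵥ (fun l => p.coeff (l : ℕ))
      = fun a : Fin g.natDegree => L (X ^ (a : ℕ) * H)) ↔ p = H %ₘ g := by
  constructor
  · rintro ⟨h1, h2⟩
    rw [hankel_mulVec hs (by rwa [← degree_eq_natDegree h.monic.ne_zero])] at h2
    have h3 : g ∣ H - p := h.dvd_of_forall_lt fun a ha => by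
      rw [mul_sub, map_sub, ← congrFun h2 ⟨a, ha⟩, sub_self]
    obtain ⟨q, hq⟩ := h3
    exact (div_modByMonic_unique q p h.monic ⟨by rw [← hq]; ring, h1⟩).2.symm
  · rintro rfl
    have h1 := degree_modByMonic_lt H h.monic
    refine ⟨h1, ?_⟩
    rw [hankel_mulVec hs (by rwa [← degree_eq_natDegree h.monic.ne_zero])]
    funext a
    rw [← sub_eq_zero, ← map_sub, ← mul_sub]
    exact (h.dvd_iff _).1 (dvd_modByMonic_sub H g) _

end Recurrence

/-! ## The factors found by the Wiedemann algorithm -/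

section Wiedemann

variable {K : Type u} [Field K] {D m : ℕ}

/-- The functional `p ↦ ⟨e_k, p(T) b⟩`. -/
def krylovMap (T : Matrix (Fin D) (Fin D) K) (k : Fin D) (b : Fin D → K) : K[X] →ₗ[K] K where
  toFun p := (aeval T p *ᵥ b) k
  map_add' p q := by rw [map_add, add_mulVec]; rfl
  map_smul' c p := by rw [map_smul, smul_mulVec]; rfl

theorem krylovSeq_eq (T : Matrix (Fin D) (Fin D) K) (k : Fin D) (b : Fin D → K) (i : ℕ) :
    krylovSeq T k b i = krylovMap T k b (X ^ i) := by
  simp [krylovSeq, krylovMap]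

theorem krylovMap_mul (T : Matrix (Fin D) (Fin D) K) (k : Fin D) (b : Fin D → K) (p q : K[X]) :
    krylovMap T k (aeval T q *ᵥ b) p = krylovMap T k b (p * q) := by
  simp [krylovMap, mulVec_mulVec]

/-- The vector `e` generates `K ^ D` as a module over `K[T]`. -/
def IsCyclicVector (T : Matrix (Fin D) (Fin D) K) (e : Fin D → K) : Prop :=
  ∀ x, ∃ p : K[X], aeval T p *ᵥ e = x

/-- p(T) commutes with every q(T), so if it kills the generator e, it kills all vectors. -/
theorem IsCyclicVector.aeval_mulVec_eq_zero_iff {T : Matrix (Fin D) (Fin D) K} {e : Fin D → K}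
    (h : IsCyclicVector T e) (p : K[X]) : aeval T p *ᵥ e = 0 ↔ minpoly K T ∣ p := by
  constructor
  · intro hp
    refine minpoly.dvd K T ?_
    refine Matrix.ext_of_mulVec_single fun i => ?_
    obtain ⟨q, hq⟩ := h (Pi.single i 1)
    rw [← hq, mulVec_mulVec, ← map_mul, mul_comm, map_mul, ← mulVec_mulVec, hp]
    simp
  · rintro ⟨q, rfl⟩
    simp

theorem isIntegral_matrix (T : Matrix (Fin D) (Fin D) K) : IsIntegral K T :=
  Algebra.IsIntegral.isIntegral T

/-- At most D by Cayley–Hamilton. At least D because p ↦ p(T)e already maps the polynomials of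
degree below that of the minimal polynomial onto K^D. -/
theorem IsCyclicVector.natDegree_minpoly {T : Matrix (Fin D) (Fin D) K} {e : Fin D → K}
    (h : IsCyclicVector T e) : (minpoly K T).natDegree = D := by
  refine le_antisymm ?_ ?_
  · have := natDegree_le_of_dvd (Matrix.minpoly_dvd_charpoly T) T.charpoly_monic.ne_zero
    rwa [Matrix.charpoly_natDegree_eq_dim, Fintype.card_fin] at this
  · let φ : K[X] →ₗ[K] (Fin D → K) :=
      LinearMap.pi fun k => krylovMap T k e
    have hφ : ∀ p, φ p = aeval T p *ᵥ e := fun p => rfl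
    let ψ : (Fin (minpoly K T).natDegree → K) →ₗ[K] (Fin D → K) :=
      (φ.comp (degreeLT K (minpoly K T).natDegree).subtype).comp
        (degreeLTEquiv K (minpoly K T).natDegree).symm.toLinearMap
    have hψ : Function.Surjective ψ := by
      intro x
      obtain ⟨p, hp⟩ := h x
      have hd : p %ₘ minpoly K T ∈ degreeLT K (minpoly K T).natDegree := by
        rw [mem_degreeLT, ← degree_eq_natDegree (minpoly.ne_zero (isIntegral_matrix T))]
        exact degree_modByMonic_lt p (minpoly.monic (isIntegral_matrix T))
      refine ⟨degreeLTEquiv K _ ⟨_, hd⟩, ?_⟩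
      simp only [ψ, LinearMap.comp_apply, LinearEquiv.coe_coe, LinearEquiv.symm_apply_apply]
      change φ (p %ₘ minpoly K T) = x
      rw [hφ, aeval_modByMonic_eq_self_of_root (minpoly.aeval K T), hp]
    have := LinearMap.finrank_le_finrank_of_surjective hψ
    simpa using this

/-- The factors found by the Wiedemann algorithm, from the round with number `k` on, when the
product of the factors found before is `f`. -/
def FactorChain (T : Matrix (Fin D) (Fin D) K) (e : Fin D → K) : ℕ → K[X] → List K[X] → Prop
  | _, f, [] => aeval T f *ᵥ e = 0
  | k, f, g :: gs => aeval T f *ᵥ e ≠ 0 ∧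
      (∃ hk : k < D, IsAnnihilator (krylovMap T ⟨k, hk⟩ (aeval T f *ᵥ e)) g) ∧
      FactorChain T e (k + 1) (f * g) gs

variable {T : Matrix (Fin D) (Fin D) K} {e : Fin D → K}

theorem FactorChain.unique {k : ℕ} {f : K[X]} {gs gs' : List K[X]} (h : FactorChain T e k f gs)
    (h' : FactorChain T e k f gs') : gs = gs' := by
  induction gs generalizing k f gs' with
  | nil =>
    cases gs' with
    | nil => rfl
    | cons g' gs' => exact absurd h h'.1
  | cons g gs ih =>
    cases gs' with
    | nil => exact absurd h' h.1
    | cons g' gs' =>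
      obtain ⟨_, ⟨hk, h1⟩, h2⟩ := h
      obtain ⟨_, ⟨hk', h1'⟩, h2'⟩ := h'
      obtain rfl := h1.unique h1'
      rw [ih h2 h2']

/-- If F = fc, then c(T) kills f(T)e, so c lies in the ideal generated by g. -/
theorem annihilator_mul_dvd {k : Fin D} {f g F : K[X]} (hF : aeval T F *ᵥ e = 0) (hf : f ∣ F)
    (hg : IsAnnihilator (krylovMap T k (aeval T f *ᵥ e)) g) : f * g ∣ F := by
  obtain ⟨c, rfl⟩ := hf
  refine mul_dvd_mul_left f ((hg.dvd_iff c).2 fun q => ?_)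
  rw [krylovMap_mul, mul_assoc, mul_comm c f, ← krylovMap_mul, hF]
  simp [krylovMap]

/-- Invariant: before the round with number k, the coordinates i < k of q(T)f(T)e vanish for every
q. After D rounds nothing is left, and f(T)e = 0. -/
theorem exists_factorChain {F : K[X]} (hF0 : F ≠ 0) (hF : aeval T F *ᵥ e = 0) :
    ∃ gs, FactorChain T e 0 1 gs := by
  suffices H : ∀ n k f, D = k + n → f ∣ F →
      (∀ i : Fin D, (i : ℕ) < k → ∀ q, krylovMap T i e (q * f) = 0) →
      ∃ gs, FactorChain T e k f gs from
    H D 0 1 (by simp) (one_dvd _) (fun i hi => absurd hi (by omega))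
  intro n
  induction n with
  | zero =>
    intro k f hk hf hi
    refine ⟨[], funext fun i => ?_⟩
    have := hi i (by omega) 1
    rwa [one_mul] at this
  | succ n ih =>
    intro k f hk hf hi
    by_cases hb : aeval T f *ᵥ e = 0
    · exact ⟨[], hb⟩
    · have hkD : k < D := by omega
      obtain ⟨g, hg⟩ : ∃ g, IsAnnihilator (krylovMap T ⟨k, hkD⟩ (aeval T f *ᵥ e)) g := by
        refine exists_isAnnihilator hF0 fun q => ?_
        rw [krylovMap_mul, mul_right_comm, ← krylovMap_mul, hF]
        simp [krylovMap]
      obtain ⟨gs, hgs⟩ := ih (k + 1) (f * g) (by omega) (annihilator_mul_dvd hF hf hg) (by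
        intro i hi' q
        by_cases h : (i : ℕ) = k
        · obtain rfl : i = ⟨k, hkD⟩ := Fin.ext h
          rw [mul_comm f g, ← mul_assoc, ← krylovMap_mul]
          exact (hg.dvd_iff g).1 dvd_rfl q
        · rw [mul_comm f g, ← mul_assoc]
          exact hi i (by omega) _)
      exact ⟨g :: gs, hb, ⟨hkD, hg⟩, hgs⟩

theorem FactorChain.monic {k : ℕ} {f : K[X]} {gs : List K[X]} (h : FactorChain T e k f gs) :
    ∀ g ∈ gs, g.Monic := by
  induction gs generalizing k f with
  | nil => simp
  | cons g gs ih =>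
    obtain ⟨_, ⟨hk, h1⟩, h2⟩ := h
    intro g' hg'
    rcases List.mem_cons.1 hg' with rfl | hg'
    · exact h1.monic
    · exact ih h2 g' hg'

/-- The product of the factors divides the minimal polynomial throughout, and is divisible by it as
soon as it kills e. -/
theorem FactorChain.mul_prod_eq (hT : IsCyclicVector T e) {k : ℕ} {f : K[X]} {gs : List K[X]}
    (h : FactorChain T e k f gs) (hf : f.Monic) (hfF : f ∣ minpoly K T) :
    f * gs.prod = minpoly K T := by
  induction gs generalizing k f with
  | nil =>
    have h1 : minpoly K T ∣ f := (hT.aeval_mulVec_eq_zero_iff f).1 h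
    rw [List.prod_nil, mul_one]
    exact eq_of_monic_of_associated hf (minpoly.monic (isIntegral_matrix T))
      (associated_of_dvd_dvd hfF h1)
  | cons g gs ih =>
    obtain ⟨_, ⟨hk, h1⟩, h2⟩ := h
    rw [List.prod_cons, ← mul_assoc]
    exact ih h2 (hf.mul h1.monic)
      (annihilator_mul_dvd ((hT.aeval_mulVec_eq_zero_iff _).2 dvd_rfl) hfF h1)

/-- Writing v_j = H_j(T)e turns the right-hand side ⟨e_k, T^a f(T)v_j⟩ into L(X^a H_j), with L the
functional of b = f(T)e. The round is then determined by the annihilator g of L; deg g ≤ D − deg f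
makes the sequence of length 2(D − deg f) long enough. -/
theorem isWiedemannRun_iff (hT : IsCyclicVector T e) (H : Fin m → K[X]) (k : ℕ) (f : K[X])
    (hf : f.Monic) (hfF : f ∣ minpoly K T) (l : List (K[X] × (Fin m → K[X]))) :
    IsWiedemannRun T k f.natDegree (aeval T f *ᵥ e) (fun j => aeval T f *ᵥ aeval T (H j) *ᵥ e) l ↔
      ∃ gs, FactorChain T e k f gs ∧ l = gs.map fun g => (g, fun j => H j %ₘ g) := by
  induction l generalizing k f with
  | nil =>
    constructor
    · intro h; exact ⟨[], h, rfl⟩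
    · rintro ⟨gs, h1, h2⟩
      obtain rfl := List.map_eq_nil_iff.1 h2.symm
      exact h1
  | cons s l ih =>
    obtain ⟨g, h⟩ := s
    have hF0 : aeval T (minpoly K T) *ᵥ e = 0 := by simp
    have hannih : ∀ hk : k < D,
        ∃ g, IsAnnihilator (krylovMap T ⟨k, hk⟩ (aeval T f *ᵥ e)) g := by
      intro hk
      refine exists_isAnnihilator (minpoly.ne_zero (isIntegral_matrix T)) fun q => ?_
      rw [krylovMap_mul, mul_right_comm, ← krylovMap_mul, hF0]
      simp [krylovMap]
    have hround : ∀ (hk : k < D) (g : K[X]) (h : Fin m → K[X]),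
        (IsMinimalPolynomial (krylovSeq T ⟨k, hk⟩ (aeval T f *ᵥ e)) (2 * (D - f.natDegree)) g ∧
        IsUnit (hankel g.natDegree (krylovSeq T ⟨k, hk⟩ (aeval T f *ᵥ e))).det ∧
        ∀ j, (h j).degree < g.degree ∧
          hankel g.natDegree (krylovSeq T ⟨k, hk⟩ (aeval T f *ᵥ e)) *ᵥ
              (fun l => (h j).coeff (l : ℕ))
            = fun a : Fin g.natDegree =>
              krylovSeq T ⟨k, hk⟩ (aeval T f *ᵥ aeval T (H j) *ᵥ e) a) ↔
        IsAnnihilator (krylovMap T ⟨k, hk⟩ (aeval T f *ᵥ e)) g ∧ h = fun j => H j %ₘ g := by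
      intro hk g h
      obtain ⟨g₀, hg₀⟩ := hannih hk
      have hdeg : g₀.natDegree ≤ D - f.natDegree := by
        have h1 := annihilator_mul_dvd hF0 hfF hg₀
        have h2 := natDegree_le_of_dvd h1 (minpoly.ne_zero (isIntegral_matrix T))
        rw [hf.natDegree_mul hg₀.monic, hT.natDegree_minpoly] at h2
        omega
      have hs := krylovSeq_eq T ⟨k, hk⟩ (aeval T f *ᵥ e)
      have hv : ∀ (j : Fin m) (a : ℕ), krylovSeq T ⟨k, hk⟩ (aeval T f *ᵥ aeval T (H j) *ᵥ e) a
          = krylovMap T ⟨k, hk⟩ (aeval T f *ᵥ e) (X ^ a * H j) := by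
        intro j a
        rw [krylovSeq_eq, krylovMap_mul, krylovMap_mul, krylovMap_mul, mul_right_comm]
      rw [isMinimalPolynomial_iff hs hg₀ hdeg]
      constructor
      · rintro ⟨rfl, -, h2⟩
        refine ⟨hg₀, funext fun j => ?_⟩
        have := h2 j
        simp only [hv] at this
        exact (hg₀.hankel_mulVec_iff hs (H j) (h j)).1 this
      · rintro ⟨h1, rfl⟩
        obtain rfl := h1.unique hg₀
        refine ⟨rfl, hg₀.isUnit_hankel hs, fun j => ?_⟩
        simp only [hv]
        exact (hg₀.hankel_mulVec_iff hs (H j) _).2 rfl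
    have hnext : ∀ (hk : k < D), IsAnnihilator (krylovMap T ⟨k, hk⟩ (aeval T f *ᵥ e)) g →
        (IsWiedemannRun T (k + 1) (f.natDegree + g.natDegree) (aeval T g *ᵥ aeval T f *ᵥ e)
          (fun j => aeval T g *ᵥ aeval T f *ᵥ aeval T (H j) *ᵥ e) l ↔
        ∃ gs, FactorChain T e (k + 1) (f * g) gs ∧
          l = gs.map fun g => (g, fun j => H j %ₘ g)) := by
      intro hk hg
      rw [← ih (k + 1) (f * g) (hf.mul hg.monic) (annihilator_mul_dvd hF0 hfF hg),
        hf.natDegree_mul hg.monic]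
      simp only [mulVec_mulVec, ← map_mul, mul_comm f g, mul_assoc]
    constructor
    · rintro ⟨h1, ⟨hk, h2⟩, h3⟩
      obtain ⟨h4, rfl⟩ := (hround hk g h).1 h2
      obtain ⟨gs, h5, rfl⟩ := (hnext hk h4).1 h3
      exact ⟨g :: gs, ⟨h1, ⟨hk, h4⟩, h5⟩, rfl⟩
    · rintro ⟨gs, h1, h2⟩
      cases gs with
      | nil => simp at h2
      | cons g' gs =>
        rw [List.map_cons, List.cons.injEq, Prod.mk.injEq] at h2
        obtain ⟨⟨rfl, rfl⟩, rfl⟩ := h2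
        obtain ⟨h3, ⟨hk, h4⟩, h5⟩ := h1
        exact ⟨h3, ⟨hk, (hround hk g _).2 ⟨h4, rfl⟩⟩, (hnext hk h4).2 ⟨gs, h5, rfl⟩⟩

end Wiedemann

/-! ## The squarefree part and the record of the method -/

section SquarefreePart

variable {K : Type u} [Field K] {D m : ℕ}

open UniqueFactorizationMonoid

open Classical

theorem monic_radical (f : K[X]) : (radical f).Monic := by
  rw [UniqueFactorizationMonoid.radical]
  refine monic_prod_of_monic _ _ fun p hp => ?_
  rw [mem_primeFactors] at hp
  rw [id, ← normalize_normalized_factor p hp]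
  exact monic_normalize (irreducible_of_normalized_factor p hp).ne_zero

theorem radical_eq_of_squarefree {f p : K[X]} (hf : f ≠ 0) (hp : p.Monic)
    (hsq : Squarefree p) (hpf : p ∣ f) (h : ∀ q, Irreducible q → q ∣ f → q ∣ p) :
    p = radical f := by
  refine eq_of_monic_of_associated hp (monic_radical f) (associated_of_dvd_dvd ?_ ?_)
  · exact (dvd_radical_iff hsq.isRadical hf).2 hpf
  · refine (radical_dvd_iff_primeFactors_subset hp.ne_zero).2 fun q hq => ?_
    rw [mem_primeFactors] at hq ⊢
    have hi := irreducible_of_normalized_factor q hq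
    exact (mem_normalizedFactors_iff' hp.ne_zero).2 ⟨hi, normalize_normalized_factor q hq,
      h q hi (dvd_of_mem_normalizedFactors hq)⟩

theorem IsCoprime.of_squarefree {a b : K[X]} (h : Squarefree (a * b)) : IsCoprime a b :=
  isRelPrime_iff_isCoprime.1 (IsRelPrime.of_squarefree_mul h)

theorem pairwise_isCoprime_of_squarefree_prod {l : List K[X]} (h : Squarefree l.prod) :
    l.Pairwise IsCoprime := by
  induction l with
  | nil => exact List.Pairwise.nil
  | cons a l ih =>
    rw [List.prod_cons] at h
    refine List.Pairwise.cons (fun b hb => ?_) (ih h.of_mul_right)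
    exact (IsCoprime.of_squarefree h).of_isCoprime_of_dvd_right (List.dvd_prod hb)

/-- The first components of the squarefree splitting. -/
def splitFactors : K[X] → List K[X] → List K[X]
  | _, [] => []
  | p, g :: gs =>
      if p = 1 then [] else
        if normalize (EuclideanDomain.gcd g p) = 1 then splitFactors p gs
        else normalize (EuclideanDomain.gcd g p) ::
          splitFactors (p /ₘ normalize (EuclideanDomain.gcd g p)) gs

theorem isMonicGcd_normalize {g p : K[X]} (hg : g ≠ 0) :
    IsMonicGcd (normalize (EuclideanDomain.gcd g p)) g p := by
  have h0 : EuclideanDomain.gcd g p ≠ 0 := fun h =>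
    hg (EuclideanDomain.gcd_eq_zero_iff.1 h).1
  refine ⟨monic_normalize h0, normalize_dvd_iff.2 (EuclideanDomain.gcd_dvd_left g p),
    normalize_dvd_iff.2 (EuclideanDomain.gcd_dvd_right g p), ?_⟩
  obtain ⟨u, hu⟩ := (normalize_associated (EuclideanDomain.gcd g p)).symm
  refine ⟨u * EuclideanDomain.gcdA g p, u * EuclideanDomain.gcdB g p, ?_⟩
  conv_lhs => rw [← hu, EuclideanDomain.gcd_eq_gcd_ab]
  ring

theorem IsMonicGcd.unique {g g' p q : K[X]} (h : IsMonicGcd g p q) (h' : IsMonicGcd g' p q) :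
    g = g' :=
  eq_of_monic_of_associated h.monic h'.monic
    (associated_of_dvd_dvd (h'.dvd h.dvd_left h.dvd_right) (h.dvd h'.dvd_left h'.dvd_right))

theorem splitFactors_cons {p g g' : K[X]} (hg : g ≠ 0) (h : IsMonicGcd g' g p) (gs : List K[X]) :
    splitFactors p (g :: gs) = if p = 1 then [] else
      if g' = 1 then splitFactors p gs else g' :: splitFactors (p /ₘ g') gs := by
  rw [splitFactors, ← h.unique (isMonicGcd_normalize hg)]

/-- Each kept polynomial divides the factor it comes from, so (H_j mod g) mod g' = H_j mod g'; the
splitting only has to be followed on first components. -/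
theorem squarefreeSplit_map (H : Fin m → K[X]) (p : K[X]) (gs : List K[X])
    (hgs : ∀ g ∈ gs, g.Monic) :
    squarefreeSplit p (gs.map fun g => (g, fun j => H j %ₘ g))
      = (splitFactors p gs).map fun g => (g, fun j => H j %ₘ g) := by
  induction gs generalizing p with
  | nil => rfl
  | cons g gs ih =>
    have hg := hgs g List.mem_cons_self
    have h := isMonicGcd_normalize (g := g) (p := p) hg.ne_zero
    rw [splitFactors_cons hg.ne_zero h, List.map_cons, squarefreeSplit]
    have ih' := fun q => ih q fun g' hg' => hgs g' (List.mem_cons_of_mem _ hg')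
    have hmod : (fun j => (H j %ₘ g) %ₘ normalize (EuclideanDomain.gcd g p))
        = fun j => H j %ₘ normalize (EuclideanDomain.gcd g p) := by
      funext j
      refine modByMonic_eq_of_dvd_sub h.monic ?_
      exact h.dvd_left.trans (dvd_modByMonic_sub _ _)
    dsimp only
    split_ifs with h1 h2
    · rfl
    · exact ih' p
    · rw [List.map_cons, ih', hmod]

/-- p is squarefree, so p/g' is coprime to g' and therefore to g. Then p ∣ gq leaves p/g' ∣ q, the
invariant by which p is exhausted at the end of the list. -/
theorem exists_split_step {p g g' : K[X]} {q : K[X]} (hp : p.Monic) (hsq : Squarefree p)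
    (h : IsMonicGcd g' g p) (hdvd : p ∣ g * q) :
    g' * (p /ₘ g') = p ∧ (p /ₘ g').Monic ∧ Squarefree (p /ₘ g') ∧ p /ₘ g' ∣ q := by
  have h1 : g' * (p /ₘ g') = p := by
    rw [← modByMonic_add_div p g', (modByMonic_eq_zero_iff_dvd h.monic).2 h.dvd_right, zero_add,
      mul_divByMonic_cancel_left _ h.monic]
  generalize p /ₘ g' = p' at *
  subst h1
  have hcop : IsCoprime g' p' := IsCoprime.of_squarefree hsq
  refine ⟨rfl, h.monic.of_mul_monic_left hp, hsq.of_mul_right, ?_⟩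
  have h2 : IsCoprime p' g := by
    refine isCoprime_of_dvd _ _ (fun h0 => ?_) fun z hz _ hz1 hz2 => hz ?_
    · rw [h0.1, mul_zero] at hp
      exact not_monic_zero hp
    · exact hcop.isUnit_of_dvd' (h.dvd hz2 (hz1.mul_left g')) hz1
  exact h2.dvd_of_dvd_mul_left ((dvd_mul_left p' g').trans hdvd)

theorem list_prod_dvd_of_pairwise_isCoprime {l : List K[X]} {p : K[X]} (hl : l.Pairwise IsCoprime)
    (h : ∀ g ∈ l, g ∣ p) : l.prod ∣ p := by
  induction l with
  | nil => simp
  | cons a l ih =>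
    rw [List.pairwise_cons] at hl
    rw [List.prod_cons]
    refine IsCoprime.mul_dvd ?_ (h a List.mem_cons_self)
      (ih hl.2 fun g hg => h g (List.mem_cons_of_mem _ hg))
    have h1 := hl.1
    clear ih hl h
    induction l with
    | nil => simp [isCoprime_one_right]
    | cons b l ih =>
      rw [List.prod_cons]
      exact (h1 b List.mem_cons_self).mul_right
        (ih fun c hc => h1 c (List.mem_cons_of_mem _ hc))

theorem splitFactors_prod {p : K[X]} {gs : List K[X]} (hgs : ∀ g ∈ gs, g.Monic) (hp : p.Monic)
    (hsq : Squarefree p) (hdvd : p ∣ gs.prod) :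
    (splitFactors p gs).prod = p ∧ ∀ g ∈ splitFactors p gs, g.Monic := by
  induction gs generalizing p with
  | nil =>
    rw [List.prod_nil] at hdvd
    exact ⟨(hp.eq_one_of_isUnit (isUnit_of_dvd_one hdvd)).symm, by simp [splitFactors]⟩
  | cons g gs ih =>
    have hg := hgs g List.mem_cons_self
    have h := isMonicGcd_normalize (g := g) (p := p) hg.ne_zero
    rw [List.prod_cons] at hdvd
    obtain ⟨h1, h2, h3, h4⟩ := exists_split_step hp hsq h hdvd
    have ih' := ih (fun g' hg' => hgs g' (List.mem_cons_of_mem _ hg')) h2 h3 h4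
    rw [splitFactors_cons hg.ne_zero h]
    split_ifs with h5 h6
    · simp [h5]
    · rw [h6, one_mul, ← h6] at h1
      rwa [h1] at ih'
    · rw [List.prod_cons, ih'.1]
      exact ⟨h1, List.forall_mem_cons.2 ⟨h.monic, ih'.2⟩⟩

/-- The record of the method, when the Wiedemann factors are `gs` and `v_j` is the coordinate
vector of `H j`. -/
def methodTrace (H : Fin m → K[X]) (gs : List K[X]) : MethodTrace K[X] m where
  systems := gs.map fun g => (g, fun j => H j %ₘ g)
  parts := (if radical gs.prod = gs.prod then gs else splitFactors (radical gs.prod) gs).map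
    fun g => (g, fun j => H j %ₘ g)
  result := (radical gs.prod, fun j => H j %ₘ radical gs.prod)

/-- All components are remainders of the H_j: the kept moduli are coprime with product rad F, so the
congruences amount to p ≡ H_j modulo rad F. Existence and uniqueness of the run come out together.
-/
theorem isMethodRun_iff {T : Matrix (Fin D) (Fin D) K}
    (hT : IsCyclicVector T (unitVec K D)) (H : Fin m → K[X]) {gs : List K[X]}
    (hgs : FactorChain T (unitVec K D) 0 1 gs) (t : MethodTrace K[X] m) :
    IsMethodRun T (fun j => aeval T (H j) *ᵥ unitVec K D) t ↔ t = methodTrace H gs := by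
  have hrun : ∀ l, IsWiedemannRun T 0 0 (unitVec K D) (fun j => aeval T (H j) *ᵥ unitVec K D) l ↔
      l = gs.map fun g => (g, fun j => H j %ₘ g) := by
    intro l
    have := isWiedemannRun_iff hT H 0 1 monic_one (one_dvd _) l
    rw [natDegree_one, map_one, one_mulVec] at this
    simp only [one_mulVec] at this
    rw [this]
    constructor
    · rintro ⟨gs', h1, rfl⟩
      rw [h1.unique hgs]
    · rintro rfl
      exact ⟨gs, hgs, rfl⟩
  have hmonic := hgs.monic
  have hprod : gs.prod = minpoly K T := by
    rw [← hgs.mul_prod_eq hT monic_one (one_dvd _), one_mul]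
  have hdeg : gs.prod.natDegree = D := by rw [hprod, hT.natDegree_minpoly]
  have hpm : gs.prod.Monic := hprod ▸ minpoly.monic (isIntegral_matrix T)
  have hfst : ∀ l : List K[X], (l.map fun g => (g, fun j => H j %ₘ g)).map Prod.fst = l := by
    intro l; simp [Function.comp_def]
  have hrm := monic_radical gs.prod
  let parts := if radical gs.prod = gs.prod then gs else splitFactors (radical gs.prod) gs
  have hparts : parts.prod = radical gs.prod ∧ ∀ g ∈ parts, g.Monic := by
    simp only [parts]
    split_ifs with h
    · exact ⟨h.symm, hmonic⟩
    · exact splitFactors_prod hmonic hrm squarefree_radical radical_dvd_self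
  have hpair : parts.Pairwise IsCoprime :=
    pairwise_isCoprime_of_squarefree_prod (by rw [hparts.1]; exact squarefree_radical)
  have hpartsEq : (if radical gs.prod = gs.prod then gs.map fun g => (g, fun j => H j %ₘ g)
      else squarefreeSplit (radical gs.prod) (gs.map fun g => (g, fun j => H j %ₘ g)))
      = parts.map fun g => (g, fun j => H j %ₘ g) := by
    simp only [parts]
    split_ifs with h
    · rfl
    · exact squarefreeSplit_map H _ gs hmonic
  have hcrt : ∀ (p : K[X]) (j : Fin m), (p.degree < (radical gs.prod).degree ∧
      ∀ s ∈ parts.map fun g => (g, fun j => H j %ₘ g), s.1 ∣ p - s.2 j) ↔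
      p = H j %ₘ radical gs.prod := by
    intro p j
    have h1 : (∀ s ∈ parts.map fun g => (g, fun j => H j %ₘ g), s.1 ∣ p - s.2 j) ↔
        radical gs.prod ∣ p - H j := by
      have h2 : ∀ g, g ∣ p - H j %ₘ g ↔ g ∣ p - H j := by
        intro g
        rw [show p - H j = (p - H j %ₘ g) + (H j %ₘ g - H j) by ring]
        exact (dvd_add_left (dvd_modByMonic_sub _ _)).symm
      simp only [List.mem_map, forall_exists_index, and_imp, forall_apply_eq_imp_iff₂, h2]
      rw [← hparts.1]
      constructor
      · exact fun h => list_prod_dvd_of_pairwise_isCoprime hpair h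
      · intro h g hg
        exact (List.dvd_prod hg).trans h
    rw [h1]
    constructor
    · rintro ⟨h2, q, hq⟩
      exact ((div_modByMonic_unique (-q) p hrm ⟨by linear_combination hq, h2⟩).2).symm
    · rintro rfl
      exact ⟨degree_modByMonic_lt _ hrm, dvd_modByMonic_sub _ _⟩
  obtain ⟨sys, pts, res, hs⟩ := t
  simp only [IsMethodRun, methodTrace, hrun, MethodTrace.mk.injEq, Prod.mk.injEq]
  constructor
  · rintro ⟨rfl, -, h3, -, -, h6, h7⟩
    simp only [hfst] at h3 h6 h7
    rw [hpartsEq] at h3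
    subst h3
    refine ⟨rfl, rfl, h6, funext fun j => ?_⟩
    exact (hcrt _ j).1 (h7 j)
  · rintro ⟨rfl, rfl, rfl, rfl⟩
    simp only [hfst]
    exact ⟨trivial, hdeg, hpartsEq.symm, hparts.1, hpair, trivial, fun j => (hcrt _ j).2 rfl⟩

end SquarefreePart

/-! ## Ideals in shape position -/

section LexOrder

variable {K : Type u} [Field K] {m : ℕ}

/-- The elimination property of LEX: terms below a power of x_1 are powers of x_1. -/
theorem lexOrder_eq_zero_of_le {s t : Fin (m + 1) →₀ ℕ}
    (h : (lexOrder (m + 1)).toSyn t ≤ (lexOrder (m + 1)).toSyn s)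
    (hs : ∀ j : Fin m, s j.succ = 0) (j : Fin m) : t j.succ = 0 := by
  rcases h.lt_or_eq with h | h
  · obtain ⟨i, hi, hi'⟩ := (Finsupp.Lex.lt_iff (α := (Fin (m + 1))ᵒᵈ)).1 h
    have hlt : t (OrderDual.ofDual i) < s (OrderDual.ofDual i) := hi'
    have hi0 : OrderDual.ofDual i = 0 := by
      by_contra h0
      obtain ⟨k, hk⟩ := Fin.exists_succ_eq.2 h0
      rw [← hk, hs] at hlt
      exact absurd hlt (Nat.not_lt_zero _)
    have h1 : t j.succ = s j.succ := hi (OrderDual.toDual j.succ) (by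
      change OrderDual.ofDual i < j.succ
      rw [hi0]; exact Fin.succ_pos j)
    exact h1.trans (hs j)
  · rw [(lexOrder (m + 1)).toSyn.injective h]; exact hs j

theorem degree_eq_of_forall_le {n : ℕ} (ord : MonomialOrder.{0, w} (Fin n))
    {f : MvPolynomial (Fin n) K} {s : Fin n →₀ ℕ} (hs : s ∈ f.support)
    (h : ∀ t ∈ f.support, ord.toSyn t ≤ ord.toSyn s) : ord.degree f = s := by
  have hf : f ≠ 0 := by rintro rfl; simp at hs
  exact ord.toSyn.injective (le_antisymm (h _ (ord.degree_mem_support hf)) (ord.le_degree hs))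

theorem coeff_aeval_X_zero (p : K[X]) (s : Fin (m + 1) →₀ ℕ) :
    MvPolynomial.coeff s (aeval (MvPolynomial.X 0 : MvPolynomial (Fin (m + 1)) K) p)
      = if s = Finsupp.single 0 (s 0) then p.coeff (s 0) else 0 := by
  induction p using Polynomial.induction_on' with
  | add p q hp hq =>
    rw [map_add, MvPolynomial.coeff_add, hp, hq, coeff_add]
    split_ifs <;> simp
  | monomial n a =>
    rw [aeval_monomial, MvPolynomial.algebraMap_eq, MvPolynomial.coeff_C_mul,
      MvPolynomial.coeff_X_pow, coeff_monomial]
    by_cases h : Finsupp.single 0 n = s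
    · subst h; simp
    · rw [if_neg h]
      split_ifs with h1 h2
      · exact absurd (by rw [h1, h2]) h
      · simp
      · simp

theorem mem_support_aeval_X_zero {p : K[X]} {s : Fin (m + 1) →₀ ℕ} :
    s ∈ (aeval (MvPolynomial.X 0 : MvPolynomial (Fin (m + 1)) K) p).support ↔
      ∃ a, p.coeff a ≠ 0 ∧ s = Finsupp.single 0 a := by
  rw [MvPolynomial.mem_support_iff, coeff_aeval_X_zero]
  constructor
  · intro h
    split_ifs at h with h1
    · exact ⟨s 0, h, h1⟩
    · exact absurd rfl h
  · rintro ⟨a, ha, rfl⟩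
    simpa using ha

theorem exists_eq_aeval_X_zero {f : MvPolynomial (Fin (m + 1)) K}
    (hf : ∀ s ∈ f.support, ∀ j : Fin m, s j.succ = 0) :
    ∃ p : K[X], f = aeval (MvPolynomial.X 0) p := by
  refine ⟨∑ s ∈ f.support, Polynomial.monomial (s 0) (f.coeff s), ?_⟩
  rw [map_sum]
  conv_lhs => rw [f.as_sum]
  refine Finset.sum_congr rfl fun s hs => ?_
  rw [aeval_monomial, MvPolynomial.algebraMap_eq, MvPolynomial.monomial_eq,
    Finsupp.prod_fintype _ _ (fun _ => pow_zero _), Fin.prod_univ_succ]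
  simp [hf s hs]

theorem degree_aeval_X_zero {p : K[X]} (hp : p ≠ 0) :
    (lexOrder (m + 1)).degree (aeval (MvPolynomial.X 0 : MvPolynomial (Fin (m + 1)) K) p)
      = Finsupp.single 0 p.natDegree := by
  refine degree_eq_of_forall_le _ (mem_support_aeval_X_zero.2
    ⟨_, by simpa using hp, rfl⟩) fun t ht => ?_
  obtain ⟨a, ha, rfl⟩ := mem_support_aeval_X_zero.1 ht
  refine (lexOrder (m + 1)).toSyn_monotone ?_
  exact Finsupp.single_le_single.2 (le_natDegree_of_ne_zero ha)

theorem coeff_X_succ_sub (j : Fin m) (p : K[X]) (s : Fin (m + 1) →₀ ℕ) :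
    MvPolynomial.coeff s (MvPolynomial.X j.succ - aeval (MvPolynomial.X 0) p)
      = (if s = Finsupp.single j.succ 1 then 1 else 0)
        - (if s = Finsupp.single 0 (s 0) then p.coeff (s 0) else 0) := by
  rw [MvPolynomial.coeff_sub, coeff_aeval_X_zero, MvPolynomial.coeff_X]
  simp [eq_comm]

theorem single_succ_ne (j : Fin m) (a : ℕ) :
    (Finsupp.single j.succ 1 : Fin (m + 1) →₀ ℕ) ≠ Finsupp.single 0 a := by
  intro h
  have := DFunLike.congr_fun h j.succ
  simp at this

theorem mem_support_X_succ_sub {j : Fin m} {p : K[X]} {s : Fin (m + 1) →₀ ℕ} :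
    s ∈ (MvPolynomial.X j.succ - aeval (MvPolynomial.X 0) p : MvPolynomial (Fin (m + 1)) K).support
      ↔ s = Finsupp.single j.succ 1 ∨ ∃ a, p.coeff a ≠ 0 ∧ s = Finsupp.single 0 a := by
  rw [MvPolynomial.mem_support_iff, coeff_X_succ_sub, ← mem_support_aeval_X_zero (K := K),
    MvPolynomial.mem_support_iff, coeff_aeval_X_zero]
  by_cases h : s = Finsupp.single j.succ 1
  · have h2 : ¬ s = Finsupp.single 0 (s 0) := fun h3 => single_succ_ne j _ (h.symm.trans h3)
    rw [if_pos h, if_neg h2]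
    simp [h]
  · rw [if_neg h]
    simp [h]

theorem degree_X_succ_sub (j : Fin m) (p : K[X]) :
    (lexOrder (m + 1)).degree
      (MvPolynomial.X j.succ - aeval (MvPolynomial.X 0) p : MvPolynomial (Fin (m + 1)) K)
      = Finsupp.single j.succ 1 := by
  refine degree_eq_of_forall_le _ (mem_support_X_succ_sub.2 (Or.inl rfl)) fun t ht => ?_
  rcases mem_support_X_succ_sub.1 ht with rfl | ⟨a, _, rfl⟩
  · exact le_rfl
  · by_contra hlt
    have := lexOrder_eq_zero_of_le (not_le.1 hlt).le
      (fun j => by simp) j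
    simp at this

/-- If the leading term of an element of J is a power of x_1, elimination makes the element a
polynomial in x_1, hence a multiple of f; any other leading term is divisible by some later
variable. `hf0` keeps the leading term of f from dividing those variables, and `hdeg` keeps the
tails reduced. -/
theorem isReducedGroebnerBasis_shapeSet {J : Ideal (MvPolynomial (Fin (m + 1)) K)} {f : K[X]}
    {h : Fin m → K[X]} (hf : f.Monic) (hf0 : 0 < f.natDegree)
    (hJ : ∀ p : K[X], aeval (MvPolynomial.X 0) p ∈ J ↔ f ∣ p)
    (hX : ∀ j : Fin m, MvPolynomial.X j.succ - aeval (MvPolynomial.X 0) (h j) ∈ J)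
    (hdeg : ∀ j, (h j).degree < f.degree) :
    IsReducedGroebnerBasis (lexOrder (m + 1)) (shapeSet f h) J := by
  have hle : ∀ {j : Fin m} {s : Fin (m + 1) →₀ ℕ}, Finsupp.single j.succ 1 ≤ s ↔ s j.succ ≠ 0 := by
    intro j s
    rw [Finsupp.single_le_iff]; omega
  refine ⟨?_, ?_, ?_, ?_⟩
  · rintro g (rfl | ⟨j, rfl⟩)
    · exact (hJ f).2 dvd_rfl
    · exact hX j
  · rintro g (rfl | ⟨j, rfl⟩)
    · rw [MonomialOrder.leadingCoeff, degree_aeval_X_zero hf.ne_zero, coeff_aeval_X_zero]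
      simpa using hf.leadingCoeff
    · rw [MonomialOrder.leadingCoeff, degree_X_succ_sub, coeff_X_succ_sub, if_pos rfl,
        if_neg (single_succ_ne j _), sub_zero]
  · intro g hg hg0
    by_cases hs : ∀ j : Fin m, (lexOrder (m + 1)).degree g j.succ = 0
    · obtain ⟨p, rfl⟩ := exists_eq_aeval_X_zero fun s hs' =>
        lexOrder_eq_zero_of_le ((lexOrder (m + 1)).le_degree hs') hs
      have hp : p ≠ 0 := by rintro rfl; simp at hg0
      refine ⟨_, Set.mem_insert _ _, ?_⟩
      rw [degree_aeval_X_zero hp, degree_aeval_X_zero hf.ne_zero]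
      exact Finsupp.single_le_single.2 (natDegree_le_of_dvd ((hJ p).1 hg) hp)
    · push Not at hs
      obtain ⟨j, hj⟩ := hs
      refine ⟨_, Set.mem_insert_of_mem _ ⟨j, rfl⟩, ?_⟩
      rw [degree_X_succ_sub]
      exact hle.2 hj
  · have h0 : ∀ (j : Fin m) (a : ℕ), (Finsupp.single 0 a : Fin (m + 1) →₀ ℕ) j.succ = 0 :=
      fun j a => by simp
    rintro g (rfl | ⟨j, rfl⟩) g' (rfl | ⟨i, rfl⟩) hne s hs
    · exact absurd rfl hne
    · obtain ⟨a, _, rfl⟩ := mem_support_aeval_X_zero.1 hs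
      rw [degree_X_succ_sub, hle, h0]
      simp
    · rw [degree_aeval_X_zero hf.ne_zero, Finsupp.single_le_iff]
      rcases mem_support_X_succ_sub.1 hs with rfl | ⟨a, ha, rfl⟩
      · simp [Fin.succ_ne_zero j, hf0.ne']
      · have h1 := (le_degree_of_ne_zero ha).trans_lt (hdeg j)
        rw [degree_eq_natDegree hf.ne_zero] at h1
        have : a < f.natDegree := by exact_mod_cast h1
        simpa using this
    · rw [degree_X_succ_sub, hle]
      rcases mem_support_X_succ_sub.1 hs with rfl | ⟨a, ha, rfl⟩
      · have hij : i ≠ j := by rintro rfl; exact hne rfl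
        simp [hij.symm]
      · rw [h0]; simp

end LexOrder

/-! ### Coordinates in the quotient ring, cyclicity of the unit vector, and the radical -/

section ShapePosition

variable {K : Type u} [Field K] {m D : ℕ} {ord : MonomialOrder.{0, w} (Fin (m + 1))}
  {I : Ideal (MvPolynomial (Fin (m + 1)) K)} {ε : Fin D → (Fin (m + 1) →₀ ℕ)}
  {T : Fin (m + 1) → Matrix (Fin D) (Fin D) K}

/-- The residue class with a given coordinate vector. -/
def residueMap (I : Ideal (MvPolynomial (Fin (m + 1)) K)) (ε : Fin D → (Fin (m + 1) →₀ ℕ)) :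
    (Fin D → K) →ₗ[K] MvPolynomial (Fin (m + 1)) K ⧸ I :=
  (Ideal.Quotient.mkₐ K I).toLinearMap.comp
    (Fintype.linearCombination K fun k => MvPolynomial.monomial (ε k) (1 : K))

theorem residueMap_apply (c : Fin D → K) : residueMap I ε c
    = Ideal.Quotient.mk I (∑ k, MvPolynomial.monomial (ε k) (c k)) := by
  simp [residueMap, Fintype.linearCombination_apply, MvPolynomial.smul_monomial]

/-- A nonzero combination of the ε_k has one of them as its leading term, so it is not in I. -/
theorem residueMap_injective (hε : IsCanonicalBasis ord I ε) :
    Function.Injective (residueMap I ε) := by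
  have hinj : Function.Injective ε := fun a b h => hε.1.injective (by simp only [h])
  rw [← LinearMap.ker_eq_bot, LinearMap.ker_eq_bot']
  intro c hc
  rw [residueMap_apply, Ideal.Quotient.eq_zero_iff_mem] at hc
  have hcoeff : ∀ s, MvPolynomial.coeff s (∑ k, MvPolynomial.monomial (ε k) (c k))
      = ∑ k, if ε k = s then c k else 0 := by
    intro s
    simp [MvPolynomial.coeff_sum, MvPolynomial.coeff_monomial]
  by_cases h0 : (∑ k, MvPolynomial.monomial (ε k) (c k)) = 0
  · funext i
    have := hcoeff (ε i)
    rw [h0] at this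
    simpa [hinj.eq_iff] using this.symm
  · have h1 := ord.degree_mem_support h0
    rw [MvPolynomial.mem_support_iff, hcoeff] at h1
    obtain ⟨k, -, hk⟩ := Finset.exists_ne_zero_of_sum_ne_zero h1
    have hk' : ε k = ord.degree (∑ k, MvPolynomial.monomial (ε k) (c k)) := by
      by_contra h2
      rw [if_neg h2] at hk
      exact hk rfl
    have h3 : ε k ∈ Set.range ε := ⟨k, rfl⟩
    rw [hε.2] at h3
    exact absurd hk'.symm (h3 _ hc h0)

theorem residueMap_mulVec (hT : ∀ i, IsMultiplicationMatrix I ε i (T i)) (i : Fin (m + 1))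
    (c : Fin D → K) : residueMap I ε (T i *ᵥ c)
      = Ideal.Quotient.mk I (MvPolynomial.X i) * residueMap I ε c := by
  have h1 : ∀ j, residueMap I ε (fun k => T i k j)
      = Ideal.Quotient.mk I (MvPolynomial.monomial (ε j) 1 * MvPolynomial.X i) := by
    intro j
    rw [residueMap_apply]
    exact (Ideal.Quotient.eq.2 (hT i j)).symm
  have h2 : T i *ᵥ c = ∑ j, c j • fun k => T i k j := by
    funext k
    simp [mulVec, dotProduct, mul_comm]
  rw [h2, map_sum]
  simp only [map_smul, h1]
  rw [residueMap_apply, ← map_mul, Finset.mul_sum, map_sum]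
  refine Finset.sum_congr rfl fun j _ => ?_
  rw [← Ideal.Quotient.mkₐ_eq_mk K, ← map_smul, ← smul_mul_assoc, MvPolynomial.smul_monomial,
    smul_eq_mul, mul_one, mul_comm]

/-- If 1 were a leading term, I would contain a nonzero constant. As the least term, 1 comes first
in the basis. -/
theorem exists_eq_zero_of_ne_top (hI : I ≠ ⊤) (hε : IsCanonicalBasis ord I ε) :
    ∃ h : 0 < D, ε ⟨0, h⟩ = 0 := by
  have h0 : (0 : Fin (m + 1) →₀ ℕ) ∈ Set.range ε := by
    rw [hε.2]
    intro f hf hf0 hdeg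
    apply hI
    have hC := ord.eq_C_of_degree_eq_zero hdeg
    have h1 : ord.leadingCoeff f ≠ 0 := ord.leadingCoeff_ne_zero_iff.2 hf0
    rw [hC] at hf
    exact Ideal.eq_top_of_isUnit_mem _ hf ((isUnit_iff_ne_zero.2 h1).map MvPolynomial.C)
  obtain ⟨k, hk⟩ := h0
  have hD : 0 < D := k.pos
  refine ⟨hD, ?_⟩
  have h1 : ord.toSyn (ε ⟨0, hD⟩) ≤ ord.toSyn (ε k) :=
    hε.1.monotone (Fin.mk_le_of_le_val (Nat.zero_le _))
  rw [hk, map_zero] at h1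
  exact ord.toSyn.injective (by rw [map_zero]; exact le_antisymm h1 (ord.zero_le _))

theorem residueMap_unitVec (hI : I ≠ ⊤) (hε : IsCanonicalBasis ord I ε) :
    residueMap I ε (unitVec K D) = 1 := by
  obtain ⟨hD, h0⟩ := exists_eq_zero_of_ne_top hI hε
  rw [residueMap_apply, Finset.sum_eq_single ⟨0, hD⟩]
  · simp [h0, unitVec]
  · intro b _ hb
    have : (b : ℕ) ≠ 0 := fun h => hb (Fin.ext h)
    simp [unitVec, this]
  · simp

theorem residueMap_aeval (hT : ∀ i, IsMultiplicationMatrix I ε i (T i)) (p : K[X])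
    (c : Fin D → K) : residueMap I ε (aeval (T 0) p *ᵥ c)
      = Ideal.Quotient.mk I (aeval (MvPolynomial.X 0) p) * residueMap I ε c := by
  induction p using Polynomial.induction_on generalizing c with
  | add p q hp hq => rw [map_add, add_mulVec, map_add, hp, hq, map_add, map_add, add_mul]
  | C a =>
    rw [aeval_C, aeval_C, Algebra.algebraMap_eq_smul_one, smul_mulVec, one_mulVec, map_smul,
      ← Ideal.Quotient.mkₐ_eq_mk K, AlgHom.commutes]
    exact Algebra.smul_def a (residueMap I ε c)
  | monomial n a ih =>
    rw [pow_succ, ← mul_assoc, map_mul, ← mulVec_mulVec, ih, aeval_X, residueMap_mulVec hT,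
      map_mul _ (C a * X ^ n), aeval_X, map_mul _ _ (MvPolynomial.X 0), mul_assoc]

/-- Substituting h_j(x_1) for x_j does not change residue classes, so every class is that of some
p(x_1). By injectivity of `residueMap` the equality carries over to coordinate vectors p(T_1)e. -/
theorem isCyclicVector_of_inShapePosition (hI : I ≠ ⊤) (hs : InShapePosition I)
    (hε : IsCanonicalBasis ord I ε) (hT : ∀ i, IsMultiplicationMatrix I ε i (T i)) :
    IsCyclicVector (T 0) (unitVec K D) := by
  obtain ⟨f, h, hG, -⟩ := hs
  have hX : ∀ j : Fin m, Ideal.Quotient.mk I (aeval (MvPolynomial.X 0) (h j))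
      = Ideal.Quotient.mk I (MvPolynomial.X j.succ) := fun j =>
    (Ideal.Quotient.eq.2 (hG _ (Set.mem_insert_of_mem _ ⟨j, rfl⟩))).symm
  let θ : MvPolynomial (Fin (m + 1)) K →ₐ[K] K[X] := MvPolynomial.aeval (Fin.cons X h)
  have hθ : (Ideal.Quotient.mkₐ K I).comp ((aeval (MvPolynomial.X 0)).comp θ)
      = Ideal.Quotient.mkₐ K I := by
    refine MvPolynomial.algHom_ext fun i => ?_
    refine Fin.cases ?_ (fun j => ?_) i
    · simp [θ]
    · simpa [θ] using hX j
  intro x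
  refine ⟨θ (∑ k, MvPolynomial.monomial (ε k) (x k)), residueMap_injective hε ?_⟩
  rw [residueMap_aeval hT, residueMap_unitVec hI hε, mul_one, residueMap_apply]
  exact DFunLike.congr_fun hθ _

theorem aeval_X_zero_mem_iff (hI : I ≠ ⊤) (hε : IsCanonicalBasis ord I ε)
    (hT : ∀ i, IsMultiplicationMatrix I ε i (T i)) (p : K[X]) :
    aeval (MvPolynomial.X 0) p ∈ I ↔ aeval (T 0) p *ᵥ unitVec K D = 0 := by
  rw [← Ideal.Quotient.eq_zero_iff_mem, ← mul_one (Ideal.Quotient.mk I _),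
    ← residueMap_unitVec hI hε, ← residueMap_aeval hT,
    map_eq_zero_iff _ (residueMap_injective hε)]

theorem X_succ_sub_mem (hI : I ≠ ⊤) (hε : IsCanonicalBasis ord I ε)
    (hT : ∀ i, IsMultiplicationMatrix I ε i (T i)) {H : Fin m → K[X]}
    (hH : ∀ j, T j.succ *ᵥ unitVec K D = aeval (T 0) (H j) *ᵥ unitVec K D) (j : Fin m) :
    MvPolynomial.X j.succ - aeval (MvPolynomial.X 0) (H j) ∈ I := by
  rw [← Ideal.Quotient.eq]
  have := congrArg (residueMap I ε) (hH j)
  rwa [residueMap_mulVec hT, residueMap_aeval hT, residueMap_unitVec hI hε, mul_one,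
    mul_one] at this

-- p(x_1)^n ∈ I means F ∣ p^n for the minimal polynomial F of T_1; hence p(x_1) ∈ √I exactly when
-- rad F ∣ p. Together with x_j − H_j(x_1) ∈ I this meets the criterion
-- `isReducedGroebnerBasis_shapeSet`.
open UniqueFactorizationMonoid Classical in
theorem isReducedGroebnerBasis_radical (hI : I ≠ ⊤) (hs : InShapePosition I)
    (hε : IsCanonicalBasis ord I ε) (hT : ∀ i, IsMultiplicationMatrix I ε i (T i))
    {H : Fin m → K[X]}
    (hH : ∀ j, T j.succ *ᵥ unitVec K D = aeval (T 0) (H j) *ᵥ unitVec K D) :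
    IsReducedGroebnerBasis (lexOrder (m + 1)) (shapeSet (radical (minpoly K (T 0)))
      (fun j => H j %ₘ radical (minpoly K (T 0)))) I.radical := by
  have hcyc := isCyclicVector_of_inShapePosition hI hs hε hT
  have hF0 : minpoly K (T 0) ≠ 0 := minpoly.ne_zero (isIntegral_matrix _)
  have hrm := monic_radical (minpoly K (T 0))
  have hmem : ∀ p : K[X], aeval (MvPolynomial.X 0 : MvPolynomial (Fin (m + 1)) K) p ∈ I.radical ↔
      radical (minpoly K (T 0)) ∣ p := by
    intro p
    rw [← exists_dvd_pow_iff_radical_dvd hF0, Ideal.mem_radical_iff]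
    refine exists_congr fun n => ?_
    rw [← map_pow, aeval_X_zero_mem_iff hI hε hT, hcyc.aeval_mulVec_eq_zero_iff]
  refine isReducedGroebnerBasis_shapeSet hrm ?_ hmem (fun j => ?_)
    fun j => degree_modByMonic_lt _ hrm
  · rw [Nat.pos_iff_ne_zero]
    intro h0
    have h1 : radical (minpoly K (T 0)) = 1 := hrm.natDegree_eq_zero.1 h0
    have h2 := (hmem 1).2 (h1 ▸ dvd_rfl)
    rw [map_one, ← Ideal.eq_top_iff_one, Ideal.radical_eq_top] at h2
    exact hI h2
  · have h1 : (MvPolynomial.X j.succ : MvPolynomial (Fin (m + 1)) K)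
        - aeval (MvPolynomial.X 0) (H j %ₘ radical (minpoly K (T 0)))
        = (MvPolynomial.X j.succ - aeval (MvPolynomial.X 0) (H j))
        - aeval (MvPolynomial.X 0) (H j %ₘ radical (minpoly K (T 0)) - H j) := by
      rw [map_sub]; ring
    rw [h1]
    exact sub_mem (Ideal.le_radical (X_succ_sub_mem hI hε hT hH j))
      ((hmem _).2 (dvd_modByMonic_sub _ _))

end ShapePosition

/-! ## The program for the squarefree part -/

section RadicalMath

variable {K : Type u} [Field K]

open UniqueFactorizationMonoid

open Classical

/-- Suppose q² ∣ v. If q^k ∣ c, then q^(k+2) ∣ F, so q^(k+1) divides F and F', hence c. All powers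
of q would divide c. The argument works in every characteristic. -/
theorem squarefree_of_mul_gcd_derivative {F c v : K[X]} (hF : F ≠ 0)
    (hc : IsMonicGcd c F (derivative F)) (hv : v * c = F) : Squarefree v := by
  have hv0 : v ≠ 0 := by rintro rfl; exact hF (by rw [← hv, zero_mul])
  rw [squarefree_iff_irreducible_sq_not_dvd_of_ne_zero hv0]
  intro q hq hdvd
  have key : ∀ k, q ^ k ∣ c := by
    intro k
    induction k with
    | zero => simp
    | succ k ih =>
      have h1 : q ^ (k + 2) ∣ F := by
        rw [← hv, pow_add, mul_comm (q ^ k), pow_two]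
        exact mul_dvd_mul hdvd ih
      refine hc.dvd ((pow_dvd_pow q (Nat.le_succ _)).trans h1) ?_
      have h2 := pow_sub_one_dvd_derivative_of_pow_dvd h1
      rwa [show k + 2 - 1 = k + 1 by omega] at h2
  have hc0 := hc.monic.ne_zero
  have h1 := natDegree_le_of_dvd (key (c.natDegree + 1)) hc0
  rw [natDegree_pow] at h1
  have h2 : 0 < q.natDegree := hq.natDegree_pos
  have h3 : c.natDegree + 1 ≤ (c.natDegree + 1) * q.natDegree := Nat.le_mul_of_pos_right _ h2
  omega

/-- Each irreducible factor of F = vc divides v or c. Since v is squarefree, t is the product of the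
primes of v that do not occur in c. -/
theorem radical_eq_mul {F c v h t : K[X]} (hF : F.Monic)
    (hc : IsMonicGcd c F (derivative F)) (hv : v * c = F) (hh : IsMonicGcd h (radical c) v)
    (ht : h * t = v) : radical c * t = radical F := by
  have hsq := squarefree_of_mul_gcd_derivative hF.ne_zero hc hv
  have hvm : v.Monic := by rw [← hv] at hF; exact hc.monic.of_mul_monic_right hF
  have htm : t.Monic := hh.monic.of_mul_monic_left (ht ▸ hvm)
  have hr0 := hc.monic.ne_zero
  have hcop : IsCoprime h t := IsCoprime.of_squarefree (ht ▸ hsq)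
  have htsq : Squarefree t := hsq.squarefree_of_dvd ⟨h, by rw [← ht, mul_comm]⟩
  have hcop2 : IsRelPrime (radical c) t := by
    intro z hz1 hz2
    have hz3 : z ∣ h := hh.dvd hz1 (hz2.trans ⟨h, by rw [← ht, mul_comm]⟩)
    exact hcop.isUnit_of_dvd' hz3 hz2
  refine radical_eq_of_squarefree hF.ne_zero ((monic_radical c).mul htm)
    (squarefree_mul_iff.2 ⟨hcop2, squarefree_radical, htsq⟩) ?_ fun q hq hqF => ?_
  · rw [← hv, mul_comm]
    exact mul_dvd_mul ⟨h, by rw [← ht, mul_comm]⟩ radical_dvd_self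
  · rw [← hv] at hqF
    rcases hq.prime.dvd_or_dvd hqF with h1 | h1
    · rw [← ht] at h1
      rcases hq.prime.dvd_or_dvd h1 with h2 | h2
      · exact (h2.trans hh.dvd_left).mul_right t
      · exact h2.mul_left _
    · exact ((dvd_radical_iff_of_irreducible hq hr0).2 h1).mul_right t

/-- A polynomial with zero derivative is a polynomial in X^p; taking p-th roots of its coefficients
gives R^p = F. -/
theorem radical_eq_of_derivative_eq_zero {F R : K[X]} {p : ℕ} [CharP K p] (hp : p.Prime)
    (hF : derivative F = 0) (hR : ∀ j, (R.coeff j) ^ p = F.coeff (p * j)) :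
    radical R = radical F := by
  have : Fact p.Prime := ⟨hp⟩
  have h1 : R.map (frobenius K p) = contract p F := by
    ext j
    rw [coeff_map, coeff_contract hp.ne_zero, mul_comm]
    exact hR j
  have h2 : R ^ p = F := by
    rw [← map_frobenius_expand, map_expand, h1, expand_contract p hF hp.ne_zero]
  rw [← h2, radical_pow R hp.ne_zero]

end RadicalMath

/-! ### Squarefree parts by derivatives, gcds and p-th roots, with quadratic cost -/

section RadicalProgram

variable {K : Type u} [Field K] {ι : Type}

/-- The program for powers, by repeated squaring. -/
def binPowC (a : ι ⊕ ℕ) (n : ℕ) : Comp ι (ι ⊕ ℕ) :=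
  if n = 0 then pure oneReg
  else if n = 1 then pure a
  else do
    let h ← binPowC a (n / 2)
    let z ← arithC .mul h h
    if n % 2 = 0 then pure z else arithC .mul z a
termination_by n

theorem runLe_binPowC {w : World ι K} {a : ι ⊕ ℕ} {x : K} (ha : Holds w a x) (n : ℕ) :
    RunLe w (binPowC a n) (2 * Nat.log 2 n) fun r w' => Holds w' r (x ^ n) := by
  induction n using Nat.strong_induction_on with
  | _ n ih =>
    rw [binPowC]
    split_ifs with h0 h1 h2
    · subst h0; exact RunLe.pure (by simpa using holds_one w)
    · subst h1; exact RunLe.pure (by simpa using ha)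
    all_goals
      have hlog : Nat.log 2 n = Nat.log 2 (n / 2) + 1 := by
        rw [Nat.log_div_base]
        have : 0 < Nat.log 2 n := Nat.log_pos one_lt_two (by omega)
        omega
    · refine RunLe.bind (c₂ := 1) (ih (n / 2) (by omega)) fun h w₁ hw₁ hh => ?_
      refine RunLe.bind (c₂ := 0) (runLe_mul hh hh) fun z w₂ hw₂ hz => ?_
      refine RunLe.pure ?_
      rwa [← pow_add, show n / 2 + n / 2 = n by omega] at hz
    · refine RunLe.bind (c₂ := 2) (ih (n / 2) (by omega)) fun h w₁ hw₁ hh => ?_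
      refine RunLe.bind (c₂ := 1) (runLe_mul hh hh) fun z w₂ hw₂ hz => ?_
      have := runLe_mul hz (ha.mono (hw₁.trans hw₂))
      rwa [← pow_add, ← pow_succ, show n / 2 + n / 2 + 1 = n by omega] at this

/-- Registers with the first natural numbers. -/
def natsC : ℕ → Comp ι (ℕ → ι ⊕ ℕ)
  | 0 => pure fun _ => zeroReg
  | n + 1 => do
      let g ← natsC n
      let x ← arithC .add (g n) oneReg
      pure (Function.update g (n + 1) x)

theorem runLe_natsC (w : World ι K) (n : ℕ) :
    RunLe w (natsC n) n fun g w' => ∀ i ≤ n, Holds w' (g i) (i : K) := by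
  induction n with
  | zero =>
    exact RunLe.pure fun i hi => by
      obtain rfl : i = 0 := by omega
      simpa using holds_zero w
  | succ n ih =>
    refine RunLe.bind (c₂ := 1) ih fun g w₁ hw₁ hg => ?_
    refine RunLe.bind (c₂ := 0) (runLe_add (hg n le_rfl) (holds_one w₁)) fun x w₂ hw₂ hx => ?_
    refine RunLe.pure fun i hi => ?_
    by_cases h : i = n + 1
    · subst h; simpa using hx
    · rw [Function.update_of_ne h]
      exact (hg i (by omega)).mono hw₂

/-- The program for the derivative of a polynomial with at most `n` coefficients. -/
def derivativeC (a : ℕ → ι ⊕ ℕ) (n : ℕ) : Comp ι (ℕ → ι ⊕ ℕ) := do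
  let c ← natsC n
  tabN (n - 1) fun i => arithC .mul (a (i + 1)) (c (i + 1))

theorem runLe_derivativeC {w : World ι K} {a : ℕ → ι ⊕ ℕ} {p : K[X]} {n : ℕ}
    (ha : Stores w a p.coeff) (hp : polyLen p ≤ n) :
    RunLe w (derivativeC a n) (2 * n) fun z w' => Stores w' z (derivative p).coeff := by
  refine RunLe.bind (c₂ := (n - 1) * 1) (runLe_natsC w n) fun c w₁ hw₁ hc => ?_
  refine runLe_tabN (fun i hi => ?_) fun i hi w₂ hw₂ => ?_
  · rw [coeff_derivative, coeff_eq_zero_of_polyLen_le hp (by omega), zero_mul]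
  · rw [coeff_derivative]
    have := runLe_mul ((ha (i + 1)).mono (hw₁.trans hw₂)) ((hc (i + 1) (by omega)).mono hw₂)
    rwa [Nat.cast_succ] at this

theorem polyLen_derivative_lt {p : K[X]} (hp : p ≠ 0) : polyLen (derivative p) < polyLen p :=
  polyLen_lt_iff_degree_lt.2 (degree_derivative_lt hp)

/-- The monic greatest common divisor, computed from the remainder of the first polynomial. -/
def gcdModC (na : ℕ) (a : ℕ → ι ⊕ ℕ) (nb : ℕ) (b : ℕ → ι ⊕ ℕ) : Comp ι (ℕ × (ℕ → ι ⊕ ℕ)) := do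
  let qr ← divModC b nb na a
  let m ← lenC qr.2 (nb - 1)
  gcdC nb b m qr.2

theorem runLe_gcdModC {w : World ι K} {na nb : ℕ} {a b : ℕ → ι ⊕ ℕ} {A B : K[X]}
    (ha : Stores w a A.coeff) (hb : Stores w b B.coeff) (hna : polyLen A ≤ na)
    (hnb : nb = polyLen B) (hB : B ≠ 0) :
    RunLe w (gcdModC na a nb b) (na * (2 + nb * 2) + (2 * nb + 16 * nb * nb)) fun r w' =>
      ∃ g, IsMonicGcd g A B ∧ r.1 = polyLen g ∧ Stores w' r.2 g.coeff := by
  have hnb0 : nb ≠ 0 := by rw [hnb, Ne, polyLen_eq_zero]; exact hB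
  refine RunLe.bind (c₂ := 2 * nb + 16 * nb * nb) (runLe_divModC hb hB hnb.symm na ha (by omega))
    (fun qr w₁ hw₁ ⟨_, h2, _, h4⟩ => ?_) le_rfl
  refine RunLe.bind (c₂ := nb + 16 * nb * nb) (runLe_lenC h2 h4) (fun m w₂ hw₂ hm => ?_)
  refine Run.mono (run_gcdC (hb.mono (hw₁.trans hw₂)) (h2.mono hw₂) hnb hm (by omega)) ?_
  rintro r w' n - ⟨g, h5, h6, h7, h8⟩
  exact ⟨⟨g, h5.mod_left, h6, h7⟩, by omega⟩

/-- The program for the squarefree part of a monic polynomial with `n` coefficients over a field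
of characteristic `p`, in which `E`-th powers are `p`-th roots. -/
def radicalC (p E : ℕ) : ℕ → ℕ → (ℕ → ι ⊕ ℕ) → Comp ι (ℕ × (ℕ → ι ⊕ ℕ))
  | 0, _, _ => pure (1, fun i => if i = 0 then oneReg else zeroReg)
  | fuel + 1, n, a =>
      if n ≤ 1 then pure (1, fun i => if i = 0 then oneReg else zeroReg)
      else do
        let d ← derivativeC a n
        let m ← lenC d (n - 1)
        if m = 0 then do
          let b ← tabN ((n - 1) / p + 1) fun j => binPowC (a (p * j)) E
          radicalC p E fuel ((n - 1) / p + 1) b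
        else do
          let c ← gcdC n a m d
          let v ← divModC c.2 c.1 (n - c.1 + 1) a
          let r ← radicalC p E fuel c.1 c.2
          let h ← gcdModC r.1 r.2 (n - c.1 + 1) v.1
          let t ← divModC h.2 h.1 (n - c.1 + 1 - h.1 + 1) v.1
          let z ← mulC r.2 r.1 t.1 (n - c.1 + 1 - h.1 + 1)
          pure (r.1 + (n - c.1 + 1 - h.1 + 1) - 1, z)

theorem polyLen_of_monic {p : K[X]} (hp : p.Monic) : polyLen p = p.natDegree + 1 :=
  polyLen_of_ne_zero hp.ne_zero

theorem polyLen_one : polyLen (1 : K[X]) = 1 := by rw [polyLen_of_monic monic_one]; simp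

-- If F' ≠ 0, the recursion goes to gcd(F, F') of degree s = d − δ, and the other work is paid by
-- 300(d² − s²) = 600sδ + 300δ². If F' = 0, then p ∣ d, so p ≤ N and E-th powers are p-th roots by
-- `hE`; the degree drops to d/p ≤ d/2, which also pays for the d/p + 1 powers at 2 log E operations
-- each.
open UniqueFactorizationMonoid Classical in
theorem runLe_radicalC {p E : ℕ} (hp : ringChar K = p) (N : ℕ)
    (hE : p = 0 ∨ N < p ∨ ∀ x : K, (x ^ E) ^ p = x) (fuel : ℕ) {w : World ι K} {n : ℕ}
    {a : ℕ → ι ⊕ ℕ} {F : K[X]} (ha : Stores w a F.coeff) (hF : F.Monic) (hn : n = polyLen F)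
    (hN : F.natDegree ≤ N) (hfuel : F.natDegree ≤ fuel) :
    RunLe w (radicalC p E fuel n a)
      (300 * F.natDegree ^ 2 + 4 * Nat.log 2 E * F.natDegree) fun r w' =>
        r.1 = polyLen (radical F) ∧ Stores w' r.2 (radical F).coeff := by
  have hbase : ∀ (F : K[X]) (w : World ι K), F.Monic → F.natDegree = 0 →
      1 = polyLen (radical F) ∧ Stores w (fun i => if i = 0 then oneReg else zeroReg)
        (radical F).coeff := by
    intro F w hF h
    rw [hF.natDegree_eq_zero.1 h, radical_one, polyLen_one]
    exact ⟨rfl, stores_one w⟩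
  induction fuel generalizing w n a F with
  | zero => exact RunLe.pure (hbase F w hF (by omega))
  | succ fuel ih =>
    have hlen := polyLen_of_monic hF
    rw [radicalC]
    split_ifs with hn1
    · exact RunLe.pure (hbase F w hF (by omega))
    obtain ⟨d, hd⟩ : ∃ d, d = F.natDegree := ⟨_, rfl⟩
    rw [← hd] at hlen hN hfuel ⊢
    have hd1 : 1 ≤ d := by omega
    refine Run.bind_le (runLe_derivativeC ha hn.ge) fun D w₁ hw₁ hD => ?_
    have hlt := polyLen_derivative_lt hF.ne_zero
    refine Run.bind_le (runLe_lenC hD (by omega)) fun m w₂ hw₂ hm => ?_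
    split_ifs with hm0
    · have hF' : derivative F = 0 := polyLen_eq_zero.1 (by omega)
      have hdvd : p ∣ d := by
        rw [← hp, ← ringChar.spec]
        have := coeff_derivative F (d - 1)
        rw [hF', coeff_zero, Nat.sub_add_cancel hd1, hd, hF.coeff_natDegree, one_mul, ← hd,
          ← Nat.cast_succ, Nat.succ_eq_add_one, Nat.sub_add_cancel hd1] at this
        exact this.symm
      have hp0 : p ≠ 0 := by rintro rfl; have := Nat.eq_zero_of_zero_dvd hdvd; omega
      have hple : p ≤ d := Nat.le_of_dvd hd1 hdvd
      replace hE : ∀ x : K, (x ^ E) ^ p = x := by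
        rcases hE with h | h | h
        · exact absurd h hp0
        · omega
        · exact h
      have : CharP K p := hp ▸ ringChar.charP K
      have hpp : p.Prime := by
        rcases CharP.char_is_prime_or_zero K p with h | h
        · exact h
        · exact absurd h hp0
      have hE0 : (0 : K) ^ E = 0 := eq_zero_of_pow_eq_zero (hE 0)
      obtain ⟨e, he⟩ : ∃ e, e = d / p := ⟨_, rfl⟩
      have hpe : p * e = d := by rw [he]; exact Nat.mul_div_cancel' hdvd
      have hn1' : (n - 1) / p + 1 = e + 1 := by rw [he]; congr 2; omega
      have h2e : 2 * e ≤ d := hpe ▸ Nat.mul_le_mul_right e hpp.two_le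
      rw [hn1']
      let R : K[X] := ∑ j ∈ Finset.range (e + 1), C (F.coeff (p * j) ^ E) * X ^ j
      have hRc : ∀ j, R.coeff j = F.coeff (p * j) ^ E := by
        intro j
        simp only [R, finsetSum_coeff, coeff_C_mul, coeff_X_pow, mul_ite, mul_one, mul_zero,
          Finset.sum_ite_eq, Finset.mem_range]
        split_ifs with hj
        · rfl
        · rw [coeff_eq_zero_of_natDegree_lt, hE0]
          rw [← hd, ← hpe]
          exact Nat.mul_lt_mul_of_pos_left (by omega) hpp.pos
      have hRe : R.coeff e = 1 := by rw [hRc, hpe, hd, hF.coeff_natDegree, one_pow]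
      have hRlen : polyLen R = e + 1 := by
        refine polyLen_eq_of_coeff_ne_zero ?_ (by rw [hRe]; exact one_ne_zero)
        rw [polyLen_le_iff, degree_lt_iff_coeff_zero]
        intro j hj
        rw [hRc, coeff_eq_zero_of_natDegree_lt, hE0]
        rw [← hd, ← hpe]
        exact Nat.mul_lt_mul_of_pos_left (by omega) hpp.pos
      have hR0 : R ≠ 0 := by rw [Ne, ← polyLen_eq_zero, hRlen]; omega
      have hRd : R.natDegree = e := by have := polyLen_of_ne_zero hR0; omega
      have hRm : R.Monic := by rw [Monic, leadingCoeff, hRd, hRe]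
      have hrad : radical R = radical F :=
        radical_eq_of_derivative_eq_zero hpp hF' fun j => by rw [hRc, hE]
      refine Run.bind_le (runLe_tabN (x := R.coeff) (c := 2 * Nat.log 2 E)
        (fun j hj => coeff_eq_zero_of_polyLen_le hRlen.le hj) fun j hj w₃ hw₃ => ?_)
        fun b w₃ hw₃ hb => ?_
      · rw [hRc]
        exact runLe_binPowC ((ha _).mono (hw₁.trans (hw₂.trans hw₃))) E
      refine Run.mono (ih hb hRm hRlen.symm (by omega) (by omega)) ?_
      rintro r w' n₄ - ⟨hr, hn₄⟩ n₃ hn₃ n₂ hn₂ n₁ hn₁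
      rw [hrad] at hr
      refine ⟨hr, ?_⟩
      rw [hRd] at hn₄
      have e1 : Nat.log 2 E * (2 * e) ≤ Nat.log 2 E * d := Nat.mul_le_mul_left _ h2e
      have e2 : Nat.log 2 E * 2 ≤ Nat.log 2 E * d :=
        Nat.mul_le_mul_left _ (hpp.two_le.trans hple)
      have e3 : (2 * e) ^ 2 ≤ d ^ 2 := Nat.pow_le_pow_left h2e 2
      have e4 : d ≤ d ^ 2 := Nat.le_self_pow two_ne_zero d
      generalize Nat.log 2 E = L at *
      have e5 : (2 * e) ^ 2 = 4 * e ^ 2 := by ring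
      have e6 : (e + 1) * (2 * L) = 2 * (L * e) + 2 * L := by ring
      have e7 : 4 * L * e = 4 * (L * e) := by ring
      have e8 : 4 * L * d = 4 * (L * d) := by ring
      have e9 : L * (2 * e) = 2 * (L * e) := by ring
      omega
    · have hw₀ := hw₁.trans hw₂
      refine Run.bind (run_gcdC (ha.mono hw₀) (hD.mono hw₂) hn hm hlt) fun c w₃ n₃ hw₃ hc => ?_
      obtain ⟨G, hG, hc1, hc2, hcost⟩ := hc
      have hG0 := hG.monic.ne_zero
      obtain ⟨s, hs⟩ : ∃ s, s = G.natDegree := ⟨_, rfl⟩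
      have hGlen := polyLen_of_monic hG.monic
      have hF'0 : derivative F ≠ 0 := by
        rw [Ne, ← polyLen_eq_zero]; omega
      have hsd : s < d := by
        have h1 := natDegree_le_of_dvd hG.dvd_right hF'0
        have h2 := polyLen_of_ne_zero hF'0
        omega
      obtain ⟨δ, hδ⟩ : ∃ δ, d = s + δ := ⟨d - s, by omega⟩
      rw [show n - c.1 + 1 = δ + 1 by omega]
      obtain ⟨V, hV⟩ : ∃ V, F / G = V := ⟨_, rfl⟩
      have hVG : V * G = F := by
        rw [← hV, mul_comm]; exact EuclideanDomain.mul_div_cancel' hG0 hG.dvd_left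
      have hVm : V.Monic := by rw [← hVG] at hF; exact hG.monic.of_mul_monic_right hF
      have hVlen : polyLen V = δ + 1 := by
        have := hVm.natDegree_mul hG.monic
        rw [hVG] at this
        rw [polyLen_of_monic hVm]; omega
      refine Run.bind_le (runLe_divModC hc2 hG0 hc1.symm (δ + 1) (ha.mono (hw₀.trans hw₃))
        (by omega)) fun v w₄ hw₄ hv => ?_
      rw [hV] at hv
      refine Run.bind_le (ih (hc2.mono hw₄) hG.monic hc1 (by omega) (by omega))
        fun r w₅ hw₅ hr => ?_
      have hradd : (radical G).natDegree ≤ s :=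
        hs ▸ natDegree_le_of_dvd radical_dvd_self hG0
      have hradm := monic_radical G
      have hradlen := polyLen_of_monic hradm
      refine Run.bind_le (runLe_gcdModC hr.2 (hv.1.mono hw₅) hr.1.ge hVlen.symm hVm.ne_zero)
        fun h w₆ hw₆ hh => ?_
      obtain ⟨H, hH, hh1, hh2⟩ := hh
      have hHlen := polyLen_of_monic hH.monic
      have hHV : H.natDegree ≤ δ := by
        have h1 := natDegree_le_of_dvd hH.dvd_right hVm.ne_zero
        have h2 := polyLen_of_monic hVm
        omega
      obtain ⟨U, hU⟩ : ∃ U, V / H = U := ⟨_, rfl⟩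
      have hHU : H * U = V := by
        rw [← hU]; exact EuclideanDomain.mul_div_cancel' hH.monic.ne_zero hH.dvd_right
      have hUm : U.Monic := hH.monic.of_mul_monic_left (hHU ▸ hVm)
      obtain ⟨y, hy⟩ : ∃ y, y = δ + 1 - h.1 + 1 := ⟨_, rfl⟩
      have hUlen : polyLen U = y := by
        have h1 := hH.monic.natDegree_mul hUm
        rw [hHU] at h1
        have h2 := polyLen_of_monic hVm
        rw [polyLen_of_monic hUm]; omega
      rw [← hy]
      refine Run.bind_le (runLe_divModC hh2 hH.monic.ne_zero hh1.symm y
        (hv.1.mono (hw₅.trans hw₆)) (by omega)) fun t w₇ hw₇ ht => ?_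
      rw [hU] at ht
      refine Run.bind_le (runLe_mulC (hr.2.mono (hw₆.trans hw₇)) ht.1 hr.1.ge hUlen.le)
        fun z w₈ hw₈ hz => ?_
      have hrad := radical_eq_mul hF hG hVG hH hHU
      refine Run.pure fun n₈ hn₈ n₇ hn₇ n₆ hn₆ n₅ hn₅ n₄ hn₄ n₂ hn₂ n₁ hn₁ =>
        ⟨⟨?_, by rwa [hrad] at hz⟩, ?_⟩
      · rw [← hrad, polyLen_of_monic (hradm.mul hUm), hradm.natDegree_mul hUm]
        have := polyLen_of_monic hUm
        have := hr.1
        dsimp only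
        omega
      · rw [← hs] at hGlen hn₅
        have hr1 : r.1 ≤ s + 1 := by omega
        have hh1' : h.1 ≤ δ + 1 := by omega
        have hy1 : y ≤ δ + 1 := by omega
        have hnn : n = s + δ + 1 := by omega
        have hcc : c.1 = s + 1 := by omega
        have e1 : r.1 * (2 + (δ + 1) * 2) ≤ (s + 1) * (2 + (δ + 1) * 2) :=
          Nat.mul_le_mul_right _ hr1
        have e2 : y * (2 + h.1 * 2) ≤ (δ + 1) * (2 + (δ + 1) * 2) :=
          Nat.mul_le_mul hy1 (by omega)
        have e3 : r.1 * (y * 2) ≤ (s + 1) * ((δ + 1) * 2) := Nat.mul_le_mul hr1 (by omega)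
        have e4 : s * 1 ≤ s * δ := Nat.mul_le_mul_left _ (by omega)
        have e5 : δ * 1 ≤ δ * δ := Nat.mul_le_mul_left _ (by omega)
        have e6 : Nat.log 2 E * s ≤ Nat.log 2 E * d := Nat.mul_le_mul_left _ hsd.le
        rw [hnn, hcc] at hcost
        rw [hcc] at hn₄
        generalize Nat.log 2 E = L at *
        have f1 : (s + 1) * (2 + (δ + 1) * 2) = 2 * (s * δ) + 4 * s + 2 * δ + 4 := by ring
        have f2 : (δ + 1) * (2 + (δ + 1) * 2) = 2 * (δ * δ) + 6 * δ + 4 := by ring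
        have f3 : (s + 1) * ((δ + 1) * 2) = 2 * (s * δ) + 2 * s + 2 * δ + 2 := by ring
        have f4 : (δ + 1) * (2 + (s + 1) * 2) = 2 * (s * δ) + 4 * δ + 2 * s + 4 := by ring
        have f5 : 16 * (δ + 1) * (δ + 1) = 16 * (δ * δ) + 32 * δ + 16 := by ring
        have f6 : 16 * (s + δ + 1) * (s + δ + 1)
            = 16 * (s + δ + 1) * (s + 1) + 16 * (s * δ) + 16 * (δ * δ) + 16 * δ := by ring
        have f7 : 300 * d ^ 2 = 300 * s ^ 2 + 600 * (s * δ) + 300 * (δ * δ) := by rw [hδ]; ring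
        have f8 : 4 * L * s = 4 * (L * s) := by ring
        have f9 : 4 * L * d = 4 * (L * d) := by ring
        rw [f7, f9]
        omega

end RadicalProgram

/-! ## Minimal polynomials and Hankel systems by the Euclidean algorithm -/

section HankelSolution

variable {K : Type u} [Field K]

/-- With S the reversed sequence, this coefficient pairs the l-th coefficient of V with the term of
index a + l. Recurrences thus become vanishing coefficients of V·S, the form in which the Euclidean
algorithm finds them. -/
theorem coeff_mul_reverse {L : K[X] →ₗ[K] K} {N : ℕ} {S : K[X]}
    (hS : ∀ i < N, S.coeff i = L (X ^ (N - 1 - i))) {V : K[X]} {a : ℕ} (h : V.natDegree + a < N) :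
    (V * S).coeff (N - 1 - a) = L (X ^ a * V) := by
  conv_lhs => rw [V.as_sum_range_C_mul_X_pow]
  conv_rhs => rw [V.as_sum_range_C_mul_X_pow]
  rw [Finset.sum_mul, finsetSum_coeff, Finset.mul_sum, map_sum]
  refine Finset.sum_congr rfl fun l hl => ?_
  have hl' : l ≤ V.natDegree := Nat.lt_succ_iff.1 (Finset.mem_range.1 hl)
  rw [mul_assoc, coeff_C_mul, coeff_X_pow_mul', if_pos (by omega), hS _ (by omega), mul_left_comm,
    ← pow_add, ← smul_eq_C_mul, map_smul, smul_eq_mul]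
  congr 3
  omega

theorem coeff_eq_of_eq_mul_X_pow_add {p q u : K[X]} {N i : ℕ} (h : p = u * X ^ N + q)
    (hi : i < N) : p.coeff i = q.coeff i := by
  rw [h, coeff_add, coeff_mul_X_pow', if_neg (by omega), zero_add]

/-- Berlekamp–Massey by the Euclidean algorithm for X^(2M) and S. From V₁S ≡ R₁ modulo X^(2M) with
R₁ short it follows that L(X^a V₁) = 0 for a < M, so V₁ = gc. It remains to see that c is a
constant. -/
theorem IsAnnihilator.eq_of_isEuclidPair {L : K[X] →ₗ[K] K} {g : K[X]} (h : IsAnnihilator L g)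
    {M : ℕ} (hM : g.natDegree ≤ M) {S R₀ R₁ V₀ V₁ : K[X]}
    (hS : ∀ i < 2 * M, S.coeff i = L (X ^ (2 * M - 1 - i)))
    (hE : IsEuclidPair (X ^ (2 * M)) S R₀ R₁ V₀ V₁) (hR₀ : M < polyLen R₀)
    (hR₁ : polyLen R₁ ≤ M) : C V₁.leadingCoeff⁻¹ * V₁ = g := by
  obtain ⟨⟨U₀, U₁, h0, h1, hU⟩, -, hV, hlen⟩ := hE
  have hA : polyLen (X ^ (2 * M) : K[X]) = 2 * M + 1 := by
    rw [polyLen_of_monic (monic_X_pow _), natDegree_X_pow]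
  have hV1 : V₁ ≠ 0 := by rintro rfl; simp [polyLen_zero] at hV
  have hV1d : V₁.natDegree ≤ M := by have := polyLen_of_ne_zero hV1; omega
  have hdvd : g ∣ V₁ := by
    refine h.dvd_of_forall_lt fun a ha => ?_
    rw [← coeff_mul_reverse hS (by omega),
      coeff_eq_of_eq_mul_X_pow_add (N := 2 * M) (u := -U₁) (q := R₁) (by rw [h1]; ring) (by omega)]
    exact coeff_eq_zero_of_polyLen_le hR₁ (by omega)
  obtain ⟨c, hc⟩ := hdvd
  have hc0 : c ≠ 0 := by rintro rfl; exact hV1 (by rw [hc, mul_zero])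
  have hdeg : V₁.natDegree = g.natDegree + c.natDegree := by
    rw [hc, natDegree_mul h.monic.ne_zero hc0]
  -- Modulo X^(2M), the coefficients of gS from index deg g on are values L(X^b g) = 0.
  obtain ⟨y, r, hyr, hr⟩ : ∃ y r : K[X], g * S = y * X ^ (2 * M) + r ∧ polyLen r ≤ g.natDegree := by
    refine ⟨(g * S) /ₘ X ^ (2 * M), (g * S) %ₘ X ^ (2 * M), ?_, ?_⟩
    · conv_lhs => rw [← modByMonic_add_div (g * S) (X ^ (2 * M))]
      ring
    · rw [polyLen_le_iff, degree_lt_iff_coeff_zero]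
      intro i hi
      by_cases hi' : i < 2 * M
      · have h2 : (g * S).coeff i = ((g * S) %ₘ X ^ (2 * M)).coeff i := by
          refine coeff_eq_of_eq_mul_X_pow_add (u := (g * S) /ₘ X ^ (2 * M)) ?_ hi'
          conv_lhs => rw [← modByMonic_add_div (g * S) (X ^ (2 * M))]
          ring
        rw [← h2, show i = 2 * M - 1 - (2 * M - 1 - i) by omega, coeff_mul_reverse hS (by omega)]
        exact (h.dvd_iff g).1 dvd_rfl _
      · refine coeff_eq_zero_of_degree_lt ((degree_modByMonic_lt _ (monic_X_pow _)).trans_le ?_)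
        rw [degree_X_pow]
        exact_mod_cast not_lt.1 hi'
  have hcr : polyLen (c * r) ≤ M := by
    by_cases hr0 : r = 0
    · simp [hr0, polyLen_zero]
    · have h2 := polyLen_of_ne_zero hr0
      rw [polyLen_of_ne_zero (mul_ne_zero hc0 hr0), natDegree_mul hc0 hr0]
      omega
  have hkey : X ^ (2 * M) * (U₁ + c * y) = R₁ - c * r := by
    rw [h1, hc]; linear_combination c * (-hyr)
  have hz : U₁ + c * y = 0 := by
    by_contra hne
    have h2 : (R₁ - c * r).degree < (X ^ (2 * M) : K[X]).degree := by
      rw [degree_X_pow]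
      refine (degree_sub_le _ _).trans_lt (max_lt ?_ ?_)
      · exact polyLen_le_iff.1 (hR₁.trans (by omega))
      · exact polyLen_le_iff.1 (hcr.trans (by omega))
    have h3 := eq_zero_of_dvd_of_degree_lt ⟨_, hkey.symm⟩ h2
    rw [h3] at hkey
    exact (mul_ne_zero (monic_X_pow _).ne_zero hne) hkey
  -- Since V₁ = gc and U₁ = −cy, the polynomial c divides the determinant U₀V₁ − U₁V₀, a unit.
  have hcu : IsUnit c := by
    refine isUnit_of_dvd_unit ⟨U₀ * g + y * V₀, ?_⟩ hU
    linear_combination U₀ * hc - V₀ * hz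
  obtain ⟨γ, hγ, rfl⟩ := Polynomial.isUnit_iff.1 hcu
  have hγ0 : γ ≠ 0 := hγ.ne_zero
  rw [hc, leadingCoeff_mul, h.monic.leadingCoeff, leadingCoeff_C, one_mul, mul_left_comm, ← C_mul,
    inv_mul_cancel₀ hγ0, C_1, mul_one]

/-- L(X^a V₀) is the coefficient of X^(2M−1−a) in R₀, whose degree is 2M − deg g: zero for a < deg g
− 1 and the leading coefficient for a = deg g − 1. The normalized V₀ is the last column of the
inverse Hankel matrix. -/
theorem IsAnnihilator.map_mul_cofactor {L : K[X] →ₗ[K] K} {g : K[X]} (h : IsAnnihilator L g)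
    {M : ℕ} (hM : g.natDegree ≤ M) {S R₀ R₁ V₀ V₁ : K[X]}
    (hS : ∀ i < 2 * M, S.coeff i = L (X ^ (2 * M - 1 - i)))
    (hE : IsEuclidPair (X ^ (2 * M)) S R₀ R₁ V₀ V₁) (hR₀ : M < polyLen R₀)
    (hR₁ : polyLen R₁ ≤ M) {a : ℕ} (ha : a < g.natDegree) :
    L (X ^ a * (C R₀.leadingCoeff⁻¹ * V₀)) = if a + 1 = g.natDegree then 1 else 0 := by
  have hg := h.eq_of_isEuclidPair hM hS hE hR₀ hR₁
  obtain ⟨⟨U₀, U₁, h0, h1, hU⟩, -, hV, hlen⟩ := hE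
  have hA : polyLen (X ^ (2 * M) : K[X]) = 2 * M + 1 := by
    rw [polyLen_of_monic (monic_X_pow _), natDegree_X_pow]
  have hV1 : V₁ ≠ 0 := by rintro rfl; simp [polyLen_zero] at hV
  have hV1len : polyLen V₁ = g.natDegree + 1 := by
    rw [← polyLen_of_monic h.monic, ← hg,
      polyLen_C_mul (inv_ne_zero (leadingCoeff_ne_zero.2 hV1))]
  have hR00 : R₀ ≠ 0 := by rintro rfl; simp [polyLen_zero] at hR₀
  have hV0d : V₀.natDegree < g.natDegree := by
    by_cases h2 : V₀ = 0
    · rw [h2, natDegree_zero]; omega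
    · have := polyLen_of_ne_zero h2; omega
  have h2 : L (X ^ a * V₀) = R₀.coeff (2 * M - 1 - a) := by
    rw [← coeff_mul_reverse hS (by omega)]
    exact coeff_eq_of_eq_mul_X_pow_add (N := 2 * M) (u := -U₀) (by rw [h0]; ring) (by omega)
  rw [mul_left_comm, ← smul_eq_C_mul, map_smul, h2, smul_eq_mul]
  split_ifs with h3
  · rw [show 2 * M - 1 - a = polyLen R₀ - 1 by omega, coeff_polyLen_sub_one hR00,
      inv_mul_cancel₀ (leadingCoeff_ne_zero.2 hR00)]
  · rw [coeff_eq_zero_of_polyLen_le le_rfl (by omega), mul_zero]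

theorem coeff_sum_range_C_mul_X_pow (c : ℕ → K) (n i : ℕ) :
    (∑ j ∈ Finset.range n, C (c j) * X ^ j).coeff i = if i < n then c i else 0 := by
  simp only [finsetSum_coeff, coeff_C_mul, coeff_X_pow, mul_ite, mul_one, mul_zero,
    Finset.sum_ite_eq, Finset.mem_range]

theorem degree_sum_range_C_mul_X_pow_lt (c : ℕ → K) (n : ℕ) :
    (∑ j ∈ Finset.range n, C (c j) * X ^ j).degree < (n : WithBot ℕ) := by
  rw [degree_lt_iff_coeff_zero]
  intro i hi
  rw [coeff_sum_range_C_mul_X_pow, if_neg (by omega)]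

/-- On degrees below l = deg g, p ↦ L(pz) is the coefficient of X^(l−1). For this functional the
quotients B_a of g by X^(a+1) are dual to the powers X^c. With N = ∑ L(X^a R) B_a therefore L(X^c N
z) = L(X^c R) for all c < l, so Nz ≡ R modulo g. -/
theorem IsAnnihilator.hankel_solution {L : K[X] →ₗ[K] K} {g z : K[X]} (h : IsAnnihilator L g)
    (hz : ∀ a < g.natDegree, L (X ^ a * z) = if a + 1 = g.natDegree then 1 else 0) (R N : K[X])
    (hN : ∀ i, N.coeff i = ∑ a ∈ Finset.range g.natDegree, L (X ^ a * R) * g.coeff (i + a + 1)) :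
    N * z %ₘ g = R %ₘ g := by
  obtain ⟨l, hl⟩ : ∃ l, l = g.natDegree := ⟨_, rfl⟩
  rw [← hl] at hz hN
  have hgl : g.coeff l = 1 := by rw [hl]; exact h.monic.coeff_natDegree
  have hgt : ∀ i, l < i → g.coeff i = 0 := fun i hi =>
    coeff_eq_zero_of_natDegree_lt (by omega)
  have hlow : ∀ p : K[X], p.degree < (l : WithBot ℕ) → L (p * z) = p.coeff (l - 1) := by
    intro p hp
    conv_lhs => rw [eq_sum_range_of_degree_lt hp, Finset.sum_mul, map_sum]
    have h1 : ∀ i ∈ Finset.range l, L (C (p.coeff i) * X ^ i * z)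
        = if i = l - 1 then p.coeff i else 0 := by
      intro i hi
      rw [Finset.mem_range] at hi
      rw [mul_assoc, ← smul_eq_C_mul, map_smul, hz i hi, smul_eq_mul]
      by_cases h2 : i = l - 1
      · rw [if_pos h2, if_pos (by omega), mul_one]
      · rw [if_neg h2, if_neg (by omega), mul_zero]
    rw [Finset.sum_congr rfl h1, Finset.sum_ite_eq']
    split_ifs with h2
    · rfl
    · rw [Finset.mem_range] at h2
      obtain rfl : l = 0 := by omega
      exact (coeff_eq_zero_of_degree_lt (hp.trans_le (by simp))).symm
  let B : ℕ → K[X] := fun a => ∑ i ∈ Finset.range l, C (g.coeff (i + a + 1)) * X ^ i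
  have hBc : ∀ a i, (B a).coeff i = g.coeff (i + a + 1) := by
    intro a i
    simp only [B]
    rw [coeff_sum_range_C_mul_X_pow]
    split_ifs with h1
    · rfl
    · exact (hgt _ (by omega)).symm
  have hB : ∀ c < l, ∀ a < l, L (X ^ c * B a * z) = if a = c then 1 else 0 := by
    intro c hc a ha
    rcases Nat.lt_or_ge a c with hac | hac
    -- For a < c the degree of X^c B_a is too large. As X^(a+1) B_a = g − low and multiples of g
    -- contribute nothing, it is replaced by −X^(c−a−1) low, of degree at most c − 1 < l − 1.
    · let low : K[X] := ∑ i ∈ Finset.range (a + 1), C (g.coeff i) * X ^ i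
      have hlowd : low.degree < ((a + 1 : ℕ) : WithBot ℕ) := degree_sum_range_C_mul_X_pow_lt _ _
      have hsplit : X ^ (a + 1) * B a = g - low := by
        ext i
        rw [coeff_X_pow_mul', hBc, coeff_sub, coeff_sum_range_C_mul_X_pow]
        split_ifs with h1 h2 h2
        · omega
        · rw [sub_zero]; congr 1; omega
        · rw [sub_self]
        · omega
      have h1 : X ^ c * B a * z = (X ^ (c - a - 1) * z) * g - (X ^ (c - a - 1) * low) * z := by
        have : (X : K[X]) ^ c = X ^ (c - a - 1) * X ^ (a + 1) := by
          rw [← pow_add]; congr 1; omega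
        rw [this]; linear_combination X ^ (c - a - 1) * z * hsplit
      have h2 : (X ^ (c - a - 1) * low).coeff (l - 1) = 0 := by
        rw [coeff_X_pow_mul']
        split_ifs
        · exact coeff_eq_zero_of_degree_lt (hlowd.trans_le (by exact_mod_cast (by omega)))
        · rfl
      have h3 : (X ^ (c - a - 1) * low).degree < (l : WithBot ℕ) := by
        rw [degree_lt_iff_coeff_zero]
        intro i hi
        rw [coeff_X_pow_mul']
        split_ifs
        · exact coeff_eq_zero_of_degree_lt (hlowd.trans_le (by exact_mod_cast (by omega)))
        · rfl
      rw [h1, map_sub, (h.dvd_iff g).1 dvd_rfl, hlow _ h3, h2, sub_zero, if_neg (by omega)]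
    · have h3 : (X ^ c * B a).degree < (l : WithBot ℕ) := by
        rw [degree_lt_iff_coeff_zero]
        intro i hi
        rw [coeff_X_pow_mul']
        split_ifs
        · rw [hBc]; exact hgt _ (by omega)
        · rfl
      rw [hlow _ h3, coeff_X_pow_mul', if_pos (by omega), hBc]
      split_ifs with h4
      · rw [← hgl]; congr 1; omega
      · exact hgt _ (by omega)
  have hNB : N = ∑ a ∈ Finset.range l, C (L (X ^ a * R)) * B a := by
    ext i
    rw [hN, finsetSum_coeff]
    refine Finset.sum_congr rfl fun a _ => ?_
    rw [coeff_C_mul, hBc]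
  refine modByMonic_eq_of_dvd_sub h.monic (h.dvd_of_forall_lt fun c hc => ?_)
  rw [← hl] at hc
  rw [mul_sub, map_sub, sub_eq_zero, hNB, Finset.sum_mul, Finset.mul_sum, map_sum]
  have h1 : ∀ a ∈ Finset.range l, L (X ^ c * (C (L (X ^ a * R)) * B a * z))
      = if a = c then L (X ^ a * R) else 0 := by
    intro a ha
    rw [Finset.mem_range] at ha
    rw [show X ^ c * (C (L (X ^ a * R)) * B a * z) = C (L (X ^ a * R)) * (X ^ c * B a * z) by ring,
      ← smul_eq_C_mul, map_smul, hB c hc a ha, smul_eq_mul, mul_ite, mul_one, mul_zero]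
  rw [Finset.sum_congr rfl h1, Finset.sum_ite_eq', if_pos (Finset.mem_range.2 hc)]

end HankelSolution

/-! ## Programs for vectors -/

section VectorPrograms

variable {K : Type u} [Field K] {ι : Type} {D m : ℕ}

/-- The product of a sparse matrix and a vector. -/
def matVecC (S : Finset (Fin D × Fin D)) (τ : Fin D → Fin D → ι ⊕ ℕ) (x : Fin D → ι ⊕ ℕ) :
    Comp ι (Fin D → ι ⊕ ℕ) :=
  tab zeroReg (fun i => sumC (fun j => arithC .mul (τ i j) (x j))
    (Finset.univ.filter fun j => (i, j) ∈ S).toList) (List.finRange D)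

theorem runLe_matVecC {w : World ι K} {S : Finset (Fin D × Fin D)} {τ : Fin D → Fin D → ι ⊕ ℕ}
    {M : Matrix (Fin D) (Fin D) K} {a : Fin D → ι ⊕ ℕ} {x : Fin D → K}
    (hτ : ∀ i j, Holds w (τ i j) (M i j)) (hS : ∀ i j, (i, j) ∉ S → M i j = 0)
    (ha : Stores w a x) :
    RunLe w (matVecC S τ a) (2 * S.card) fun z w' => Stores w' z (M *ᵥ x) := by
  have h1 : ((List.finRange D).map fun i =>
      (Finset.univ.filter fun j => (i, j) ∈ S).card * (1 + 1)).sum = 2 * S.card := by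
    have h2 : S.card = ∑ i, (Finset.univ.filter fun j => (i, j) ∈ S).card := by
      rw [Finset.card_eq_sum_card_fiberwise (f := Prod.fst) (t := Finset.univ) (by simp)]
      refine Finset.sum_congr rfl fun i _ => ?_
      refine (Finset.card_nbij' (fun j => (i, j)) Prod.snd ?_ ?_ ?_ ?_).symm
      · intro j hj; simpa using hj
      · rintro ⟨i', j⟩ hj
        simp only [Finset.coe_filter, Set.mem_ofPred_eq] at hj
        obtain ⟨h3, rfl⟩ := hj
        simpa using h3
      · intro j _; rfl
      · rintro ⟨i', j⟩ hj
        simp only [Finset.coe_filter, Set.mem_ofPred_eq] at hj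
        rw [← hj.2]
    rw [h2, Finset.mul_sum, ← List.ofFn_eq_map, List.sum_ofFn]
    exact Finset.sum_congr rfl fun i _ => mul_comm _ _
  rw [← h1]
  refine runLe_tab (P := fun i r w' => Holds w' r ((M *ᵥ x) i)) (fun _ _ _ _ h h' => h'.mono h)
    (fun k _ _ hk => absurd (List.mem_finRange k) hk) fun i _ w₁ hw₁ => ?_
  have h2 : (M *ᵥ x) i = ∑ j ∈ Finset.univ.filter fun j => (i, j) ∈ S, M i j * x j := by
    rw [mulVec, dotProduct, Finset.sum_filter]
    refine Finset.sum_congr rfl fun j _ => ?_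
    split_ifs with h
    · rfl
    · rw [hS i j h, zero_mul]
  rw [h2]
  exact runLe_sumC_finset fun j _ w₂ hw₂ =>
    runLe_mul ((hτ i j).mono (hw₁.trans hw₂)) ((ha j).mono (hw₁.trans hw₂))

/-- The vectors `x, M x, …, M ^ n x`. -/
def krylovC (S : Finset (Fin D × Fin D)) (τ : Fin D → Fin D → ι ⊕ ℕ) (x : Fin D → ι ⊕ ℕ) :
    ℕ → Comp ι (ℕ → Fin D → ι ⊕ ℕ)
  | 0 => pure fun _ => x
  | n + 1 => do
      let g ← krylovC S τ x n
      let y ← matVecC S τ (g n)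
      pure (Function.update g (n + 1) y)

theorem runLe_krylovC {w : World ι K} {S : Finset (Fin D × Fin D)} {τ : Fin D → Fin D → ι ⊕ ℕ}
    {M : Matrix (Fin D) (Fin D) K} {a : Fin D → ι ⊕ ℕ} {x : Fin D → K}
    (hτ : ∀ i j, Holds w (τ i j) (M i j)) (hS : ∀ i j, (i, j) ∉ S → M i j = 0)
    (ha : Stores w a x) (n : ℕ) :
    RunLe w (krylovC S τ a n) (n * (2 * S.card)) fun g w' =>
      ∀ i ≤ n, Stores w' (g i) (M ^ i *ᵥ x) := by
  induction n with
  | zero =>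
    exact RunLe.pure fun i hi => by
      obtain rfl : i = 0 := by omega
      simpa using ha
  | succ n ih =>
    refine RunLe.bind (c₂ := 2 * S.card) ih (fun g w₁ hw₁ hg => ?_) (by rw [add_mul, one_mul])
    refine RunLe.bind (c₂ := 0) (runLe_matVecC (fun i j => (hτ i j).mono hw₁) hS (hg n le_rfl))
      fun y w₂ hw₂ hy => ?_
    refine RunLe.pure fun i hi => ?_
    by_cases h : i = n + 1
    · subst h
      rw [Function.update_self, pow_succ', ← mulVec_mulVec]
      exact hy
    · rw [Function.update_of_ne h]
      exact (hg i (by omega)).mono hw₂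

/-- A linear combination of `n` vectors. -/
def linCombC (n : ℕ) (c : ℕ → ι ⊕ ℕ) (g : ℕ → Fin D → ι ⊕ ℕ) : Comp ι (Fin D → ι ⊕ ℕ) :=
  tabFin D zeroReg fun r => sumC (fun i => arithC .mul (c i) (g i r)) (List.range n)

theorem runLe_linCombC {w : World ι K} {n : ℕ} {c : ℕ → ι ⊕ ℕ} {g : ℕ → Fin D → ι ⊕ ℕ}
    {T : Matrix (Fin D) (Fin D) K} {b : Fin D → K} {p : K[X]} (hc : Stores w c p.coeff)
    (hp : polyLen p ≤ n) (hg : ∀ i < n, Stores w (g i) (T ^ i *ᵥ b)) :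
    RunLe w (linCombC n c g) (D * (n * 2)) fun z w' => Stores w' z (aeval T p *ᵥ b) := by
  refine runLe_tabFin (P := fun r z w' => Holds w' z ((aeval T p *ᵥ b) r))
    (fun _ _ _ _ h h' => h'.mono h) fun r w₁ hw₁ => ?_
  have h1 : (aeval T p *ᵥ b) r = ∑ i ∈ Finset.range n, p.coeff i * (T ^ i *ᵥ b) r := by
    conv_lhs => rw [eq_sum_range_of_degree_lt (polyLen_le_iff.1 hp)]
    rw [map_sum, sum_mulVec, Finset.sum_apply]
    refine Finset.sum_congr rfl fun i _ => ?_
    rw [← smul_eq_C_mul, map_smul, smul_mulVec, map_pow, aeval_X]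
    rfl
  rw [h1]
  exact runLe_sumC_range fun i hi w₂ hw₂ =>
    runLe_mul ((hc i).mono (hw₁.trans hw₂)) ((hg i hi r).mono (hw₁.trans hw₂))

/-- The difference of two vectors. -/
def vecSubC (a b : Fin D → ι ⊕ ℕ) : Comp ι (Fin D → ι ⊕ ℕ) :=
  tabFin D zeroReg fun r => arithC .sub (a r) (b r)

theorem runLe_vecSubC {w : World ι K} {a b : Fin D → ι ⊕ ℕ} {x y : Fin D → K}
    (ha : Stores w a x) (hb : Stores w b y) :
    RunLe w (vecSubC a b) D fun z w' => Stores w' z (x - y) := by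
  have := runLe_tabFin (w := w) (N := D) (c := 1) (d := zeroReg)
    (f := fun r => arithC .sub (a r) (b r)) (P := fun r z w' => Holds w' z ((x - y) r))
    (fun _ _ _ _ h h' => h'.mono h)
    fun r w₁ hw₁ => runLe_sub ((ha r).mono hw₁) ((hb r).mono hw₁)
  rwa [mul_one] at this

/-- The inner product of two vectors. -/
def dotC (a b : Fin D → ι ⊕ ℕ) : Comp ι (ι ⊕ ℕ) :=
  sumC (fun r => arithC .mul (a r) (b r)) (List.finRange D)

theorem runLe_dotC {w : World ι K} {a b : Fin D → ι ⊕ ℕ} {x y : Fin D → K}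
    (ha : Stores w a x) (hb : Stores w b y) :
    RunLe w (dotC a b) (D * 2) fun z w' => Holds w' z (x ⬝ᵥ y) := by
  have := runLe_sumC (w := w) (f := fun r => arithC .mul (a r) (b r)) (l := List.finRange D)
    (c := 1) (x := fun r => x r * y r)
    fun r _ w₁ hw₁ => runLe_mul ((ha r).mono hw₁) ((hb r).mono hw₁)
  rw [List.length_finRange, ← List.ofFn_eq_map, List.sum_ofFn] at this
  exact this

end VectorPrograms

/-! ## A round of the Wiedemann algorithm -/

section Round

variable {K : Type u} [Field K] {ι : Type} {D m : ℕ}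

/-- The state between two rounds: the product of the factors found so far, the vector `b`, the
interpolating polynomials modulo this product, and the remaining vectors. -/
structure RoundState (ι : Type) (D m : ℕ) where
  /-- the degree of the product of the factors -/
  d : ℕ
  /-- the product of the factors -/
  f : ℕ → ι ⊕ ℕ
  /-- the vector `b` -/
  b : Fin D → ι ⊕ ℕ
  /-- the interpolating polynomials -/
  H : Fin m → ℕ → ι ⊕ ℕ
  /-- the remaining vectors -/
  res : Fin m → Fin D → ι ⊕ ℕ

/-- The state contains the data that belong to `f`. -/
structure RoundState.Stores (w : World ι K) (s : RoundState ι D m) (T : Matrix (Fin D) (Fin D) K)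
    (e : Fin D → K) (H : Fin m → K[X]) (f : K[X]) : Prop where
  d_eq : s.d = f.natDegree
  f_stores : _root_.Stores w s.f f.coeff
  b_stores : _root_.Stores w s.b (aeval T f *ᵥ e)
  H_stores : ∀ j, _root_.Stores w (s.H j) (H j %ₘ f).coeff
  res_stores : ∀ j, _root_.Stores w (s.res j) (aeval T (f * (H j /ₘ f)) *ᵥ e)

/-- The minimal polynomial of a Krylov sequence and the inverse of its numerator, from the
product of `f` with the reversed Krylov sequence of `e`. The result is the number of coefficients
of the minimal polynomial with the two polynomials. -/
def minpolyC (mul : (ℕ → ι ⊕ ℕ) → (ℕ → ι ⊕ ℕ) → Comp ι (ℕ → ι ⊕ ℕ)) (D d : ℕ)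
    (f : ℕ → ι ⊕ ℕ) (t : ℕ → ι ⊕ ℕ) : Comp ι (ℕ × (ℕ → ι ⊕ ℕ) × (ℕ → ι ⊕ ℕ)) := do
  let P ← mul f fun i => if i < 2 * (D - d) + d then t (2 * (D - d) + d - 1 - i) else zeroReg
  let n ← lenC (fun i => if i < 2 * (D - d) then P (d + i) else zeroReg) (2 * (D - d))
  let E ← euclidC (D - d) n ⟨2 * (D - d) + 1,
    fun i => if i = 2 * (D - d) then oneReg else zeroReg, n,
    fun i => if i < 2 * (D - d) then P (d + i) else zeroReg, fun _ => zeroReg,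
    fun i => if i = 0 then oneReg else zeroReg, 1⟩
  let g ← divScalarC E.v₁ E.l₁ (E.v₁ (E.l₁ - 1))
  let z ← divScalarC E.v₀ E.l₁ (E.a₀ (E.n₀ - 1))
  pure (E.l₁, g, z)

/-- `mul` multiplies polynomials with at most `n` coefficients with at most `c` operations. -/
def ComputesProduct (K : Type u) [Field K] (n c : ℕ)
    (mul : (ℕ → ι ⊕ ℕ) → (ℕ → ι ⊕ ℕ) → Comp ι (ℕ → ι ⊕ ℕ)) : Prop :=
  ∀ (w : World ι K) (a b : ℕ → ι ⊕ ℕ) (f g : K[X]), Stores w a f.coeff → Stores w b g.coeff →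
    polyLen f ≤ n → polyLen g ≤ n → polyLen (f * g) ≤ n →
    RunLe w (mul a b) c fun z w' => Stores w' z (f * g).coeff

/-- The sequence of b = f(T)e costs no products with T: its terms L(X^i f) are coefficients of f
times the reversed sequence of e, a product with at most 2D coefficients. Since g is the last
cofactor, the Euclidean algorithm stopped at D − deg f coefficients costs only O(D deg g). -/
theorem runLe_minpolyC {mul : (ℕ → ι ⊕ ℕ) → (ℕ → ι ⊕ ℕ) → Comp ι (ℕ → ι ⊕ ℕ)} {cm : ℕ}
    (hmul : ComputesProduct K (2 * D) cm mul) {w : World ι K} {f g : K[X]} {a t : ℕ → ι ⊕ ℕ}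
    {L : K[X] →ₗ[K] K} {L' : K[X] →ₗ[K] K} (hL : ∀ p, L' p = L (p * f))
    (hf : f.Monic) (hg : IsAnnihilator L' g) (hd : f.natDegree < D)
    (hgd : g.natDegree ≤ D - f.natDegree) (ha : Stores w a f.coeff)
    (ht : ∀ i < 2 * D, Holds w (t i) (L (X ^ i))) :
    RunLe w (minpolyC mul D f.natDegree a t)
      (cm + (2 * D + (16 * ((2 * D + 1) * g.natDegree) + 2 * (g.natDegree + 1)))) fun r w' =>
      r.1 = g.natDegree + 1 ∧ Stores w' r.2.1 g.coeff ∧ ∃ z, Stores w' r.2.2 z.coeff ∧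
        polyLen z ≤ g.natDegree ∧
        ∀ c < g.natDegree, L' (X ^ c * z) = if c + 1 = g.natDegree then 1 else 0 := by
  obtain ⟨d, hdd⟩ : ∃ d, d = f.natDegree := ⟨_, rfl⟩
  obtain ⟨M, hM⟩ : ∃ M, M = D - d := ⟨_, rfl⟩
  obtain ⟨N, hN⟩ : ∃ N, N = 2 * M + d := ⟨_, rfl⟩
  rw [← hdd] at hd hgd ⊢
  rw [← hM] at hgd
  simp only [minpolyC]
  rw [← hM, ← hN]
  let S' : K[X] := ∑ i ∈ Finset.range N, C (L (X ^ (N - 1 - i))) * X ^ i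
  have hS' : ∀ i < N, S'.coeff i = L (X ^ (N - 1 - i)) := fun i hi => by
    simp only [S']; rw [coeff_sum_range_C_mul_X_pow, if_pos hi]
  have hS'len : polyLen S' ≤ N := polyLen_le_iff.2 (degree_sum_range_C_mul_X_pow_lt _ _)
  have hflen : polyLen f = d + 1 := by rw [polyLen_of_monic hf, hdd]
  have hprod : polyLen (f * S') ≤ 2 * D := by
    by_cases h0 : S' = 0
    · rw [h0, mul_zero, polyLen_zero]; omega
    · have h1 := polyLen_of_ne_zero h0
      have h2 := hf.natDegree_mul' h0
      rw [polyLen_of_ne_zero (mul_ne_zero hf.ne_zero h0)]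
      omega
  refine RunLe.seq (hmul w a _ f S' ha (fun i => ?_) (by omega) (by omega) hprod)
    fun P w₁ hw₁ hP => ?_
  · simp only [S']
    rw [coeff_sum_range_C_mul_X_pow]
    split_ifs with hi
    · exact ht _ (by omega)
    · exact holds_zero w
  let S : K[X] := ∑ i ∈ Finset.range (2 * M), C (L' (X ^ (2 * M - 1 - i))) * X ^ i
  have hS : ∀ i < 2 * M, S.coeff i = L' (X ^ (2 * M - 1 - i)) := fun i hi => by
    simp only [S]; rw [coeff_sum_range_C_mul_X_pow, if_pos hi]
  have hSlen : polyLen S ≤ 2 * M := polyLen_le_iff.2 (degree_sum_range_C_mul_X_pow_lt _ _)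
  have hSst : Stores w₁ (fun i => if i < 2 * M then P (d + i) else zeroReg) S.coeff := by
    intro i
    dsimp only
    split_ifs with hi
    · rw [hS i hi, hL, ← coeff_mul_reverse hS' (by omega),
        show N - 1 - (2 * M - 1 - i) = d + i by omega]
      exact hP _
    · rw [coeff_eq_zero_of_polyLen_le hSlen (by omega)]
      exact holds_zero w₁
  refine RunLe.bind (c₁ := 2 * M) (c₂ := 16 * ((2 * D + 1) * g.natDegree) + 2 * (g.natDegree + 1))
    (runLe_lenC hSst hSlen) (fun n w₂ hw₂ hn => ?_)
  have hA : polyLen (X ^ (2 * M) : K[X]) = 2 * M + 1 := by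
    rw [polyLen_of_monic (monic_X_pow _), natDegree_X_pow]
  have hXst : Stores w₂ (fun i => if i = 2 * M then oneReg else zeroReg)
      (X ^ (2 * M) : K[X]).coeff := by
    intro i
    dsimp only
    rw [coeff_X_pow]
    split_ifs
    · exact holds_one w₂
    · exact holds_zero w₂
  have hE := run_euclidC (A := X ^ (2 * M)) (S := S) (w := w₂) M n (s := ⟨2 * M + 1,
    fun i => if i = 2 * M then oneReg else zeroReg, n,
    fun i => if i < 2 * M then P (d + i) else zeroReg, fun _ => zeroReg,
    fun i => if i = 0 then oneReg else zeroReg, 1⟩)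
    ⟨hXst, hSst.mono hw₂, stores_zero w₂, stores_one w₂, hA.symm, hn, polyLen_one.symm⟩
    (isEuclidPair_init (by omega)) (by omega) hn.ge
  refine RunLe.bind (c₁ := 16 * ((2 * D + 1) * g.natDegree)) (c₂ := 2 * (g.natDegree + 1))
    (P := fun s w' => ∃ R₀ R₁ V₀ V₁, s.Stores w' R₀ R₁ V₀ V₁ ∧
      IsEuclidPair (X ^ (2 * M)) S R₀ R₁ V₀ V₁ ∧ M < polyLen R₀ ∧ polyLen R₁ ≤ M ∧
      polyLen V₁ = g.natDegree + 1)
    (Run.mono hE ?_) ?_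
  · rintro s w' n - ⟨R₀, R₁, V₀, V₁, h1, h2, h3, h4, h5⟩
    have h6 := hg.eq_of_isEuclidPair hgd hS h2 h3 h4
    have hV1 : V₁ ≠ 0 := by
      rintro rfl
      exact hg.monic.ne_zero (by rw [← h6, mul_zero])
    have h7 : polyLen V₁ = g.natDegree + 1 := by
      rw [← polyLen_of_monic hg.monic, ← h6,
        polyLen_C_mul (inv_ne_zero (leadingCoeff_ne_zero.2 hV1))]
    refine ⟨⟨R₀, R₁, V₀, V₁, h1, h2, h3, h4, h7⟩, ?_⟩
    have h8 := h2.len_add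
    rw [hA] at h5 h8
    have h9 : polyLen R₀ + g.natDegree = 2 * M + 1 := by omega
    have h10 : 16 * (2 * M + 1) * (2 * M + 1)
        = 16 * (2 * M + 1) * polyLen R₀ + 16 * (2 * M + 1) * g.natDegree := by
      rw [← mul_add, h9]
    have h11 : 16 * (2 * M + 1) * g.natDegree ≤ 16 * ((2 * D + 1) * g.natDegree) := by
      rw [mul_assoc]; gcongr; omega
    omega
  · rintro s w₃ hw₃ ⟨R₀, R₁, V₀, V₁, ⟨g1, g2, g3, g4, g5, g6, g7⟩, h2, h3, h4, h7⟩
    have h6 := hg.eq_of_isEuclidPair hgd hS h2 h3 h4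
    have hV1 : V₁ ≠ 0 := by
      rintro rfl
      exact hg.monic.ne_zero (by rw [← h6, mul_zero])
    have hR0 : R₀ ≠ 0 := by rintro rfl; simp [polyLen_zero] at h3
    have hc1 := g4 (s.l₁ - 1)
    rw [g7, coeff_polyLen_sub_one hV1, ← g7] at hc1
    have hc2 := g1 (s.n₀ - 1)
    rw [g5, coeff_polyLen_sub_one hR0, ← g5] at hc2
    have hcof := h2.cofactor_lt
    refine RunLe.bind (c₁ := g.natDegree + 1) (c₂ := g.natDegree + 1) ((runLe_divScalarC g4 g7.ge hc1
      (leadingCoeff_ne_zero.2 hV1)).mono_cost (by omega)) fun G w₄ hw₄ hG => ?_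
    rw [h6] at hG
    refine RunLe.bind (c₁ := g.natDegree + 1) (c₂ := 0) ((runLe_divScalarC (g3.mono hw₄)
      (show polyLen V₀ ≤ s.l₁ by omega) (hc2.mono hw₄)
      (leadingCoeff_ne_zero.2 hR0)).mono_cost (by omega)) fun z w₅ hw₅ hz => ?_
    refine RunLe.pure ⟨by dsimp only; omega, hG.mono hw₅, _, hz, ?_, fun c hc =>
      hg.map_mul_cofactor hgd hS h2 h3 h4 hc⟩
    rw [polyLen_C_mul (inv_ne_zero (leadingCoeff_ne_zero.2 hR0))]
    omega

end Round

/-! ## The rounds of the Wiedemann algorithm -/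

section Rounds

variable {K : Type u} [Field K] {ι : Type} {D m : ℕ}

/-- Newton's form of interpolation: enlarging the modulus from f to fg adds a multiple of f to the
remainder. The factors need not be coprime. -/
theorem modByMonic_mul_eq {f g : K[X]} (hf : f.Monic) (hg : g.Monic) (p : K[X]) :
    p /ₘ (f * g) = (p /ₘ f) /ₘ g ∧ p %ₘ (f * g) = p %ₘ f + f * ((p /ₘ f) %ₘ g) := by
  refine div_modByMonic_unique _ _ (hf.mul hg) ⟨?_, ?_⟩
  · conv_rhs => rw [← modByMonic_add_div p f, ← modByMonic_add_div (p /ₘ f) g]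
    ring
  · refine (degree_add_le _ _).trans_lt (max_lt ?_ ?_)
    · exact (degree_modByMonic_lt p hf).trans_le (degree_le_mul_left f hg.ne_zero)
    · rw [degree_mul, degree_mul]
      exact WithBot.add_lt_add_left (degree_ne_bot.2 hf.ne_zero) (degree_modByMonic_lt _ hg)

/-- The solution of a Hankel system. -/
def hankelSolveC (L : ℕ) (g z : ℕ → ι ⊕ ℕ) (ρ : ℕ → Fin D → ι ⊕ ℕ) (res : Fin D → ι ⊕ ℕ) :
    Comp ι (ℕ → ι ⊕ ℕ) := do
  let y ← tabN L fun a => dotC (ρ a) res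
  let N ← tabN L fun n => sumC (fun a => arithC .mul (y a) (g (n + a + 1))) (List.range L)
  let q ← mulC N L z L
  let r ← divModC g (L + 1) L q
  pure r.2

/-- Z serves all right-hand sides, so each system costs L inner products and a number of operations
quadratic in L, instead of an elimination. -/
theorem runLe_hankelSolveC {w : World ι K} {L : ℕ} {g z : ℕ → ι ⊕ ℕ} {ρ : ℕ → Fin D → ι ⊕ ℕ}
    {res : Fin D → ι ⊕ ℕ} {G Z R : K[X]} {Λ : K[X] →ₗ[K] K} {rows : ℕ → Fin D → K} {x : Fin D → K}
    (hG : IsAnnihilator Λ G) (hL : L = G.natDegree) (hg : Stores w g G.coeff)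
    (hz : Stores w z Z.coeff) (hZ : polyLen Z ≤ L)
    (hΛ : ∀ a < L, Λ (X ^ a * Z) = if a + 1 = L then 1 else 0)
    (hρ : ∀ a < L, Stores w (ρ a) (rows a)) (hres : Stores w res x)
    (hR : ∀ a < L, rows a ⬝ᵥ x = Λ (X ^ a * R)) :
    RunLe w (hankelSolveC L g z ρ res)
      (L * (D * 2) + (L * (L * 2) + (L * (L * 2) + L * (2 + (L + 1) * 2)))) fun r w' =>
        Stores w' r (R %ₘ G).coeff := by
  refine RunLe.seq (runLe_tabN (x := fun a => if a < L then Λ (X ^ a * R) else 0)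
    (fun i hi => if_neg (by omega)) fun a ha w₁ hw₁ => ?_) fun y w₁ hw₁ hy => ?_
  · rw [if_pos ha, ← hR a ha]
    exact runLe_dotC ((hρ a ha).mono hw₁) (hres.mono hw₁)
  let N : K[X] := ∑ n ∈ Finset.range L, C (∑ a ∈ Finset.range L,
    Λ (X ^ a * R) * G.coeff (n + a + 1)) * X ^ n
  have hN : ∀ n, N.coeff n = ∑ a ∈ Finset.range L, Λ (X ^ a * R) * G.coeff (n + a + 1) := by
    intro n
    simp only [N]
    rw [coeff_sum_range_C_mul_X_pow]
    split_ifs with h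
    · rfl
    · refine (Finset.sum_eq_zero fun a _ => ?_).symm
      rw [coeff_eq_zero_of_natDegree_lt (by omega), mul_zero]
  have hNlen : polyLen N ≤ L := polyLen_le_iff.2 (degree_sum_range_C_mul_X_pow_lt _ _)
  refine RunLe.seq (runLe_tabN (x := N.coeff)
    (fun i hi => coeff_eq_zero_of_polyLen_le hNlen hi) fun n _ w₂ hw₂ => ?_) fun ν w₂ hw₂ hν => ?_
  · rw [hN]
    refine runLe_sumC_range (c := 1) fun a ha w₃ hw₃ => ?_
    have h1 := hy a
    dsimp only at h1
    rw [if_pos ha] at h1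
    exact runLe_mul (h1.mono (hw₂.trans hw₃)) ((hg _).mono (hw₁.trans (hw₂.trans hw₃)))
  refine RunLe.seq (runLe_mulC hν (hz.mono (hw₁.trans hw₂)) hNlen hZ) fun q w₃ hw₃ hq => ?_
  have hGlen : polyLen G = L + 1 := by rw [polyLen_of_monic hG.monic, hL]
  have hqlen : polyLen (N * Z) ≤ L + (L + 1) - 1 := by
    by_cases h0 : N * Z = 0
    · rw [h0, polyLen_zero]; omega
    · have h1 := left_ne_zero_of_mul h0
      have h2 := right_ne_zero_of_mul h0
      have h3 := polyLen_of_ne_zero h1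
      have h4 := polyLen_of_ne_zero h2
      rw [polyLen_of_ne_zero h0, natDegree_mul h1 h2]
      omega
  refine RunLe.bind (c₂ := 0) (runLe_divModC (hg.mono (hw₁.trans (hw₂.trans hw₃)))
    hG.monic.ne_zero hGlen L hq hqlen) (fun r w₄ hw₄ hr => RunLe.pure ?_) le_rfl
  rw [← hG.hankel_solution (z := Z) (by rwa [← hL]) R N (by rw [← hL]; exact hN),
    modByMonic_eq_mod _ hG.monic]
  exact hr.2.1

/-- A round of the Wiedemann algorithm with the solution of the Hankel systems. -/
def roundC (mul : (ℕ → ι ⊕ ℕ) → (ℕ → ι ⊕ ℕ) → Comp ι (ℕ → ι ⊕ ℕ)) (S : Finset (Fin D × Fin D))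
    (τ : Fin D → Fin D → ι ⊕ ℕ) (kr : ℕ → Fin D → ι ⊕ ℕ) (k : Fin D) (s : RoundState ι D m) :
    Comp ι (RoundState ι D m × (ℕ × (ℕ → ι ⊕ ℕ))) := do
  let r ← minpolyC mul D s.d s.f fun i => kr i k
  let kb ← krylovC S τ s.b (r.1 - 1)
  let ρ ← krylovC (S.map (Equiv.prodComm _ _).toEmbedding) (fun i j => τ j i)
    (fun i => if i = k then oneReg else zeroReg) (r.1 - 1)
  let u ← tabFin m (fun _ => zeroReg) fun j => hankelSolveC (r.1 - 1) r.2.1 r.2.2 ρ (s.res j)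
  let res ← tabFin m (fun _ => zeroReg) fun j =>
    linCombC (r.1 - 1) (u j) kb >>= fun t => vecSubC (s.res j) t
  let H ← tabFin m (fun _ => zeroReg) fun j => addMulC (s.H j) s.f (u j) (r.1 - 1) (s.d + 1)
  let b ← linCombC r.1 r.2.1 kb
  let f ← mulC s.f (s.d + 1) r.2.1 r.1
  pure (⟨s.d + (r.1 - 1), f, b, H, res⟩, (r.1, r.2.1))

/-- The number of operations of a round that finds a factor of degree `L`. -/
def roundCost (D m σ cm L : ℕ) : ℕ := cm + 4 * (L * σ) + (70 + 20 * m) * (D * (L + 1))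

/-- The Hankel system is solved for the residual v_j − (H_j mod f)(T)e = (H_j /ₘ f)(T)b in place of
f(T)v_j. Its solution (H_j /ₘ f) mod g is the correction that leads to H_j mod fg, and the new
residual needs only Krylov vectors of b, common to all j. Products with T, and with its transpose
for the rows e_kᵗT^a, thus number 2 deg g per round, independently of n. -/
theorem runLe_roundC {mul : (ℕ → ι ⊕ ℕ) → (ℕ → ι ⊕ ℕ) → Comp ι (ℕ → ι ⊕ ℕ)} {cm : ℕ}
    (hmul : ComputesProduct K (2 * D) cm mul) {w : World ι K} {S : Finset (Fin D × Fin D)}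
    {τ : Fin D → Fin D → ι ⊕ ℕ} {T : Matrix (Fin D) (Fin D) K} {e : Fin D → K}
    (hτ : ∀ i j, Holds w (τ i j) (T i j)) (hS : ∀ i j, (i, j) ∉ S → T i j = 0)
    {kr : ℕ → Fin D → ι ⊕ ℕ} (hkr : ∀ i < 2 * D, Stores w (kr i) (T ^ i *ᵥ e)) {k : Fin D}
    {s : RoundState ι D m} {H : Fin m → K[X]} {f g : K[X]} (hs : s.Stores w T e H f)
    (hf : f.Monic) (hg : IsAnnihilator (krylovMap T k (aeval T f *ᵥ e)) g)
    (hd : f.natDegree < D) (hgd : g.natDegree ≤ D - f.natDegree) :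
    RunLe w (roundC mul S τ kr k s) (roundCost D m S.card cm g.natDegree) fun r w' =>
      r.1.Stores w' T e H (f * g) ∧ r.2.1 = polyLen g ∧ Stores w' r.2.2 g.coeff := by
  obtain ⟨L, hL⟩ : ∃ L, L = g.natDegree := ⟨_, rfl⟩
  obtain ⟨d, hdf⟩ : ∃ d, d = f.natDegree := ⟨_, rfl⟩
  have hmin := runLe_minpolyC hmul (L := krylovMap T k e)
    (fun p => krylovMap_mul T k e p f) hf hg hd hgd hs.f_stores
    (t := fun i => kr i k) (fun i hi => by
      have := hkr i hi k
      simpa [krylovMap] using this)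
  rw [← hL, ← hdf] at hmin
  have hglen : polyLen g = L + 1 := by rw [polyLen_of_monic hg.monic, hL]
  have hflen : polyLen f = d + 1 := by rw [polyLen_of_monic hf, hdf]
  refine RunLe.mono_cost (c := cm + (2 * D + (16 * ((2 * D + 1) * L) + 2 * (L + 1)))
    + (L * (2 * S.card) + (L * (2 * S.card)
    + (m * (L * (D * 2) + (L * (L * 2) + (L * (L * 2) + L * (2 + (L + 1) * 2))))
    + (m * (D * (L * 2) + D) + (m * ((d + 1) * (L * 2))
    + (D * ((L + 1) * 2) + (d + 1) * ((L + 1) * 2)))))))) ?_ ?_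
  · rw [roundC, hs.d_eq, ← hdf]
    refine RunLe.seq hmin fun r w₁ hw₁ ⟨hr1, hr2, z, hz1, hz2, hz3⟩ => ?_
    rw [hr1, Nat.add_sub_cancel]
    refine RunLe.seq (runLe_krylovC (fun i j => (hτ i j).mono hw₁) hS (hs.b_stores.mono hw₁) L)
      fun kb w₂ hw₂ hkb => ?_
    have hρ := runLe_krylovC (w := w₂) (S := S.map (Equiv.prodComm _ _).toEmbedding)
      (τ := fun i j => τ j i) (M := Tᵀ) (a := fun i => if i = k then oneReg else zeroReg)
      (x := Pi.single k 1) (fun i j => (hτ j i).mono (hw₁.trans hw₂))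
      (fun i j h => hS j i (by simpa using h)) (fun i => by
        dsimp only
        by_cases h : i = k
        · subst h; simpa using holds_one w₂
        · rw [if_neg h, Pi.single_eq_of_ne h]; exact holds_zero w₂) L
    rw [Finset.card_map] at hρ
    refine RunLe.seq hρ fun ρ w₃ hw₃ hρ => ?_
    have hw₁₃ := hw₁.trans (hw₂.trans hw₃)
    refine RunLe.seq (runLe_tabFin (P := fun j u w' => Stores w' u ((H j /ₘ f) %ₘ g).coeff)
      (fun _ _ _ _ h h' => h'.mono h) fun j w₄ hw₄ => ?_) fun u w₄ hw₄ hu => ?_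
    · refine runLe_hankelSolveC (x := aeval T (f * (H j /ₘ f)) *ᵥ e)
        (rows := fun a => Tᵀ ^ a *ᵥ Pi.single k 1) hg hL
        (hr2.mono (hw₂.trans (hw₃.trans hw₄)))
        (hz1.mono (hw₂.trans (hw₃.trans hw₄))) hz2 hz3 (fun a ha => (hρ a ha.le).mono hw₄)
        ((hs.res_stores j).mono (hw₁₃.trans hw₄)) fun a _ => ?_
      rw [krylovMap_mul, ← transpose_pow, mulVec_single_one]
      have h1 : ((T ^ a)ᵀ.col k) ⬝ᵥ (aeval T (f * (H j /ₘ f)) *ᵥ e)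
          = (T ^ a *ᵥ (aeval T (f * (H j /ₘ f)) *ᵥ e)) k := rfl
      rw [h1, mulVec_mulVec, ← aeval_X (R := K) T, ← map_pow, aeval_X, ← map_mul, mul_assoc,
        mul_comm f]
      rfl
    have hulen : ∀ j, polyLen ((H j /ₘ f) %ₘ g) ≤ L := fun j => by
      have := polyLen_lt_iff_degree_lt.2 (degree_modByMonic_lt (H j /ₘ f) hg.monic)
      omega
    refine RunLe.seq (runLe_tabFin
      (P := fun j x w' => Stores w' x (aeval T (f * g * (H j /ₘ (f * g))) *ᵥ e))
      (fun _ _ _ _ h h' => h'.mono h) fun j w₅ hw₅ => ?_) fun res w₅ hw₅ hres => ?_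
    · refine RunLe.seq (runLe_linCombC ((hu j).mono hw₅) (hulen j) fun i hi =>
        (hkb i hi.le).mono (hw₃.trans (hw₄.trans hw₅))) fun t w₆ hw₆ ht => ?_
      have := runLe_vecSubC ((hs.res_stores j).mono (hw₁₃.trans (hw₄.trans (hw₅.trans hw₆)))) ht
      have h2 : aeval T (f * g * (H j /ₘ (f * g))) *ᵥ e
          = aeval T (f * (H j /ₘ f)) *ᵥ e - aeval T ((H j /ₘ f) %ₘ g) *ᵥ aeval T f *ᵥ e := by
        rw [mulVec_mulVec, ← map_mul, ← sub_mulVec, ← map_sub, (modByMonic_mul_eq hf hg.monic _).1]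
        congr 2
        linear_combination f * (modByMonic_add_div (H j /ₘ f) g)
      rw [h2]
      exact this
    refine RunLe.seq (runLe_tabFin (P := fun j x w' => Stores w' x (H j %ₘ (f * g)).coeff)
      (fun _ _ _ _ h h' => h'.mono h) fun j w₆ hw₆ => ?_) fun Hr w₆ hw₆ hHr => ?_
    · rw [(modByMonic_mul_eq hf hg.monic _).2]
      exact runLe_addMulC ((hs.H_stores j).mono (hw₁₃.trans (hw₄.trans (hw₅.trans hw₆))))
        (hs.f_stores.mono (hw₁₃.trans (hw₄.trans (hw₅.trans hw₆))))
        ((hu j).mono (hw₅.trans hw₆)) hflen.le (hulen j)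
    have hw₂₆ := hw₃.trans (hw₄.trans (hw₅.trans hw₆))
    refine RunLe.seq (runLe_linCombC (hr2.mono (hw₂.trans hw₂₆)) hglen.le fun i hi =>
      (hkb i (by omega)).mono hw₂₆) fun b w₇ hw₇ hb => ?_
    refine RunLe.bind (c₂ := 0) (runLe_mulC (hs.f_stores.mono (hw₁.trans (hw₂.trans (hw₂₆.trans hw₇))))
      (hr2.mono (hw₂.trans (hw₂₆.trans hw₇))) hflen.le hglen.le)
      (fun F w₈ hw₈ hF => RunLe.pure ⟨⟨?_, hF, ?_, fun j => (hHr j).mono (hw₇.trans hw₈),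
        fun j => (hres j).mono (hw₆.trans (hw₇.trans hw₈))⟩, ?_, ?_⟩) le_rfl
    · rw [hf.natDegree_mul hg.monic, hdf, hL]
    · rw [mul_comm, map_mul, ← mulVec_mulVec]
      exact hb.mono hw₈
    · exact hglen.symm
    · exact hr2.mono (hw₂.trans (hw₂₆.trans (hw₇.trans hw₈)))
  · have hLD : L ≤ D := by omega
    have hdD : d + 1 ≤ D := by omega
    have e1 : L * L ≤ D * L := Nat.mul_le_mul_right _ hLD
    have e2 : (d + 1) * L ≤ D * L := Nat.mul_le_mul_right _ hdD
    have e3 : 1 * L ≤ D * L := Nat.mul_le_mul_right _ (by omega)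
    have f1 : 16 * ((2 * D + 1) * L) = 32 * (D * L) + 16 * L := by ring
    have f2 : L * (2 * S.card) = 2 * (L * S.card) := by ring
    have f3 : D * ((L + 1) * 2) = 2 * (D * L) + 2 * D := by ring
    have f4 : (d + 1) * ((L + 1) * 2) = 2 * ((d + 1) * L) + 2 * (d + 1) := by ring
    have f5 : (70 + 20 * m) * (D * (L + 1)) = 70 * (D * L) + 70 * D + m * (20 * (D * L) + 20 * D) := by
      ring
    have f6 : m * (L * (D * 2) + (L * (L * 2) + (L * (L * 2) + L * (2 + (L + 1) * 2))))
        + (m * (D * (L * 2) + D) + m * ((d + 1) * (L * 2)))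
        = m * (4 * (D * L) + 6 * (L * L) + 4 * L + D + 2 * ((d + 1) * L)) := by ring
    have f7 : m * (4 * (D * L) + 6 * (L * L) + 4 * L + D + 2 * ((d + 1) * L))
        ≤ m * (20 * (D * L) + 20 * D) := Nat.mul_le_mul_left _ (by omega)
    rw [← hL, roundCost, f5]
    omega

end Rounds

/-! ## The program for the method -/

section MethodProgram

variable {K : Type u} [Field K] {ι : Type} {D m : ℕ}

/-- Arrays, given with their lengths, that contain the coefficients of polynomials. -/
def PolysStored (w : World ι K) (rs : List (ℕ × (ℕ → ι ⊕ ℕ))) (gs : List K[X]) : Prop :=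
  List.Forall₂ (fun r g => r.1 = polyLen g ∧ Stores w r.2 g.coeff) rs gs

theorem PolysStored.mono {w w' : World ι K} {rs : List (ℕ × (ℕ → ι ⊕ ℕ))} {gs : List K[X]}
    (h : PolysStored w rs gs) (hw : w ≤ w') : PolysStored w' rs gs :=
  List.Forall₂.imp (fun _ _ h => ⟨h.1, h.2.mono hw⟩) h

/-- The rounds of the Wiedemann algorithm. -/
def roundsC (mul : (ℕ → ι ⊕ ℕ) → (ℕ → ι ⊕ ℕ) → Comp ι (ℕ → ι ⊕ ℕ)) (S : Finset (Fin D × Fin D))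
    (τ : Fin D → Fin D → ι ⊕ ℕ) (kr : ℕ → Fin D → ι ⊕ ℕ) :
    ℕ → ℕ → RoundState ι D m → Comp ι (List (ℕ × (ℕ → ι ⊕ ℕ)) × RoundState ι D m)
  | 0, _, s => pure ([], s)
  | fuel + 1, k, s =>
      if h : k < D ∧ s.d < D then do
        let r ← roundC mul S τ kr ⟨k, h.1⟩ s
        let t ← roundsC mul S τ kr fuel (k + 1) r.1
        pure (r.2 :: t.1, t.2)
      else pure ([], s)

theorem FactorChain.length_le {T : Matrix (Fin D) (Fin D) K} {e : Fin D → K} {k : ℕ} {f : K[X]}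
    {gs : List K[X]} (h : FactorChain T e k f gs) : gs.length ≤ D - k := by
  induction gs generalizing k f with
  | nil => simp
  | cons g gs ih =>
    obtain ⟨_, ⟨hk, _⟩, h2⟩ := h
    have := ih h2
    rw [List.length_cons]
    omega

/-- b = 0 happens exactly when f has reached degree D, so the stopping test concerns a known number
and no field element. -/
theorem runLe_roundsC {mul : (ℕ → ι ⊕ ℕ) → (ℕ → ι ⊕ ℕ) → Comp ι (ℕ → ι ⊕ ℕ)} {cm : ℕ}
    (hmul : ComputesProduct K (2 * D) cm mul) {w : World ι K} {S : Finset (Fin D × Fin D)}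
    {τ : Fin D → Fin D → ι ⊕ ℕ} {T : Matrix (Fin D) (Fin D) K} {e : Fin D → K}
    (hT : IsCyclicVector T e)
    (hτ : ∀ i j, Holds w (τ i j) (T i j)) (hS : ∀ i j, (i, j) ∉ S → T i j = 0)
    {kr : ℕ → Fin D → ι ⊕ ℕ} (hkr : ∀ i < 2 * D, Stores w (kr i) (T ^ i *ᵥ e))
    {H : Fin m → K[X]} (fuel k : ℕ) {s : RoundState ι D m} {f : K[X]} {gs : List K[X]}
    (hs : s.Stores w T e H f) (hf : f.Monic) (hfF : f ∣ minpoly K T)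
    (hgs : FactorChain T e k f gs) (hfuel : gs.length ≤ fuel) :
    RunLe w (roundsC mul S τ kr fuel k s)
      (gs.map fun g => roundCost D m S.card cm g.natDegree).sum fun r w' =>
        PolysStored w' r.1 gs ∧ r.2.Stores w' T e H (f * gs.prod) := by
  have hF0 : aeval T (minpoly K T) *ᵥ e = 0 := by simp
  have hFm := minpoly.monic (isIntegral_matrix T)
  have hnil : ∀ {gs : List K[X]}, FactorChain T e k f gs → gs = [] → ∀ {w : World ι K}
      {s : RoundState ι D m}, s.Stores w T e H f → PolysStored w [] gs ∧
        s.Stores w T e H (f * gs.prod) := by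
    rintro gs - rfl w s hs
    exact ⟨List.Forall₂.nil, by rwa [List.prod_nil, mul_one]⟩
  induction fuel generalizing w k s f gs with
  | zero =>
    have := List.eq_nil_of_length_eq_zero (Nat.le_zero.1 hfuel)
    exact RunLe.pure (hnil hgs this hs)
  | succ fuel ih =>
    rw [roundsC]
    cases gs with
    | nil =>
      have hd : ¬ s.d < D := by
        have h1 := hgs.mul_prod_eq hT hf hfF
        rw [List.prod_nil, mul_one] at h1
        rw [hs.d_eq, h1, hT.natDegree_minpoly]
        exact lt_irrefl D
      rw [dif_neg (fun h => hd h.2)]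
      exact RunLe.pure (hnil hgs rfl hs)
    | cons g gs =>
      obtain ⟨hb, ⟨hk, hg⟩, hgs'⟩ := id hgs
      have hfg := annihilator_mul_dvd hF0 hfF hg
      have hle := natDegree_le_of_dvd hfg hFm.ne_zero
      rw [hf.natDegree_mul hg.monic, hT.natDegree_minpoly] at hle
      have hd : f.natDegree < D := by
        by_contra hlt
        refine hb ((hT.aeval_mulVec_eq_zero_iff f).2 ?_)
        rw [eq_of_dvd_of_natDegree_le_of_leadingCoeff hfF
          (by rw [hT.natDegree_minpoly]; omega) (hf.trans hFm.symm)]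
      rw [dif_pos ⟨hk, by rw [hs.d_eq]; exact hd⟩]
      rw [List.map_cons, List.sum_cons]
      refine RunLe.seq (runLe_roundC hmul hτ hS hkr hs hf hg hd (by omega))
        fun r w₁ hw₁ hr => ?_
      refine RunLe.bind (c₂ := 0) (ih (fun i j => (hτ i j).mono hw₁)
        (fun i hi => (hkr i hi).mono hw₁) (k + 1) hr.1 (hf.mul hg.monic) hfg hgs'
        (by simpa using hfuel) ?_) (fun t w₂ hw₂ ht => RunLe.pure ⟨?_, ?_⟩) le_rfl
      · rintro gs - rfl w s hs
        exact ⟨List.Forall₂.nil, by rwa [List.prod_nil, mul_one]⟩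
      · exact List.Forall₂.cons ⟨hr.2.1, hr.2.2.mono hw₂⟩ ht.1
      · rw [List.prod_cons, ← mul_assoc]
        exact ht.2

/-- The remainders of polynomials with at most `N` coefficients. -/
def reduceC (N : ℕ) (H : Fin m → ℕ → ι ⊕ ℕ) (r : ℕ × (ℕ → ι ⊕ ℕ)) :
    Comp ι ((ℕ × (ℕ → ι ⊕ ℕ)) × (Fin m → ℕ → ι ⊕ ℕ)) := do
  let h ← tabFin m (fun _ => zeroReg) fun j =>
    divModC r.2 r.1 N (H j) >>= fun q => pure q.2
  pure (r, h)

/-- Arrays that contain a polynomial set. -/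
def SystemStored (w : World ι K) (P : Fin m → K[X])
    (r : (ℕ × (ℕ → ι ⊕ ℕ)) × (Fin m → ℕ → ι ⊕ ℕ)) (g : K[X]) : Prop :=
  g.Monic ∧ r.1.1 = polyLen g ∧ Stores w r.1.2 g.coeff ∧
    ∀ j, Stores w (r.2 j) (P j %ₘ g).coeff

theorem SystemStored.mono {w w' : World ι K} {P : Fin m → K[X]}
    {r : (ℕ × (ℕ → ι ⊕ ℕ)) × (Fin m → ℕ → ι ⊕ ℕ)} {g : K[X]} (h : SystemStored w P r g)
    (hw : w ≤ w') : SystemStored w' P r g :=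
  ⟨h.1, h.2.1, h.2.2.1.mono hw, fun j => (h.2.2.2 j).mono hw⟩

theorem runLe_reduceC {w : World ι K} {N : ℕ} {H : Fin m → ℕ → ι ⊕ ℕ} {P : Fin m → K[X]}
    {r : ℕ × (ℕ → ι ⊕ ℕ)} {g : K[X]} (hH : ∀ j, Stores w (H j) (P j).coeff)
    (hP : ∀ j, polyLen (P j) ≤ N) (hg : g.Monic) (hr : r.1 = polyLen g)
    (hr' : Stores w r.2 g.coeff) :
    RunLe w (reduceC N H r) (m * (N * (2 + polyLen g * 2))) fun z w' => SystemStored w' P z g := by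
  have hlen := polyLen_of_monic hg
  refine RunLe.bind (c₂ := 0) (runLe_tabFin (P := fun j x w' => Stores w' x (P j %ₘ g).coeff)
    (fun _ _ _ _ h h' => h'.mono h) (c := N * (2 + polyLen g * 2)) fun j w₁ hw₁ => ?_)
    (fun h w₁ hw₁ hh => RunLe.pure ⟨hg, hr, hr'.mono hw₁, hh⟩) le_rfl
  rw [hr]
  refine RunLe.bind (c₂ := 0) (runLe_divModC (hr'.mono hw₁) hg.ne_zero rfl N ((hH j).mono hw₁)
    (by have := hP j; omega)) (fun q w₂ hw₂ hq => RunLe.pure ?_) le_rfl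
  rw [modByMonic_eq_mod _ hg]
  exact hq.2.1

/-- The polynomial sets with given first polynomials. -/
def reduceListC (N : ℕ) (H : Fin m → ℕ → ι ⊕ ℕ) : List (ℕ × (ℕ → ι ⊕ ℕ)) →
    Comp ι (List ((ℕ × (ℕ → ι ⊕ ℕ)) × (Fin m → ℕ → ι ⊕ ℕ)))
  | [] => pure []
  | r :: rs => do
      let x ← reduceC N H r
      let t ← reduceListC N H rs
      pure (x :: t)

theorem runLe_reduceListC {w : World ι K} {N : ℕ} {H : Fin m → ℕ → ι ⊕ ℕ} {P : Fin m → K[X]}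
    {rs : List (ℕ × (ℕ → ι ⊕ ℕ))} {gs : List K[X]} (hH : ∀ j, Stores w (H j) (P j).coeff)
    (hP : ∀ j, polyLen (P j) ≤ N) (hgs : ∀ g ∈ gs, g.Monic) (hrs : PolysStored w rs gs) :
    RunLe w (reduceListC N H rs) (gs.map fun g => m * (N * (2 + polyLen g * 2))).sum
      fun z w' => List.Forall₂ (SystemStored w' P) z gs := by
  induction rs generalizing w gs with
  | nil =>
    cases hrs
    exact RunLe.pure List.Forall₂.nil
  | cons r rs ih =>
    cases hrs with
    | cons h1 h2 =>
      rename_i g gs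
      rw [List.map_cons, List.sum_cons]
      refine RunLe.seq (runLe_reduceC hH hP (hgs g List.mem_cons_self) h1.1 h1.2)
        fun x w₁ hw₁ hx => ?_
      refine RunLe.bind (c₂ := 0) (ih (fun j => (hH j).mono hw₁)
        (fun g' hg' => hgs g' (List.mem_cons_of_mem _ hg')) (PolysStored.mono h2 hw₁))
        (fun t w₂ hw₂ ht => RunLe.pure ?_) le_rfl
      exact List.Forall₂.cons (hx.mono hw₂) ht

/-- The squarefree splitting. -/
def splitC : ℕ → (ℕ → ι ⊕ ℕ) → List (ℕ × (ℕ → ι ⊕ ℕ)) → Comp ι (List (ℕ × (ℕ → ι ⊕ ℕ)))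
  | _, _, [] => pure []
  | n, a, r :: rs =>
      if n = 1 then pure [] else do
        let g ← gcdModC n a r.1 r.2
        if g.1 = 1 then splitC n a rs
        else do
          let q ← divModC g.2 g.1 (n - g.1 + 1) a
          let t ← splitC (n - g.1 + 1) q.1 rs
          pure (g :: t)

theorem IsMonicGcd.symm {g p q : K[X]} (h : IsMonicGcd g p q) : IsMonicGcd g q p := by
  obtain ⟨h1, h2, h3, x, y, h4⟩ := h
  exact ⟨h1, h3, h2, y, x, by rw [h4, add_comm]⟩

theorem polyLen_eq_one_iff {p : K[X]} (hp : p.Monic) : polyLen p = 1 ↔ p = 1 := by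
  rw [polyLen_of_monic hp, ← hp.natDegree_eq_zero]; omega

-- The gcd starts with the remainder of p modulo g, so one step costs O(N deg g) up to lower-order
-- terms rather than O(N²), and the steps add up.
open Classical in
theorem runLe_splitC {N : ℕ} {w : World ι K} {n : ℕ} {a : ℕ → ι ⊕ ℕ} {p : K[X]}
    {rs : List (ℕ × (ℕ → ι ⊕ ℕ))} {gs : List K[X]} (ha : Stores w a p.coeff) (hn : n = polyLen p)
    (hp : p.Monic) (hgs : ∀ g ∈ gs, g.Monic) (hrs : PolysStored w rs gs)
    (hpN : p.natDegree ≤ N) (hN : ∀ g ∈ gs, g.natDegree ≤ N) :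
    RunLe w (splitC n a rs) (gs.map fun g => 30 * ((N + 1) * (g.natDegree + 1))).sum
      fun z w' => PolysStored w' z (splitFactors p gs) := by
  induction rs generalizing w gs n a p with
  | nil =>
    cases hrs
    exact RunLe.pure List.Forall₂.nil
  | cons r rs ih =>
    cases hrs with
    | cons h1 h2 =>
      rename_i g gs
      obtain ⟨hr1, hr2⟩ := h1
      have hgm := hgs g List.mem_cons_self
      have hgN := hN g List.mem_cons_self
      have hgs' := fun g' hg' => hgs g' (List.mem_cons_of_mem g hg')
      have hN' := fun g' hg' => hN g' (List.mem_cons_of_mem g hg')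
      rw [splitC]
      split_ifs with hn1
      · rw [splitFactors, if_pos ((polyLen_eq_one_iff hp).1 (hn ▸ hn1))]
        exact RunLe.pure List.Forall₂.nil
      · have hp1 : p ≠ 1 := fun h => hn1 (by rw [hn, (polyLen_eq_one_iff hp).2 h])
        have hplen := polyLen_of_monic hp
        have hglen := polyLen_of_monic hgm
        rw [List.map_cons, List.sum_cons]
        have hcost : n * (2 + r.1 * 2) + (2 * r.1 + 16 * r.1 * r.1) + (N + 1) * (2 + r.1 * 2)
            ≤ 30 * ((N + 1) * (g.natDegree + 1)) := by
          rw [hr1, hglen]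
          generalize g.natDegree = l at *
          have e1 : n * (2 + (l + 1) * 2) ≤ (N + 1) * (2 + (l + 1) * 2) :=
            Nat.mul_le_mul_right _ (by omega)
          have e2 : (l + 1) * (l + 1) ≤ (N + 1) * (l + 1) := Nat.mul_le_mul_right _ (by omega)
          have e3 : 1 * (l + 1) ≤ (N + 1) * (l + 1) := Nat.mul_le_mul_right _ (by omega)
          have e4 : (N + 1) * 1 ≤ (N + 1) * (l + 1) := Nat.mul_le_mul_left _ (by omega)
          have e5 : (N + 1) * (2 + (l + 1) * 2) = 2 * (N + 1) + 2 * ((N + 1) * (l + 1)) := by ring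
          have e6 : 16 * (l + 1) * (l + 1) = 16 * ((l + 1) * (l + 1)) := by ring
          omega
        refine RunLe.bind (c₂ := (N + 1) * (2 + r.1 * 2)
          + (gs.map fun g => 30 * ((N + 1) * (g.natDegree + 1))).sum)
          (runLe_gcdModC ha hr2 hn.ge hr1 hgm.ne_zero) (fun h w₁ hw₁ hh => ?_) (by omega)
        obtain ⟨G, hG, hG1, hG2⟩ := hh
        rw [splitFactors_cons hgm.ne_zero hG.symm, if_neg hp1]
        have hG1' := polyLen_eq_one_iff hG.monic
        have hGlen := polyLen_of_monic hG.monic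
        have hGp := natDegree_le_of_dvd hG.dvd_left hp.ne_zero
        have hGg := natDegree_le_of_dvd hG.dvd_right hgm.ne_zero
        split_ifs with h3 h4 h4
        · exact (ih (ha.mono hw₁) hn hp hgs' (PolysStored.mono h2 hw₁) hpN hN').mono_cost
            (by omega)
        · exact absurd (hG1'.1 (hG1 ▸ h3)) h4
        · exact absurd (hG1.trans (hG1'.2 h4)) h3
        · have hdiv : G * (p / G) = p := EuclideanDomain.mul_div_cancel' hG.monic.ne_zero hG.dvd_left
          have hqm : (p / G).Monic := hG.monic.of_mul_monic_left (hdiv.symm ▸ hp)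
          have hqd : p.natDegree = G.natDegree + (p / G).natDegree := by
            rw [← hG.monic.natDegree_mul hqm, hdiv]
          have hqlen := polyLen_of_monic hqm
          refine RunLe.bind (c₁ := (N + 1) * (2 + r.1 * 2))
            (c₂ := (gs.map fun g => 30 * ((N + 1) * (g.natDegree + 1))).sum)
            ((runLe_divModC hG2 hG.monic.ne_zero hG1.symm (n - h.1 + 1) (ha.mono hw₁)
              (by omega)).mono_cost (Nat.mul_le_mul (by omega) (by omega))) fun q w₂ hw₂ hq => ?_
          rw [divByMonic_eq_div _ hG.monic]
          refine RunLe.bind (c₂ := 0) (ih hq.1 (by omega) hqm hgs'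
            (PolysStored.mono h2 (hw₁.trans hw₂)) (by omega) hN') fun t w₃ hw₃ ht => ?_
          exact RunLe.pure (List.Forall₂.cons ⟨hG1, hG2.mono (hw₂.trans hw₃)⟩ ht)

end MethodProgram

/-! ## The whole method -/

section WholeMethod

variable {K : Type u} [Field K] {D m : ℕ}

/-- The list of the first `n` registers of an array. -/
def regsOf {ρ : Type} (n : ℕ) (a : ℕ → ρ) : List ρ := (List.range n).map a

theorem coeff_polyOfRegisters {ρ : Type} (μ : ρ → K) (l : List ρ) (i : ℕ) :
    (polyOfRegisters μ l).coeff i = (l.map μ).getD i 0 := by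
  induction l generalizing i with
  | nil => simp [polyOfRegisters]
  | cons r l ih =>
    cases i with
    | zero => simp [polyOfRegisters]
    | succ i =>
      rw [polyOfRegisters, coeff_add, coeff_X_mul, ih, coeff_C_of_ne_zero (Nat.succ_ne_zero i),
        zero_add]
      simp

theorem polyOfRegisters_regsOf {ι : Type} {w : World ι K} {n : ℕ} {a : ℕ → ι ⊕ ℕ} {p : K[X]}
    (ha : Stores w a p.coeff) (hp : polyLen p ≤ n) : polyOfRegisters w.val (regsOf n a) = p := by
  ext i
  rw [coeff_polyOfRegisters, regsOf, List.getD_eq_getElem?_getD]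
  by_cases hi : i < n
  · simpa [hi] using (ha i).2
  · rw [coeff_eq_zero_of_polyLen_le hp (by omega)]
    simp [hi]

/-- The registers of the coefficients of a polynomial set. -/
def systemRegs {ι : Type} (r : (ℕ × (ℕ → ι ⊕ ℕ)) × (Fin m → ℕ → ι ⊕ ℕ)) :
    List (ι ⊕ ℕ) × (Fin m → List (ι ⊕ ℕ)) :=
  (regsOf r.1.1 r.1.2, fun j => regsOf r.1.1 (r.2 j))

theorem SystemStored.polyOfRegisters_eq {ι : Type} {w : World ι K} {P : Fin m → K[X]}
    {r : (ℕ × (ℕ → ι ⊕ ℕ)) × (Fin m → ℕ → ι ⊕ ℕ)} {g : K[X]} (h : SystemStored w P r g) :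
    (polyOfRegisters w.val (systemRegs r).1, fun j => polyOfRegisters w.val ((systemRegs r).2 j))
      = (g, fun j => P j %ₘ g) := by
  obtain ⟨h1, h2, h3, h4⟩ := h
  refine Prod.ext (polyOfRegisters_regsOf h3 h2.ge) (funext fun j => ?_)
  refine polyOfRegisters_regsOf (h4 j) ?_
  have := polyLen_lt_iff_degree_lt.2 (degree_modByMonic_lt (P j) h1)
  change polyLen (P j %ₘ g) ≤ r.1.1
  omega

theorem map_systemRegs_eq {ι : Type} {w : World ι K} {P : Fin m → K[X]}
    {rs : List ((ℕ × (ℕ → ι ⊕ ℕ)) × (Fin m → ℕ → ι ⊕ ℕ))} {gs : List K[X]}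
    (h : List.Forall₂ (SystemStored w P) rs gs) :
    (rs.map systemRegs).map (fun s => (polyOfRegisters w.val s.1,
      fun j => polyOfRegisters w.val (s.2 j))) = gs.map fun g => (g, fun j => P j %ₘ g) := by
  induction h with
  | nil => rfl
  | cons h1 _ ih =>
    simp only [List.map_cons] at ih ⊢
    rw [ih, h1.polyOfRegisters_eq]

/-- The program for the squarefree splitting of the polynomials in `l`, where `r` stores the
squarefree part of a polynomial of degree `D`. -/
def splitIfC {ι : Type} (D : ℕ) (r : ℕ × (ℕ → ι ⊕ ℕ)) (l : List (ℕ × (ℕ → ι ⊕ ℕ))) :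
    Comp ι (List (ℕ × (ℕ → ι ⊕ ℕ))) :=
  if r.1 = D + 1 then pure l else splitC r.1 r.2 l

/-- The program for the method. The numbers `p` and `E` are the characteristic and an exponent of
`p`-th roots. -/
def methodC (mul : (ℕ → MethodInput m D ⊕ ℕ) → (ℕ → MethodInput m D ⊕ ℕ) →
      Comp (MethodInput m D) (ℕ → MethodInput m D ⊕ ℕ)) (p E : ℕ) (S : Finset (Fin D × Fin D)) :
    Comp (MethodInput m D) (MethodTrace (List (MethodInput m D ⊕ ℕ)) m) := do
  let kr ← krylovC S (fun i j => Sum.inl (Sum.inl (i, j)))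
    (fun i => if (i : ℕ) = 0 then oneReg else zeroReg) (2 * D - 1)
  let rs ← roundsC mul S (fun i j => Sum.inl (Sum.inl (i, j))) kr D 0
    (⟨0, fun i => if i = 0 then oneReg else zeroReg,
      fun i => if (i : ℕ) = 0 then oneReg else zeroReg, fun _ _ => zeroReg,
      fun j i => Sum.inl (Sum.inr (j, i))⟩ : RoundState (MethodInput m D) D m)
  let systems ← reduceListC D rs.2.H rs.1
  let r ← radicalC p E D (D + 1) rs.2.f
  let q ← splitIfC D r rs.1
  let parts ← reduceListC D rs.2.H q
  let result ← reduceC D rs.2.H r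
  pure ⟨systems.map systemRegs, parts.map systemRegs, systemRegs result⟩

theorem monic_list_prod {gs : List K[X]} (h : ∀ g ∈ gs, g.Monic) : gs.prod.Monic := by
  induction gs with
  | nil => exact monic_one
  | cons g gs ih =>
    rw [List.prod_cons]
    exact (h g List.mem_cons_self).mul (ih fun g' hg' => h g' (List.mem_cons_of_mem g hg'))

theorem natDegree_list_prod_of_forall_monic {gs : List K[X]} (h : ∀ g ∈ gs, g.Monic) :
    gs.prod.natDegree = (gs.map natDegree).sum := by
  induction gs with
  | nil => simp
  | cons g gs ih =>
    have h1 := fun g' hg' => h g' (List.mem_cons_of_mem g hg')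
    rw [List.prod_cons, (h g List.mem_cons_self).natDegree_mul (monic_list_prod h1),
      List.map_cons, List.sum_cons, ih h1]

theorem sum_map_affine (gs : List K[X]) (a b : ℕ) :
    (gs.map fun g => a + b * g.natDegree).sum = gs.length * a + b * (gs.map natDegree).sum := by
  induction gs with
  | nil => simp
  | cons g gs ih => simp only [List.map_cons, List.sum_cons, ih, List.length_cons]; ring

open Classical in
theorem length_splitFactors_le (p : K[X]) (gs : List K[X]) :
    (splitFactors p gs).length ≤ gs.length := by
  induction gs generalizing p with
  | nil => exact le_rfl
  | cons g gs ih =>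
    rw [splitFactors]
    split_ifs
    · simp
    · exact (ih p).trans (Nat.le_succ _)
    · exact Nat.succ_le_succ (ih _)

/-- A bound for the number of operations of the method. -/
def methodCost (m D σ cm E : ℕ) : ℕ :=
  D * cm + 8 * (D * σ) + 600 * ((m + 1) * (D * D)) + 4 * (D * Nat.log 2 E)

-- The rounds leave H_j mod F, and all polynomials of the record are remainders of it, since their
-- moduli divide F. Costs proportional to D(deg g + 1) add up to O(D²) because there are at most D
-- factors, of total degree D for the rounds and at most D for the kept sets.
open UniqueFactorizationMonoid Classical in
theorem runLe_methodC {mul : (ℕ → MethodInput m D ⊕ ℕ) → (ℕ → MethodInput m D ⊕ ℕ) →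
      Comp (MethodInput m D) (ℕ → MethodInput m D ⊕ ℕ)} {cm p E : ℕ} (hD : 0 < D)
    (hmul : ComputesProduct K (2 * D) cm mul) (hp : ringChar K = p)
    (hE : p = 0 ∨ D < p ∨ ∀ x : K, (x ^ E) ^ p = x) {w : World (MethodInput m D) K}
    {S : Finset (Fin D × Fin D)} {T : Matrix (Fin D) (Fin D) K} {H : Fin m → K[X]}
    {gs : List K[X]}
    (hT : IsCyclicVector T (unitVec K D)) (hS : ∀ i j, (i, j) ∉ S → T i j = 0)
    (hgs : FactorChain T (unitVec K D) 0 1 gs)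
    (hτ : ∀ i j, Holds w (Sum.inl (Sum.inl (i, j))) (T i j))
    (hv : ∀ j i, Holds w (Sum.inl (Sum.inr (j, i))) ((aeval T (H j) *ᵥ unitVec K D) i)) :
    RunLe w (methodC mul p E S) (methodCost m D S.card cm E) fun out w' =>
      out.map (polyOfRegisters w'.val) = methodTrace H gs := by
  have hFm := minpoly.monic (isIntegral_matrix T)
  have hprod : gs.prod = minpoly K T := by
    rw [← hgs.mul_prod_eq hT monic_one (one_dvd _), one_mul]
  have hFd := hT.natDegree_minpoly
  have hgm := hgs.monic
  have hlen := hgs.length_le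
  have hsum := natDegree_list_prod_of_forall_monic hgm
  rw [hprod, hFd] at hsum
  rw [← hprod] at hFm hFd
  have hFlen : polyLen gs.prod = D + 1 := by rw [polyLen_of_monic hFm, hFd]
  have hunit : ∀ w : World (MethodInput m D) K,
      Stores w (fun i : Fin D => if (i : ℕ) = 0 then oneReg else zeroReg) (unitVec K D) := by
    intro w i
    simp only [unitVec]
    split_ifs
    · exact holds_one w
    · exact holds_zero w
  have hrad := monic_radical gs.prod
  have hradF : radical gs.prod ∣ gs.prod := radical_dvd_self
  have hradd : (radical gs.prod).natDegree ≤ D := hFd ▸ natDegree_le_of_dvd hradF hFm.ne_zero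
  have hradlen := polyLen_of_monic hrad
  let q : List K[X] := if radical gs.prod = gs.prod then gs else splitFactors (radical gs.prod) gs
  have hq : (∀ g ∈ q, g.Monic) ∧ q.prod = radical gs.prod ∧ q.length ≤ D := by
    simp only [q]
    split_ifs with h
    · exact ⟨hgm, h.symm, hlen⟩
    · have := splitFactors_prod hgm hrad squarefree_radical hradF
      exact ⟨this.2, this.1, (length_splitFactors_le _ _).trans hlen⟩
  have hqsum : (q.map natDegree).sum ≤ D := by
    rw [← natDegree_list_prod_of_forall_monic hq.1, hq.2.1]; exact hradd
  have hred : ∀ (l : List K[X]), (∀ g ∈ l, g.Monic) → l.length ≤ D → (l.map natDegree).sum ≤ D →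
      (l.map fun g => m * (D * (2 + polyLen g * 2))).sum ≤ 6 * (m * (D * D)) := by
    intro l h1 h2 h3
    have h4 : (l.map fun g => m * (D * (2 + polyLen g * 2)))
        = l.map fun g => 4 * (m * D) + 2 * (m * D) * g.natDegree := by
      refine List.map_congr_left fun g hg => ?_
      rw [polyLen_of_monic (h1 g hg)]; ring
    rw [h4, sum_map_affine]
    calc _ ≤ D * (4 * (m * D)) + 2 * (m * D) * D := by gcongr
      _ = _ := by ring
  have hP : ∀ j, polyLen (H j %ₘ gs.prod) ≤ D := fun j => by
    rw [polyLen_le_iff, ← hFd, ← degree_eq_natDegree hFm.ne_zero]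
    exact degree_modByMonic_lt _ hFm
  have hmod : ∀ g : K[X], g.Monic → g ∣ gs.prod → ∀ j, H j %ₘ gs.prod %ₘ g = H j %ₘ g :=
    fun g hg hdvd j => modByMonic_eq_of_dvd_sub hg (hdvd.trans (dvd_modByMonic_sub _ _))
  have hmodl : ∀ l : List K[X], (∀ g ∈ l, g.Monic) → l.prod ∣ gs.prod →
      (l.map fun g => (g, fun j => H j %ₘ gs.prod %ₘ g)) = l.map fun g => (g, fun j => H j %ₘ g) := by
    intro l h1 h2
    refine List.map_congr_left fun g hg => ?_
    rw [funext (hmod g (h1 g hg) ((List.dvd_prod hg).trans h2))]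
  have hround : (gs.map fun g => roundCost D m S.card cm g.natDegree).sum
      ≤ D * cm + 4 * (D * S.card) + (140 + 40 * m) * (D * D) := by
    have h1 : (fun g : K[X] => roundCost D m S.card cm g.natDegree)
        = fun g => (cm + (70 + 20 * m) * D) + (4 * S.card + (70 + 20 * m) * D) * g.natDegree := by
      funext g; rw [roundCost]; ring
    rw [h1, sum_map_affine, ← hsum]
    calc _ ≤ D * (cm + (70 + 20 * m) * D) + (4 * S.card + (70 + 20 * m) * D) * D := by gcongr; omega
      _ = _ := by ring
  have hsplit : (gs.map fun g => 30 * ((D + 1) * (g.natDegree + 1))).sum ≤ 120 * (D * D) := by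
    have h1 : (fun g : K[X] => 30 * ((D + 1) * (g.natDegree + 1)))
        = fun g => 30 * (D + 1) + 30 * (D + 1) * g.natDegree := by
      funext g; ring
    rw [h1, sum_map_affine, ← hsum]
    calc _ ≤ D * (30 * (D + D)) + 30 * (D + D) * D := by gcongr <;> omega
      _ = _ := by ring
  have hresult : m * (D * (2 + polyLen (radical gs.prod) * 2)) ≤ 6 * (m * (D * D)) := by
    calc _ ≤ m * (D * (6 * D)) := by gcongr; omega
      _ = _ := by ring
  have hrcost : 300 * gs.prod.natDegree ^ 2 + 4 * Nat.log 2 E * gs.prod.natDegree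
      = 300 * (D * D) + 4 * (D * Nat.log 2 E) := by rw [hFd]; ring
  refine RunLe.mono_cost (c := (2 * D - 1) * (2 * S.card)
    + ((D * cm + 4 * (D * S.card) + (140 + 40 * m) * (D * D)) + (6 * (m * (D * D))
    + ((300 * (D * D) + 4 * (D * Nat.log 2 E)) + (120 * (D * D) + (6 * (m * (D * D))
    + 6 * (m * (D * D)))))))) ?_ ?_
  · rw [methodC]
    refine RunLe.seq (runLe_krylovC hτ hS (hunit w) _) fun kr w₁ hw₁ hkr => ?_
    refine RunLe.seq ((runLe_roundsC hmul hT (fun i j => (hτ i j).mono hw₁) hS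
      (fun i hi => hkr i (by omega)) (H := H) D 0 (f := 1) ⟨by simp, stores_one w₁, ?_,
        fun j => ?_, fun j => ?_⟩ monic_one (one_dvd _) hgs hlen).mono_cost hround)
      fun rs w₂ hw₂ hrs => ?_
    · rw [map_one, one_mulVec]; exact hunit w₁
    · rw [modByMonic_one]; exact stores_zero w₁
    · rw [divByMonic_one, one_mul]; exact fun i => (hv j i).mono hw₁
    obtain ⟨hrs1, hrs2⟩ := hrs
    rw [one_mul] at hrs2
    refine RunLe.seq ((runLe_reduceListC hrs2.H_stores hP hgm hrs1).mono_cost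
      (hred gs hgm hlen hsum.ge)) fun sys w₃ hw₃ hsys => ?_
    have hR := runLe_radicalC hp D hE D (hrs2.f_stores.mono hw₃) hFm hFlen.symm hFd.le hFd.le
    rw [hrcost] at hR
    refine RunLe.seq hR fun r w₄ hw₄ hr => ?_
    have hbranch : RunLe w₄ (splitIfC D r rs.1) (120 * (D * D)) fun z w' => PolysStored w' z q := by
      by_cases h : radical gs.prod = gs.prod
      · rw [splitIfC, if_pos (by rw [hr.1, h, hFlen])]
        simp only [q, if_pos h]
        exact RunLe.pure (hrs1.mono (hw₃.trans hw₄))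
      · have hne : r.1 ≠ D + 1 := by
          intro h1
          refine h (eq_of_dvd_of_natDegree_le_of_leadingCoeff hradF ?_ (hrad.trans hFm.symm))
          have := hr.1
          omega
        rw [splitIfC, if_neg hne]
        simp only [q, if_neg h]
        refine (runLe_splitC (N := D) hr.2 hr.1 hrad hgm (hrs1.mono (hw₃.trans hw₄)) hradd
          fun g hg => ?_).mono_cost hsplit
        rw [← hFd]
        exact natDegree_le_of_dvd (List.dvd_prod hg) hFm.ne_zero
    refine RunLe.seq hbranch fun z w₅ hw₅ hz => ?_
    refine RunLe.seq ((runLe_reduceListC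
      (fun j => (hrs2.H_stores j).mono (hw₃.trans (hw₄.trans hw₅))) hP hq.1 hz).mono_cost
      (hred q hq.1 hq.2.2 hqsum)) fun parts w₆ hw₆ hparts => ?_
    refine RunLe.bind (c₂ := 0) ((runLe_reduceC
      (fun j => (hrs2.H_stores j).mono (hw₃.trans (hw₄.trans (hw₅.trans hw₆)))) hP hrad hr.1
      (hr.2.mono (hw₅.trans hw₆))).mono_cost hresult) (fun res w₇ hw₇ hres => RunLe.pure ?_) le_rfl
    have hsys' : List.Forall₂ (SystemStored w₇ fun j => H j %ₘ gs.prod) sys gs :=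
      hsys.imp fun _ _ h => h.mono (hw₄.trans (hw₅.trans (hw₆.trans hw₇)))
    have hparts' : List.Forall₂ (SystemStored w₇ fun j => H j %ₘ gs.prod) parts q :=
      hparts.imp fun _ _ h => h.mono hw₇
    rw [MethodTrace.map, methodTrace, MethodTrace.mk.injEq]
    refine ⟨?_, ?_, ?_⟩
    · rw [map_systemRegs_eq hsys', hmodl gs hgm dvd_rfl]
    · rw [map_systemRegs_eq hparts', hmodl q hq.1 (hq.2.1 ▸ hradF)]
    · rw [hres.polyOfRegisters_eq, funext (hmod _ hrad hradF)]
  · have e1 : (2 * D - 1) * (2 * S.card) ≤ 4 * (D * S.card) := by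
      calc _ ≤ (2 * D) * (2 * S.card) := by gcongr; omega
        _ = _ := by ring
    have e2 : (140 + 40 * m) * (D * D) = 140 * (D * D) + 40 * (m * (D * D)) := by ring
    have e3 : (m + 1) * (D * D) = m * (D * D) + D * D := by ring
    rw [methodCost, e2, e3]
    omega

end WholeMethod

/-! ## The algorithm -/

section Algorithm

/-- A multiplication program for polynomials of length at most `n` over the fields of
characteristic `p`. -/
def polyMulC {ι : Type} (p n : ℕ) : (ℕ → ι ⊕ ℕ) → (ℕ → ι ⊕ ℕ) → Comp ι (ℕ → ι ⊕ ℕ) :=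
  if h : 0 < n then Classical.choose (exists_polyMul.{u} (ι := ι) p n h) else fun a _ => pure a

theorem computesProduct_polyMulC {ι : Type} {K : Type u} [Field K] {p n : ℕ} (hn : 0 < n)
    (hp : ringChar K = p) :
    ComputesProduct K n (polyMulCost n) (polyMulC.{u} (ι := ι) p n) := by
  rw [polyMulC, dif_pos hn]
  exact Classical.choose_spec (exists_polyMul.{u} (ι := ι) p n hn) K hp

/-- An exponent of `p`-th roots in the field with `q` elements; it is not used if `p` is zero or
greater than `D`. -/
def rootExponent (D p q : ℕ) : ℕ := if p = 0 ∨ D < p then 0 else q / p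

/-- The program for the method: it sets up the constant `1` first. -/
def methodAlgorithm : MethodAlgorithm := fun m D p q S =>
  .one 1 ((methodC (m := m) (polyMulC.{u} p (2 * D)) p (rootExponent D p q) S 2).bind
    fun r => .ret r.1)

variable {K : Type u} [Field K] {D m : ℕ}

theorem ringChar_dvd_card (K : Type u) [Field K] [Finite K] : ringChar K ∣ Nat.card K := by
  have := Fintype.ofFinite K
  rw [← ringChar.spec, Nat.card_eq_fintype_card, Nat.cast_card_eq_zero]

/-- In the field with q elements, (x^(q/p))^p = x^q = x. -/
theorem pow_rootExponent_pow
    (hK : ringChar K = 0 ∨ D < ringChar K ∨ Finite K) :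
    ringChar K = 0 ∨ D < ringChar K ∨
      ∀ x : K, (x ^ rootExponent D (ringChar K) (Nat.card K)) ^ ringChar K = x := by
  by_cases h : ringChar K = 0 ∨ D < ringChar K
  · exact h.elim Or.inl fun h => Or.inr (Or.inl h)
  · have : Finite K := by tauto
    have := Fintype.ofFinite K
    refine Or.inr (Or.inr fun x => ?_)
    rw [rootExponent, if_neg h, ← pow_mul, Nat.div_mul_cancel (ringChar_dvd_card K),
      Nat.card_eq_fintype_card, FiniteField.pow_card]

open Classical in
/-- The state after the constant `1` has been put into the register reserved for it. -/
def World.start {ι : Type} (μ : ι ⊕ ℕ → K) (hμ : μ (Sum.inr 0) = 0) : World ι K where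
  next := 2
  val := Function.update μ (Sum.inr 1) 1
  one_lt := one_lt_two
  val_zero := by simpa using hμ
  val_one := by simp

theorem World.holds_start {ι : Type} {μ : ι ⊕ ℕ → K} (hμ : μ (Sum.inr 0) = 0) (i : ι) :
    Holds (World.start μ hμ) (Sum.inl i) (μ (Sum.inl i)) :=
  ⟨trivial, by simp [World.start]⟩

theorem performs_methodAlgorithm {T : Matrix (Fin D) (Fin D) K} {H : Fin m → K[X]}
    {gs : List K[X]} (hD : 0 < D) (hT : IsCyclicVector T (unitVec K D))
    (hgs : FactorChain T (unitVec K D) 0 1 gs)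
    (hK : ringChar K = 0 ∨ D < ringChar K ∨ Finite K) :
    ∃ c, Performs methodAlgorithm.{u} T (fun j => aeval T (H j) *ᵥ unitVec K D)
        (methodTrace H gs) c ∧
      c ≤ methodCost m D (nonzeroEntries T).card (polyMulCost (2 * D))
        (rootExponent D (ringChar K) (Nat.card K)) + 1 := by
  let v : Fin m → Fin D → K := fun j => aeval T (H j) *ᵥ unitVec K D
  let w : World (MethodInput m D) K := World.start (initialRegisters T v) rfl
  obtain ⟨out, w', n, h1, -, h2, h3⟩ := runLe_methodC (w := w) (H := H) (S := nonzeroEntries T) hD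
    (computesProduct_polyMulC (by omega) rfl) rfl (pow_rootExponent_pow hK) hT
    (fun i j h => by simpa [nonzeroEntries] using h) hgs
    (fun i j => World.holds_start rfl (Sum.inl (i, j))) (fun j i => World.holds_start rfl (Sum.inr (j, i)))
  refine ⟨n + 1, ⟨out, w'.val, ?_, h2⟩, Nat.succ_le_succ h3⟩
  rw [methodAlgorithm, AlgProgram.run, AlgProgram.run_bind]
  exact congrArg (fun o => (o.bind fun r => ((AlgProgram.ret r.1.1).run r.2.1).map fun r' =>
    (r'.1, r'.2.1, r.2.2 + r'.2.2)).map fun r => (r.1, r.2.1, r.2.2 + 1)) h1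

end Algorithm

/-! ## The number of operations -/

section Bound

/-- log D log log D is negative for D = 2; a lower bound above −1 lets the summand n ≥ 1 of
`methodBound` compensate for it. -/
theorem neg_half_le_mul_log {x : ℝ} (hx : 0 ≤ x) : -(1 / 2) ≤ x * Real.log x := by
  rcases hx.eq_or_lt with rfl | hx
  · norm_num
  · have h := Real.log_le_sub_one_of_pos (x := (1 / 2) / x) (by positivity)
    rw [Real.log_div (by norm_num) hx.ne', one_div, Real.log_inv, le_sub_iff_add_le,
      le_div_iff₀ hx] at h
    nlinarith [Real.log_two_lt_d9, mul_pos hx hx]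

/-- Taken at x = log D, this absorbs single logarithms into log D log log D + 1. -/
theorem sub_one_le_mul_log {x : ℝ} (hx : 0 ≤ x) : x - 1 ≤ x * Real.log x := by
  rcases hx.eq_or_lt with rfl | hx
  · norm_num
  · have h := Real.one_sub_inv_le_log_of_pos hx
    calc x - 1 = x * (1 - x⁻¹) := by rw [mul_sub, mul_inv_cancel₀ hx.ne', mul_one]
      _ ≤ _ := mul_le_mul_of_nonneg_left h hx.le

theorem natLog_two_le {E : ℕ} (hE : E ≠ 0) : (Nat.log 2 E : ℝ) ≤ 2 * Real.log E := by
  have h : ((2 : ℝ) ^ Nat.log 2 E) ≤ E := by exact_mod_cast Nat.pow_log_le_self 2 hE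
  have h1 := Real.log_le_log (by positivity) h
  rw [Real.log_pow] at h1
  nlinarith [Real.log_two_gt_d9, (Nat.cast_nonneg (Nat.log 2 E) : (0 : ℝ) ≤ _)]

/-- With x = log D: a ≤ 2x and log₂ a + 1 ≤ 2 log x + 3, and 4x log x + 6x ≤ 10(x log x + 1) by
`sub_one_le_mul_log`. -/
theorem mul_natLog_le {D a : ℕ} (ha : 2 ^ a ≤ D) :
    (a * (Nat.log 2 a + 1) : ℝ) ≤ 10 * (Real.log D * Real.log (Real.log D) + 1) := by
  have hx : 0 ≤ Real.log D := Real.log_natCast_nonneg D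
  have h0 := sub_one_le_mul_log hx
  rcases Nat.eq_zero_or_pos a with rfl | hpos
  · simp only [Nat.cast_zero, zero_mul]; linarith
  have hD : D ≠ 0 := (lt_of_lt_of_le (by positivity) ha).ne'
  have h1 : (a : ℝ) ≤ 2 * Real.log D :=
    le_trans (by exact_mod_cast Nat.le_log_of_pow_le one_lt_two ha) (natLog_two_le hD)
  have ha1 : (1 : ℝ) ≤ a := by exact_mod_cast hpos
  have hx' : 0 < Real.log D := by linarith
  have h2 : Real.log a ≤ Real.log 2 + Real.log (Real.log D) := by
    rw [← Real.log_mul two_ne_zero hx'.ne']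
    exact Real.log_le_log (by linarith) h1
  have h3 := natLog_two_le hpos.ne'
  have h4 : (Nat.log 2 a + 1 : ℝ) ≤ 2 * Real.log (Real.log D) + 3 := by
    linarith [Real.log_two_lt_d9]
  calc (a * (Nat.log 2 a + 1) : ℝ) ≤ 2 * Real.log D * (2 * Real.log (Real.log D) + 3) := by
        gcongr
    _ ≤ _ := by linarith

/-- The offset 3 in `fastMulCost` brings the power of two below D. The constants are 6·20600·10 and
6·20000. -/
theorem polyMulCost_two_mul_le {D : ℕ} (hD : 0 < D) :
    (polyMulCost (2 * D) : ℝ)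
      ≤ D * (1236000 * (Real.log D * Real.log (Real.log D) + 1) + 120000) := by
  have hpow : 2 ^ (Nat.clog 2 (2 * D) - 3) ≤ D := by
    rcases Nat.lt_or_ge 3 (Nat.clog 2 (2 * D)) with h | h
    · have h1 := Nat.pow_pred_clog_lt_self (b := 2) one_lt_two (x := 2 * D) (by omega)
      have h2 : 2 ^ (Nat.clog 2 (2 * D)).pred = 2 ^ (Nat.clog 2 (2 * D) - 3) * 4 := by
        rw [Nat.pred_eq_sub_one, show (4 : ℕ) = 2 ^ 2 from rfl, ← pow_add]
        congr 1
        omega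
      omega
    · rw [Nat.sub_eq_zero_of_le h]
      exact hD
  have h1 := mul_natLog_le hpow
  rw [polyMulCost, fastMulCost]
  push_cast
  calc _ = (D : ℝ) * (123600 * (((Nat.clog 2 (2 * D) - 3 : ℕ) : ℝ)
        * (Nat.log 2 (Nat.clog 2 (2 * D) - 3) + 1)) + 120000) := by ring
    _ ≤ D * (123600 * (10 * (Real.log D * Real.log (Real.log D) + 1)) + 120000) := by gcongr
    _ = _ := by ring

/-- Put y = log D log log D. The multiplications contribute at most D²(1236000y + 1356000); since y
≥ −1/2, the margin in 2000000·D²(y + m + 1) covers the rest. -/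
theorem methodCost_le {m D σ E : ℕ} (hD : 0 < D) :
    (methodCost m D σ (polyMulCost (2 * D)) E + 1 : ℝ)
      ≤ 2000000 * methodBound (m + 1) D σ + 4 * (D * Nat.log 2 E) := by
  have h1 := polyMulCost_two_mul_le hD
  have h2 := neg_half_le_mul_log (Real.log_natCast_nonneg D)
  have hm : (0 : ℝ) ≤ m := m.cast_nonneg
  have hD1 : (1 : ℝ) ≤ D := by exact_mod_cast hD
  rw [methodCost, methodBound]
  push_cast
  set y := Real.log D * Real.log (Real.log D)
  have h3 : (D : ℝ) * polyMulCost (2 * D) ≤ D * (D * (1236000 * (y + 1) + 120000)) := by gcongr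
  have h4 : (0 : ℝ) ≤ D * σ := by positivity
  have h5 : (1 : ℝ) ≤ D * D := by nlinarith
  have h6 : (0 : ℝ) ≤ D * D * (m + (y + 1 / 2)) := by
    refine mul_nonneg (by positivity) ?_
    linarith
  have h7 : (0 : ℝ) ≤ D * D * m := by positivity
  have h8 : (0 : ℝ) ≤ D * D * (y + 1 / 2) := mul_nonneg (by positivity) (by linarith)
  nlinarith

end Bound

/-! ### The main theorem: the correctness statement and both cost bounds -/

section MainTheorem

theorem rootExponent_log_le {K : Type u} [Field K] [Finite K] (D : ℕ) :
    (Nat.log 2 (rootExponent D (ringChar K) (Nat.card K)) : ℝ)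
      ≤ 2 * Real.log ((Nat.card K : ℝ) / ringChar K) := by
  have h := ringChar_dvd_card K
  have h0 : (Nat.card K) ≠ 0 := Nat.card_pos.ne'
  have hp : ringChar K ≠ 0 := fun h1 => h0 (by rwa [h1, zero_dvd_iff] at h)
  have hE : Nat.card K / ringChar K ≠ 0 :=
    (Nat.div_pos (Nat.le_of_dvd Nat.card_pos h) (Nat.pos_of_ne_zero hp)).ne'
  rw [← Nat.cast_div h (Nat.cast_ne_zero.2 hp), rootExponent]
  split_ifs
  · simpa using Real.log_natCast_nonneg _
  · exact natLog_two_le hE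

theorem mainTheorem3 :
    ∃ (A : MethodAlgorithm) (C : ℝ),
      ∀ (K : Type u) [Field K] (m D : ℕ) (ord : MonomialOrder.{0, w} (Fin (m + 1)))
        (I : Ideal (MvPolynomial (Fin (m + 1)) K)) (ε : Fin D → (Fin (m + 1) →₀ ℕ))
        (T : Fin (m + 1) → Matrix (Fin D) (Fin D) K),
        I ≠ ⊤ → InShapePosition I → IsCanonicalBasis ord I ε →
        (∀ i, IsMultiplicationMatrix I ε i (T i)) →
        ∃ t : MethodTrace K[X] m,
          IsMethodRun (T 0) (fun j => T j.succ *ᵥ unitVec K D) t ∧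
          (∀ t', IsMethodRun (T 0) (fun j => T j.succ *ᵥ unitVec K D) t' → t' = t) ∧
          IsReducedGroebnerBasis (lexOrder (m + 1)) (shapeSet t.result.1 t.result.2) I.radical ∧
          (ringChar K = 0 ∨ D < ringChar K ∨ Finite K →
            ∃ c : ℕ,
              Performs A (T 0) (fun j => T j.succ *ᵥ unitVec K D) t c ∧
              (ringChar K = 0 ∨ D < ringChar K →
                (c : ℝ) ≤ C * methodBound (m + 1) D (nonzeroEntries (T 0)).card) ∧
              (Finite K →
                (c : ℝ) ≤ C * (methodBound (m + 1) D (nonzeroEntries (T 0)).card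
                  + D * Real.log ((Nat.card K : ℝ) / ringChar K)))) := by

  refine ⟨methodAlgorithm.{u}, 2000000, fun K _ m D ord I ε T hI hs hε hT => ?_⟩
  have hcyc := isCyclicVector_of_inShapePosition hI hs hε hT
  obtain ⟨hD, -⟩ := exists_eq_zero_of_ne_top hI hε
  obtain ⟨H, hH⟩ : ∃ H : Fin m → K[X], ∀ j, T j.succ *ᵥ unitVec K D
      = aeval (T 0) (H j) *ᵥ unitVec K D := 
    Classical.skolem.1 fun j : Fin m => (hcyc (T j.succ *ᵥ unitVec K D)).imp fun _ h => h.symm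
  have hv : (fun j : Fin m => T j.succ *ᵥ unitVec K D)
      = fun j => aeval (T 0) (H j) *ᵥ unitVec K D := funext hH
  have hF := minpoly.monic (isIntegral_matrix (T 0))
  obtain ⟨gs, hgs⟩ := exists_factorChain (T := T 0) (e := unitVec K D) hF.ne_zero
    (by rw [minpoly.aeval, zero_mulVec])
  have hprod : gs.prod = minpoly K (T 0) := by
    rw [← hgs.mul_prod_eq hcyc monic_one (one_dvd _), one_mul]
  have hrun := isMethodRun_iff hcyc H hgs
  rw [hv]
  refine ⟨methodTrace H gs, (hrun _).2 rfl, fun t' => (hrun t').1, ?_, fun hK => ?_⟩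
  · have := isReducedGroebnerBasis_radical hI hs hε hT hH
    rwa [← hprod] at this
  · obtain ⟨c, hc, hcost⟩ := performs_methodAlgorithm (H := H) hD hcyc hgs hK
    have hcost' : (c : ℝ) ≤ _ := (Nat.cast_le.2 hcost).trans
      ((Nat.cast_succ _).le.trans (methodCost_le hD))
    refine ⟨c, hc, fun h => ?_, fun h => ?_⟩
    -- No p-th roots are taken here: the exponent is 0, and the logarithmic term disappears.
    · rw [rootExponent, if_pos h] at hcost'
      simpa using hcost'
    · refine hcost'.trans ?_
      have h1 := rootExponent_log_le (K := K) D
      have h2 := mul_le_mul_of_nonneg_left h1 (Nat.cast_nonneg D : (0 : ℝ) ≤ D)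
      -- log(q/p) ≥ 0, because twice it bounds a natural number; so its coefficient 8 can be raised
      -- to the common constant.
      have h3 := (mul_nonneg_iff_of_pos_left (by norm_num : (0 : ℝ) < 2)).1
        ((Nat.cast_nonneg _).trans h1)
      have h4 := mul_nonneg (Nat.cast_nonneg D : (0 : ℝ) ≤ D) h3
      linarith

end MainTheorem

end
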